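/- **Model.** A *connection schedule* on $N$ nodes with period $T\ge 1$ is a sequence of permutations $\pi_0,\dots,\pi_{T-1}$ of $[N]$; put $\pi_t=\pi_{t \bmod T}$ for $t\in\mathbb Z$. Its *virtual topology* is the directed graph on $[N]\times\mathbb Z$ with the virtual edges $(i,t)\to(i,t+1)$ and the physical edges $(i,t)\to(\pi_t(i),t+1)$. A *flow* assigns an amount in $[0,\infty)$ to every finite path; it is *feasible* if the total amount on paths through any physical edge is at most $1$. The *latency* of a path is its number of edges. An *oblivious routing scheme* $R$ assigns to every $(a,b,t)\in[N]\times[N]\times\mathbb Z$ a flow $R_{a,b,t}$ of total amount $1$, supported on paths from $(a,t)$ to $\{b\}\times\mathbb Z$, such that $R_{a,b,t+T}$ is $R_{a,b,t}$ translated by $T$ timeslots. An *ORN design* is a connection schedule with an oblivious routing scheme. Its *maximum latency* $L_{\max}$ is the supremum of the latencies of the paths $P$ with $R_{a,b,t}(P)>0$ for some $a,b,t$. It *guarantees throughput $r$* if for every demand function $D:\mathbb Z\to[0,\infty)^{N\times N}$ such that all row and column sums of all matrices $D(t)$ are at most $r$, the flow $\sum_{a,b,t}D(t)_{a,b}R_{a,b,t}$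 is feasible. *EBS design of order $\ell\ge1$* ($N=n^\ell$, $n\ge 2$; nodes identified with $(\mathbb Z/n)^\ell$): $T=\ell(n-1)$ and $\pi_{(n-1)p+s-1}(i)=i+s\,\mathbf e_p$ for $0\le p<\ell$, $1\le s<n$. A semi-path from $(a,t)$ to $b$ takes the physical edge exactly when this decreases the Hamming distance to $b$, until $b$ is reached. $R_{a,b,t}$ puts weight $1/N$, for each node $c$, on the path that follows the semi-path from $(a,t)$ to $c$, waits at $c$ until timeslot $t+T$, and follows the semi-path from $(c,t+T)$ to $b$. *VBS design of order $h'\ge1$ with parameter $\delta>0$* ($N=n^{h'+1}$, $n$ prime; nodes identified with $\mathbb F_n^{h'+1}$): $T=n(n-1)$ and $\pi_{(n-1)p+s-1}(i)=i+s\,v(p)$ for $0\le p<n$, $1\le s<n$, where $v(p)=(1,p,\dots,p^{h'})$. Phase $q\in\mathbb Z$ consists of the $n-1$ timeslots from $q(n-1)$ on. Let $Q$ be the least integer with $\binom{Q}{h'}\ge\delta n$, and assume $h'+1+Q<n$. A semi-path from $a$ to $b$ starts at the beginning of a phase $q$ and occupies $h'+1+Q$ phases, with at most one physical hop per phase. It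 is *single-basis* if its hops lie in the first $h'+1$ phases and are given by the coordinates of $b-a$ in the basis $v(q),\dots,v(q+h')$; it is *hop-efficient* if it has exactly $h'$ hops, all in the last $Q$ phases. For each $(q,a,b)$ one semi-path is chosen: a hop-efficient one if there is any, the single-basis one otherwise. $R_{a,b,t}$ puts weight $1/N$, for each node $c$, on the path that waits at $a$ until the next beginning of a phase (not at all if $t$ begins a phase), and then follows the chosen semi-path from $a$ to $c$ and the chosen semi-path from $c$ to $b$. **Theorem.** For every $r\in(0,\tfrac12]$ there is a unique pair $(h,\varepsilon)\in\mathbb N\times(0,1]$ with $\frac1{2r}=h+1-\varepsilon$. Put $$L^*(r,N)=h\left(N^{1/(h+1)}+(\varepsilon N)^{1/h}\right).$$ There are absolute constants $c,C>0$ such that for every $r\in(0,\tfrac12]$: 1. (lower bound) there is a constant $c'>0$, depending only on $r$, such that for every $N>1$ every $N$-node ORN design that guarantees throughput $r$ has $L_{\max}\ge c'\,L^*(r,N)$; moreover, for all $N\ge N_0(r)$ every such design has $L_{\max}\ge c\,L^*(r,N)$; 2. (upper bound) for infinitely many $N$ there is an $N$-node ORN design that is an EBS design or a VBS design, guarantees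 throughput $r$, and has $L_{\max}\le C\,L^*(r,N)$. -/

import Mathlib

open scoped NNReal ENNReal BigOperators

noncomputable section

namespace ORN

/-! ### Connection schedules and the virtual topology -/

/-- A connection schedule on `N` nodes with period `T ≥ 1`: permutations `π₀, …, π_{T-1}` of the
node set. -/
structure ConnectionSchedule (N : ℕ) where
  T : ℕ
  T_pos : 0 < T
  perm : Fin T → Equiv.Perm (Fin N)

variable {N : ℕ}

namespace ConnectionSchedule

/-- The permutation in force in timeslot `t ∈ ℤ`, namely `π_k` with `k ≡ t (mod T)`. -/
def at_ (S : ConnectionSchedule N) (t : ℤ) : Equiv.Perm (Fin N) :=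
  S.perm ⟨(t % (S.T : ℤ)).toNat, by
    have hT : (0 : ℤ) < (S.T : ℤ) := by exact_mod_cast S.T_pos
    have h1 := Int.emod_nonneg t hT.ne'
    have h2 := Int.emod_lt_of_pos t hT
    omega⟩

theorem at_add_period (S : ConnectionSchedule N) (t : ℤ) : S.at_ (t + S.T) = S.at_ t := by
  simp [at_]

/-- Virtual edges `(i, t) → (i, t + 1)`. -/
def IsVirtual (_S : ConnectionSchedule N) (x y : Fin N × ℤ) : Prop :=
  y = (x.1, x.2 + 1)

/-- Physical edges `(i, t) → (π_t i, t + 1)`. -/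
def IsPhysical (S : ConnectionSchedule N) (x y : Fin N × ℤ) : Prop :=
  y = (S.at_ x.2 x.1, x.2 + 1)

/-- The virtual topology: the directed graph on `[N] × ℤ` whose edges are the virtual edges and
the physical edges. -/
def virtualTopology (S : ConnectionSchedule N) : Digraph (Fin N × ℤ) where
  Adj x y := S.IsVirtual x y ∨ S.IsPhysical x y

end ConnectionSchedule

/-- A (finite, directed) path in the virtual topology, with `length` edges. Time increases by one
along every edge, so a walk never repeats a vertex or an edge. -/
structure Path (S : ConnectionSchedule N) where
  length : ℕ
  vertex : Fin (length + 1) → Fin N × ℤ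
  adj : ∀ k : Fin length, S.virtualTopology.Adj (vertex k.castSucc) (vertex k.succ)

namespace Path

variable {S : ConnectionSchedule N}

/-- The first vertex of a path. -/
def source (P : Path S) : Fin N × ℤ := P.vertex 0

/-- The last vertex of a path. -/
def target (P : Path S) : Fin N × ℤ := P.vertex (Fin.last P.length)

/-- The latency of a path: its number of edges, virtual and physical. -/
def latency (P : Path S) : ℕ := P.length

/-- The path `P` contains the edge `x → y`. -/
def Traverses (P : Path S) (x y : Fin N × ℤ) : Prop :=
  ∃ k : Fin P.length, P.vertex k.castSucc = x ∧ P.vertex k.succ = y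

/-- `P` belongs to `𝒫(a, b, t)`: it leads from `(a, t)` to some copy `(b, t')` of `b`. -/
def Joins (P : Path S) (a b : Fin N) (t : ℤ) : Prop :=
  P.source = (a, t) ∧ P.target.1 = b

/-- The path `P` transposed by one period, i.e. by `T` timeslots. -/
def shift (P : Path S) : Path S where
  length := P.length
  vertex k := ((P.vertex k).1, (P.vertex k).2 + S.T)
  adj k := by
    rcases P.adj k with h | h
    · left
      unfold ConnectionSchedule.IsVirtual at h ⊢
      rw [h]
      ext
      · rfl
      · simp only; ring
    · right
      unfold ConnectionSchedule.IsPhysical at h ⊢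
      rw [h]
      ext
      · simp only [S.at_add_period]
      · simp only; ring

/-- `P` visits the nodes `f 0, f 1, …, f m` in the timeslots `t, t + 1, …, t + m`. -/
def Visits (P : Path S) (t : ℤ) (m : ℕ) (f : ℕ → Fin N) : Prop :=
  P.length = m ∧ ∀ k : Fin (P.length + 1), P.vertex k = (f k, t + (k : ℕ))

end Path

/-! ### Flows, oblivious routing schemes, throughput, latency -/

/-- A flow assigns a finite nonnegative amount to every path. -/
abbrev Flow (S : ConnectionSchedule N) := Path S → ℝ≥0

open Classical in
/-- The amount of flow traversing the edge `x → y` (possibly `∞`). -/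
def Flow.load {S : ConnectionSchedule N} (f : Flow S) (x y : Fin N × ℤ) : ℝ≥0∞ :=
  ∑' P : Path S, if P.Traverses x y then (f P : ℝ≥0∞) else 0

/-- A flow is feasible if it puts at most one unit on every physical edge. -/
def Flow.Feasible {S : ConnectionSchedule N} (f : Flow S) : Prop :=
  ∀ x y, S.IsPhysical x y → f.load x y ≤ 1

/-- An oblivious routing scheme: for all `a, b, t` one unit of flow `R_{a,b,t}` on paths from
`(a, t)` to copies of `b`, periodically in `t`. -/
structure RoutingScheme (S : ConnectionSchedule N) where
  flow : Fin N → Fin N → ℤ → Flow S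
  supported : ∀ a b t P, ¬ P.Joins a b t → flow a b t P = 0
  unit : ∀ a b t, ∑' P : Path S, (flow a b t P : ℝ≥0∞) = 1
  periodic : ∀ a b t P, flow a b (t + S.T) P.shift = flow a b t P

/-- A demand function: `D t a b` is the amount of flow with source `a` and destination `b` that
originates in timeslot `t`. -/
abbrev Demand (N : ℕ) := ℤ → Matrix (Fin N) (Fin N) ℝ≥0

/-- All row sums and all column sums of all `D t` are at most `r`. -/
def Demand.RequestsAtMost (D : Demand N) (r : ℝ) : Prop :=
  ∀ t, (∀ a, ((∑ b, D t a b : ℝ≥0) : ℝ) ≤ r) ∧ (∀ b, ((∑ a, D t a b : ℝ≥0) : ℝ) ≤ r)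

/-- The flow induced by a routing scheme and a demand function. For a fixed path at most one
summand is nonzero. -/
def RoutingScheme.inducedFlow {S : ConnectionSchedule N} (R : RoutingScheme S) (D : Demand N) :
    Flow S :=
  fun P => ∑' q : Fin N × Fin N × ℤ, D q.2.2 q.1 q.2.1 * R.flow q.1 q.2.1 q.2.2 P

/-- An ORN design on `N` nodes: a connection schedule with an oblivious routing scheme. -/
structure Design (N : ℕ) where
  schedule : ConnectionSchedule N
  routing : RoutingScheme schedule

namespace Design

/-- The design guarantees throughput `r`: the induced flow is feasible for every demand function
that requests throughput at most `r`. -/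
def GuaranteesThroughput (X : Design N) (r : ℝ) : Prop :=
  ∀ D : Demand N, D.RequestsAtMost r → (X.routing.inducedFlow D).Feasible

/-- The maximum latency of the design: the supremum of the latencies of all routing paths in use
(`⊤` if they are unbounded). -/
def maxLatency (X : Design N) : ℕ∞ :=
  ⨆ (P : Path X.schedule) (_ : ∃ a b t, 0 < X.routing.flow a b t P), (P.latency : ℕ∞)

end Design

/-! ### The Elementary Basis Scheme -/

/-- The node reached after `k` steps by the greedy semi-path towards `b` that starts at `(a, t)`:
the physical edge is taken if and only if it decreases the Hamming distance to `b`.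
Once at `b`, the semi-path waits there. -/
def greedyNode {ℓ n : ℕ} (S : ConnectionSchedule N) (φ : Fin N ≃ (Fin ℓ → ZMod n))
    (a b : Fin N) (t : ℤ) : ℕ → Fin N
  | 0 => a
  | k + 1 =>
    let i := greedyNode S φ a b t k
    let j := S.at_ (t + k) i
    if hammingDist (φ j) (φ b) < hammingDist (φ i) (φ b) then j else i

/-- `P` is the path for `(a, b, t)` via the intermediate node `c`: the greedy semi-path from
`(a, t)` to `c`, waiting at `c` until timeslot `t + T`, then the greedy semi-path from `(c, t + T)`
to `b`, which stops on first reaching `b` (after `m` steps). -/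
def IsEBSPath {ℓ n : ℕ} {S : ConnectionSchedule N} (φ : Fin N ≃ (Fin ℓ → ZMod n))
    (a b : Fin N) (t : ℤ) (c : Fin N) (P : Path S) : Prop :=
  greedyNode S φ a c t S.T = c ∧
  ∃ m : ℕ, IsLeast {k : ℕ | greedyNode S φ c b (t + S.T) k = b} m ∧
    P.Visits t (S.T + m) (fun k =>
      if k < S.T then greedyNode S φ a c t k else greedyNode S φ c b (t + S.T) (k - S.T))

open Classical in
/-- `X` is an EBS design of order `ℓ` on `N = n ^ ℓ` nodes; `φ` identifies the nodes with
`(ℤ/n)^ℓ`. -/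
def Design.IsEBS (X : Design N) (ℓ n : ℕ) : Prop :=
  1 ≤ ℓ ∧ 2 ≤ n ∧ ∃ φ : Fin N ≃ (Fin ℓ → ZMod n),
    X.schedule.T = ℓ * (n - 1) ∧
    (∀ (p : Fin ℓ) (s : ℕ), 1 ≤ s → s < n → ∀ i : Fin N,
      φ (X.schedule.at_ (((n - 1) * (p : ℕ) + s - 1 : ℕ) : ℤ) i)
        = φ i + Pi.single p (s : ZMod n)) ∧
    (∀ a b t P, X.routing.flow a b t P =
      (Finset.univ.filter (fun c : Fin N => IsEBSPath φ a b t c P)).card / (N : ℝ≥0))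

/-! ### The Vandermonde Bases Scheme -/

/-- The Vandermonde vector `(1, p, p², …, p^h)` over `ℤ/n`. -/
def vandermondeVec (n h : ℕ) (p : ℤ) : Fin (h + 1) → ZMod n :=
  fun j => (p : ZMod n) ^ (j : ℕ)

/-- Hop vector `s` of a single-basis semi-path with distance vector `d` that starts with phase `q`:
`s j` is the scale factor of the hop in phase `q + j` (`0` means no hop), the hops lie in the
phases `q, …, q + h`, and `s` is the coordinate vector of `d` in the basis
`v(q), …, v(q + h)`. -/
def IsSingleBasis (n h : ℕ) (q : ℤ) (d : Fin (h + 1) → ZMod n) (s : ℕ → ZMod n) : Prop :=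
  (∀ j, s j ≠ 0 → j < h + 1) ∧
  ∑ j ∈ Finset.range (h + 1), s j • vandermondeVec n h (q + j) = d

/-- Hop vector `s` of a hop-efficient semi-path with distance vector `d` that starts with phase
`q`: after `h + 1` phases without hops, exactly `h` of the next `Q` phases contain a hop. -/
def IsHopEfficient (n h Q : ℕ) (q : ℤ) (d : Fin (h + 1) → ZMod n) (s : ℕ → ZMod n) : Prop :=
  (∀ j, s j ≠ 0 → h + 1 ≤ j ∧ j < h + 1 + Q) ∧
  ((Finset.range (h + 1 + Q)).filter (fun j => s j ≠ 0)).card = h ∧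
  ∑ j ∈ Finset.range (h + 1 + Q), s j • vandermondeVec n h (q + j) = d

/-- A choice of one semi-path for each starting phase `q` and each ordered pair `(a, b)`:
hop-efficient whenever there is a hop-efficient one, and single-basis otherwise. -/
def IsSemiPathChoice {n h : ℕ} (Q : ℕ) (φ : Fin N ≃ (Fin (h + 1) → ZMod n))
    (s : ℤ → Fin N → Fin N → ℕ → ZMod n) : Prop :=
  ∀ q a b, IsHopEfficient n h Q q (φ b - φ a) (s q a b) ∨
    ((¬ ∃ s', IsHopEfficient n h Q q (φ b - φ a) s') ∧
      IsSingleBasis n h q (φ b - φ a) (s q a b))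

/-- The node reached after `k` steps by the semi-path with hop vector `s` that starts at `a` at the
beginning of phase `q`, that is, in timeslot `q (n - 1)`. Its `k`-th step lies in phase
`q + k / (n - 1)` and has scale factor `k % (n - 1) + 1`. -/
def semiNode {n : ℕ} (S : ConnectionSchedule N) (a : Fin N) (q : ℤ) (s : ℕ → ZMod n) : ℕ → Fin N
  | 0 => a
  | k + 1 =>
    let i := semiNode S a q s k
    if s (k / (n - 1)) = ((k % (n - 1) + 1 : ℕ) : ZMod n) then
      S.at_ (q * ((n - 1 : ℕ) : ℤ) + k) i
    else i

/-- `P` is the path for `(a, b, t)` via the intermediate node `c`: wait `w ≤ n - 2` timeslots at `a`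
until the beginning of a phase `q`, follow the chosen semi-path from `a` to `c` for `h + 1 + Q`
phases, then the chosen semi-path from `c` to `b` for another `h + 1 + Q` phases. -/
def IsVBSPath {n : ℕ} {S : ConnectionSchedule N} (h Q : ℕ)
    (s : ℤ → Fin N → Fin N → ℕ → ZMod n)
    (a b : Fin N) (t : ℤ) (c : Fin N) (P : Path S) : Prop :=
  ∃ (q : ℤ) (w : ℕ), w < n - 1 ∧ t + w = q * ((n - 1 : ℕ) : ℤ) ∧
    let K := h + 1 + Q
    let M := K * (n - 1)
    semiNode S a q (s q a c) M = c ∧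
    P.Visits t (w + M + M) (fun k =>
      if k < w then a
      else if k < w + M then semiNode S a q (s q a c) (k - w)
      else semiNode S c (q + K) (s (q + K) c b) (k - (w + M)))

open Classical in
/-- `X` is a VBS design of order `h` with parameter `δ` on `N = n ^ (h + 1)` nodes, `n` prime; `φ`
identifies the nodes with `𝔽_n^(h+1)`, `Q` is the number of future phases considered for
hop-efficient semi-paths, and `s` is the choice of the semi-paths. -/
def Design.IsVBS (X : Design N) (h n : ℕ) (δ : ℝ) : Prop :=
  1 ≤ h ∧ n.Prime ∧ 0 < δ ∧ ∃ (φ : Fin N ≃ (Fin (h + 1) → ZMod n)) (Q : ℕ)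
      (s : ℤ → Fin N → Fin N → ℕ → ZMod n),
    IsLeast {Q : ℕ | δ * n ≤ (Q.choose h : ℝ)} Q ∧
    h + 1 + Q < n ∧
    IsSemiPathChoice Q φ s ∧
    X.schedule.T = n * (n - 1) ∧
    (∀ p s : ℕ, p < n → 1 ≤ s → s < n → ∀ i : Fin N,
      φ (X.schedule.at_ (((n - 1) * p + s - 1 : ℕ) : ℤ) i)
        = φ i + (s : ZMod n) • vandermondeVec n h p) ∧
    (∀ a b t P, X.routing.flow a b t P =
      (Finset.univ.filter (fun c : Fin N => IsVBSPath h Q s a b t c P)).card / (N : ℝ≥0))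

/-! ### The latency function -/

/-- `(h, ε) ∈ ℕ × (0, 1]` solves `1 / (2 r) = h + 1 - ε`. -/
def IsHopParam (r : ℝ) (h : ℕ) (ε : ℝ) : Prop :=
  0 < ε ∧ ε ≤ 1 ∧ 1 / (2 * r) = h + 1 - ε

/-- `L* = h (N^{1/(h+1)} + (ε N)^{1/h})`. -/
def Lstar (h : ℕ) (ε : ℝ) (N : ℕ) : ℝ :=
  h * ((N : ℝ) ^ (1 / ((h : ℝ) + 1)) + (ε * N) ^ (1 / (h : ℝ)))

end ORN

end

/-! Lower bound, by linear programming duality. With at most `h` hops in `L` timeslots one reaches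
at most `B = (L + h).choose h` nodes. If `B` is small compared with `N`, then most pairs need at
least `h + 1` hops, and a throughput `r` with `1 / (2 r) = h + 1 - ε` leaves no room for this. To
obtain the factor `2` of `1 / (2 r)`, every physical edge gets a weight matrix on pairs `(a, b)`:
one unit if `a` is near behind the edge and one unit if `b` is near ahead of it, where near means at
most `h` hops in `L` timeslots (`edgeWeight`). A path with at least `h + 1` hops collects at least
`2 (h + 1)`: its first `h + 1` hops see the source and its last `h + 1` hops see the destination
(`Path.two_mul_le_sum_edgeWeight`). Row and column sums of each weight matrix are at most `N + B`,
so `r / (N + B)` times the matrix is an admissible demand, and it loads its own edge by at most `1`.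
Summing these inequalities over all edges in a long time window gives `2 (h + 1) r (N - B) ≤ N + B`
(`Design.throughput_tradeoff`). Hence `B` is at least of order `ε N / h`, which forces `L` to be at
least of order `h (ε N)^(1/h)`. For large `N` this is the dominant term of `L*`; for the remaining
`N` the trivial bound `1` suffices at the cost of the constant.

Upper bound, by routing uniformly via all intermediate nodes. If the schedule and the semi-paths are
translation invariant, the load of an edge reduces to counting the distances whose semi-path hops in
a given timeslot (`SemiPathScheme.design_guaranteesThroughput`). For `ε > 1/8` the EBS design of
order `h` is good enough: semi-paths have at most `h` hops, so that it guarantees `1 / (2 h) ≥ r`,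
and `ε^(1/h)` is bounded below.

For `ε ≤ 1/8` the VBS design of order `h` with `δ = 2 ε` is used. Single-basis semi-paths have at
most `h + 1` hops, hop-efficient ones have `h`, so it suffices that at least a fraction `ε` of the
distances admits a hop-efficient semi-path. Each choice of `h` out of `Q` phases covers `(n - 1)^h`
distances, and two choices share at most `n^(h-1)`; a Bonferroni count with about `2 ε n` choices
covers at least `ε n^(h+1)` distances (`le_card_hopEfficient`). A bound on the average number of
hops bounds the load of every edge because the semi-paths can be chosen with two symmetries:
homogeneity under scalars spreads hops evenly over the scale factors (`exists_homogeneous_choice`),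
and a linear map taking `v(p)` to `v(p + q)` makes all starting phases alike
(`vandermondeShift_vandermondeVec`). -/

noncomputable section

namespace ORN

variable {N : ℕ}

/-! ### Paths as sequences of nodes -/

namespace Path

variable {S : ConnectionSchedule N}

/-- The node visited after `k` steps (constant after the end of the path). -/
def node (P : Path S) (k : ℕ) : Fin N := (P.vertex ⟨min k P.length, by omega⟩).1

theorem adj_snd {x y : Fin N × ℤ} (h : S.virtualTopology.Adj x y) : y.2 = x.2 + 1 := by
  rcases h with h | h
  · rw [h]
  · rw [h]

theorem vertex_snd (P : Path S) (k : ℕ) (hk : k < P.length + 1) :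
    (P.vertex ⟨k, hk⟩).2 = P.source.2 + k := by
  induction k with
  | zero => simp [source]
  | succ k ih =>
    have h := adj_snd (P.adj ⟨k, by omega⟩)
    have e1 : (⟨k, by omega⟩ : Fin P.length).succ = ⟨k + 1, hk⟩ := rfl
    have e2 : (⟨k, by omega⟩ : Fin P.length).castSucc = ⟨k, by omega⟩ := rfl
    rw [e1, e2, ih] at h
    rw [h]; push_cast; ring

theorem vertex_eq (P : Path S) (k : ℕ) (hk : k < P.length + 1) :
    P.vertex ⟨k, hk⟩ = (P.node k, P.source.2 + k) := by
  refine Prod.ext ?_ (P.vertex_snd k hk)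
  have : min k P.length = k := by omega
  simp [node, this]

theorem node_zero (P : Path S) : P.node 0 = P.source.1 := by
  simp [node, source]

theorem node_length (P : Path S) : P.node P.length = P.target.1 := by
  simp [node, target, Fin.last]

theorem node_succ (P : Path S) {k : ℕ} (hk : k < P.length) :
    P.node (k + 1) = P.node k ∨ P.node (k + 1) = S.at_ (P.source.2 + k) (P.node k) := by
  have h := P.adj ⟨k, hk⟩
  have e1 : (⟨k, hk⟩ : Fin P.length).succ = ⟨k + 1, by omega⟩ := rfl
  have e2 : (⟨k, hk⟩ : Fin P.length).castSucc = ⟨k, by omega⟩ := rfl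
  rw [e1, e2, vertex_eq, vertex_eq] at h
  rcases h with h | h
  · left; exact (Prod.ext_iff.1 h).1
  · right; exact (Prod.ext_iff.1 h).1

theorem traverses_iff (P : Path S) (x y : Fin N × ℤ) :
    P.Traverses x y ↔ ∃ k < P.length, x = (P.node k, P.source.2 + k) ∧
      y = (P.node (k + 1), P.source.2 + (k + 1 : ℕ)) := by
  constructor
  · rintro ⟨k, rfl, rfl⟩
    exact ⟨k, k.2, P.vertex_eq k (by omega), P.vertex_eq (k + 1) (by omega)⟩
  · rintro ⟨k, hk, rfl, rfl⟩
    exact ⟨⟨k, hk⟩, P.vertex_eq k (by omega), P.vertex_eq (k + 1) (by omega)⟩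

/-- The steps of a path in which it moves to another node. -/
def moves (P : Path S) : Finset ℕ :=
  (Finset.range P.length).filter fun k => P.node (k + 1) ≠ P.node k

end Path

/-! ### Reachability with few hops -/

/-- Nodes that can be reached from `(x, t)` in `k` timeslots with at most `m` hops. -/
def fwd (S : ConnectionSchedule N) (x : Fin N) (t : ℤ) : ℕ → ℕ → Finset (Fin N)
  | 0, _ => {x}
  | k + 1, 0 => fwd S x t k 0
  | k + 1, m + 1 => fwd S x t k (m + 1) ∪ (fwd S x t k m).map (S.at_ (t + k)).toEmbedding

/-- Nodes from which `(y, t)` can be reached in `k` timeslots with at most `m` hops. -/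
def bwd (S : ConnectionSchedule N) (y : Fin N) (t : ℤ) : ℕ → ℕ → Finset (Fin N)
  | 0, _ => {y}
  | k + 1, 0 => bwd S y t k 0
  | k + 1, m + 1 =>
    bwd S y t k (m + 1) ∪ (bwd S y t k m).map (S.at_ (t - k - 1)).symm.toEmbedding

variable (S : ConnectionSchedule N)

theorem card_fwd_le (x : Fin N) (t : ℤ) (k m : ℕ) :
    (fwd S x t k m).card ≤ (k + m).choose m := by
  induction k generalizing m with
  | zero => simp [fwd]
  | succ k ih =>
    cases m with
    | zero => simpa [fwd] using ih 0
    | succ m =>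
      rw [fwd]
      refine (Finset.card_union_le _ _).trans ?_
      rw [Finset.card_map]
      have h1 := ih (m + 1)
      have h2 := ih m
      have h3 : (k + 1 + (m + 1)).choose (m + 1)
          = (k + m + 1).choose m + (k + m + 1).choose (m + 1) := by
        rw [← Nat.choose_succ_succ]; congr 1; omega
      have h4 : (k + m).choose m ≤ (k + m + 1).choose m := Nat.choose_le_choose _ (by omega)
      have h5 : k + (m + 1) = k + m + 1 := by omega
      rw [h5] at h1
      omega

theorem card_bwd_le (x : Fin N) (t : ℤ) (k m : ℕ) :
    (bwd S x t k m).card ≤ (k + m).choose m := by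
  induction k generalizing m with
  | zero => simp [bwd]
  | succ k ih =>
    cases m with
    | zero => simpa [bwd] using ih 0
    | succ m =>
      rw [bwd]
      refine (Finset.card_union_le _ _).trans ?_
      rw [Finset.card_map]
      have h1 := ih (m + 1)
      have h2 := ih m
      have h3 : (k + 1 + (m + 1)).choose (m + 1)
          = (k + m + 1).choose m + (k + m + 1).choose (m + 1) := by
        rw [← Nat.choose_succ_succ]; congr 1; omega
      have h4 : (k + m).choose m ≤ (k + m + 1).choose m := Nat.choose_le_choose _ (by omega)
      have h5 : k + (m + 1) = k + m + 1 := by omega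
      rw [h5] at h1
      omega

theorem fwd_subset_succ (x : Fin N) (t : ℤ) (k m : ℕ) :
    fwd S x t k m ⊆ fwd S x t (k + 1) m := by
  cases m with
  | zero => rfl
  | succ m => rw [fwd]; exact Finset.subset_union_left

theorem bwd_subset_succ (x : Fin N) (t : ℤ) (k m : ℕ) :
    bwd S x t k m ⊆ bwd S x t (k + 1) m := by
  cases m with
  | zero => rfl
  | succ m => rw [bwd]; exact Finset.subset_union_left

theorem fwd_mono (x : Fin N) (t : ℤ) (m : ℕ) : Monotone fun k => fwd S x t k m :=
  monotone_nat_of_le_succ fun k => fwd_subset_succ S x t k m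

theorem bwd_mono (x : Fin N) (t : ℤ) (m : ℕ) : Monotone fun k => bwd S x t k m :=
  monotone_nat_of_le_succ fun k => bwd_subset_succ S x t k m

variable {S}

/-- Waiting enlarges nothing but the time, and a genuine move uses up one unit of the hop budget.
Only moves are counted, not physical edges, so a physical edge that fixes its node is free. -/
theorem Path.node_mem_fwd (P : Path S) (s : ℕ) (k m : ℕ) (hk : s + k ≤ P.length)
    (hm : (P.moves.filter fun i => s ≤ i ∧ i < s + k).card ≤ m) :
    P.node (s + k) ∈ fwd S (P.node s) (P.source.2 + s) k m := by
  induction k generalizing m with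
  | zero => simp [fwd]
  | succ k ih =>
    by_cases hmv : P.node (s + k + 1) = P.node (s + k)
    · rw [← add_assoc, hmv]
      refine fwd_subset_succ _ _ _ _ _ (ih m (by omega) (le_trans (Finset.card_le_card ?_) hm))
      intro i; simp only [Finset.mem_filter]; rintro ⟨h1, h2, h3⟩; exact ⟨h1, h2, by omega⟩
    · have hlt : (P.moves.filter fun i => s ≤ i ∧ i < s + k).card <
          (P.moves.filter fun i => s ≤ i ∧ i < s + (k + 1)).card := by
        apply Finset.card_lt_card
        rw [Finset.ssubset_iff_of_subset]
        · refine ⟨s + k, ?_, ?_⟩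
          · simp only [Finset.mem_filter, moves, Finset.mem_range]
            exact ⟨⟨by omega, hmv⟩, by omega, by omega⟩
          · simp
        · intro i; simp only [Finset.mem_filter]; rintro ⟨h1, h2, h3⟩; exact ⟨h1, h2, by omega⟩
      -- The move in step `s + k` is itself counted, so the budget is positive.
      obtain ⟨m, rfl⟩ : ∃ m', m = m' + 1 := ⟨m - 1, by omega⟩
      rw [fwd]
      refine Finset.mem_union_right _ (Finset.mem_map.2 ⟨_, ih m (by omega) (by omega), ?_⟩)
      rcases P.node_succ (k := s + k) (by omega) with h | h
      · exact absurd h hmv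
      · rw [← add_assoc, h]; push_cast; rw [← add_assoc]; rfl

theorem Path.node_mem_bwd (P : Path S) (s : ℕ) (k m : ℕ) (hks : k ≤ s) (hs : s ≤ P.length)
    (hm : (P.moves.filter fun i => s - k ≤ i ∧ i < s).card ≤ m) :
    P.node (s - k) ∈ bwd S (P.node s) (P.source.2 + s) k m := by
  induction k generalizing m with
  | zero => simp [bwd]
  | succ k ih =>
    have hsk : s - k = s - (k + 1) + 1 := by omega
    by_cases hmv : P.node (s - (k + 1) + 1) = P.node (s - (k + 1))
    · rw [← hmv, ← hsk]
      refine bwd_subset_succ _ _ _ _ _ (ih m (by omega) (le_trans (Finset.card_le_card ?_) hm))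
      intro i; simp only [Finset.mem_filter]; rintro ⟨h1, h2, h3⟩; exact ⟨h1, by omega, by omega⟩
    · have hlt : (P.moves.filter fun i => s - k ≤ i ∧ i < s).card <
          (P.moves.filter fun i => s - (k + 1) ≤ i ∧ i < s).card := by
        apply Finset.card_lt_card
        rw [Finset.ssubset_iff_of_subset]
        · refine ⟨s - (k + 1), ?_, ?_⟩
          · simp only [Finset.mem_filter, moves, Finset.mem_range]
            exact ⟨⟨by omega, hmv⟩, by omega, by omega⟩
          · simp only [Finset.mem_filter, not_and]; omega
        · intro i; simp only [Finset.mem_filter]; rintro ⟨h1, h2, h3⟩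
          exact ⟨h1, by omega, by omega⟩
      obtain ⟨m, rfl⟩ : ∃ m', m = m' + 1 := ⟨m - 1, by omega⟩
      rw [bwd]
      refine Finset.mem_union_right _ (Finset.mem_map.2 ⟨_, ih m (by omega) (by omega), ?_⟩)
      rcases P.node_succ (k := s - (k + 1)) (by omega) with h | h
      · exact absurd h hmv
      · rw [hsk, h]
        have : P.source.2 + (s : ℤ) - k - 1 = P.source.2 + ((s - (k + 1) : ℕ) : ℤ) := by
          push_cast [hks]; ring
        rw [this]; simp

/-- At least `m` of at least `m` elements have fewer than `m` elements below them. -/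
theorem le_card_filter_card_lt (s : Finset ℕ) (m : ℕ) (h : m ≤ s.card) :
    m ≤ (s.filter fun x => (s.filter fun y => y < x).card < m).card := by
  induction s using Finset.induction_on_max with
  | empty => simpa using h
  | insert a s ha ih =>
    have hna : a ∉ s := fun h => lt_irrefl _ (ha a h)
    rw [Finset.card_insert_of_notMem hna] at h
    have key : ∀ x ∈ s, (insert a s).filter (fun y => y < x) = s.filter fun y => y < x := by
      intro x hx
      rw [Finset.filter_insert, if_neg (by have := ha x hx; omega)]
    by_cases hm : m ≤ s.card
    · refine (ih hm).trans (Finset.card_le_card ?_)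
      intro x hx
      rw [Finset.mem_filter] at hx ⊢
      rw [key x hx.1]
      exact ⟨Finset.mem_insert_of_mem hx.1, hx.2⟩
    · have h1 : (insert a s).card = m := by rw [Finset.card_insert_of_notMem hna]; omega
      rw [Finset.filter_true_of_mem]
      · exact h1.ge
      · intro x hx
        rw [← h1]
        apply Finset.card_lt_card
        rw [Finset.ssubset_iff_of_subset (Finset.filter_subset _ _)]
        exact ⟨x, hx, by simp⟩

theorem le_card_filter_card_gt (s : Finset ℕ) (m : ℕ) (h : m ≤ s.card) :
    m ≤ (s.filter fun x => (s.filter fun y => x < y).card < m).card := by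
  induction s using Finset.induction_on_min with
  | empty => simpa using h
  | insert a s ha ih =>
    have hna : a ∉ s := fun h => lt_irrefl _ (ha a h)
    rw [Finset.card_insert_of_notMem hna] at h
    have key : ∀ x ∈ s, (insert a s).filter (fun y => x < y) = s.filter fun y => x < y := by
      intro x hx
      rw [Finset.filter_insert, if_neg (by have := ha x hx; omega)]
    by_cases hm : m ≤ s.card
    · refine (ih hm).trans (Finset.card_le_card ?_)
      intro x hx
      rw [Finset.mem_filter] at hx ⊢
      rw [key x hx.1]
      exact ⟨Finset.mem_insert_of_mem hx.1, hx.2⟩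
    · have h1 : (insert a s).card = m := by rw [Finset.card_insert_of_notMem hna]; omega
      rw [Finset.filter_true_of_mem]
      · exact h1.ge
      · intro x hx
        rw [← h1]
        apply Finset.card_lt_card
        rw [Finset.ssubset_iff_of_subset (Finset.filter_subset _ _)]
        exact ⟨x, hx, by simp⟩

/-! ### Dual edge weights for the lower bound -/

variable (S) in
/-- Dual weight of the pair `(a, b)` at the physical edge out of `(i, τ)`: it counts whether the
edge is close to the source `a` and whether it is close to the destination `b`. -/
def edgeWeight (L h : ℕ) (i : Fin N) (τ : ℤ) (a b : Fin N) : ℝ≥0 :=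
  (if a ∈ bwd S i τ L h then 1 else 0) + (if b ∈ fwd S (S.at_ τ i) (τ + 1) L h then 1 else 0)

/-- A far destination forces at least `h + 1` moves. A move preceded by at most `h` others has the
source near behind it, and a move followed by at most `h` others has the destination near ahead of
it. A move may be of both kinds, which is why the weight adds the two indicators. -/
theorem Path.two_mul_le_sum_edgeWeight (P : Path S) (L h : ℕ) (hL : P.length ≤ L)
    (hb : P.target.1 ∉ fwd S P.source.1 P.source.2 L h) :
    (2 * (h + 1) : ℝ≥0) ≤ ∑ k ∈ P.moves,
      edgeWeight S L h (P.node k) (P.source.2 + k) P.source.1 P.target.1 := by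
  have hcard : h + 1 ≤ P.moves.card := by
    by_contra hlt
    apply hb
    have := P.node_mem_fwd 0 P.length h (by omega)
      ((Finset.card_filter_le _ _).trans (by omega))
    rw [zero_add, node_length, node_zero] at this
    refine fwd_mono S _ _ h hL ?_
    simpa using this
  have h1 := le_card_filter_card_lt P.moves (h + 1) hcard
  have h2 := le_card_filter_card_gt P.moves (h + 1) hcard
  have hmv : ∀ k ∈ P.moves, k < P.length := fun k hk => by
    simp only [moves, Finset.mem_filter, Finset.mem_range] at hk; exact hk.1
  have e1 : ((h + 1 : ℕ) : ℝ≥0) ≤ ∑ k ∈ P.moves,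
      (if P.source.1 ∈ bwd S (P.node k) (P.source.2 + k) L h then (1 : ℝ≥0) else 0) := by
    rw [Finset.sum_boole]
    refine Nat.cast_le.2 (h1.trans (Finset.card_le_card ?_))
    intro k hk
    rw [Finset.mem_filter] at hk ⊢
    refine ⟨hk.1, ?_⟩
    have hkl := hmv k hk.1
    have := P.node_mem_bwd k k h le_rfl hkl.le (by
      refine le_trans (Finset.card_le_card ?_) (Nat.lt_succ_iff.1 hk.2)
      intro i; simp only [Finset.mem_filter]; rintro ⟨h1, h2, h3⟩; exact ⟨h1, h3⟩)
    rw [Nat.sub_self, node_zero] at this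
    exact bwd_mono S _ _ h (by omega) this
  have e2 : ((h + 1 : ℕ) : ℝ≥0) ≤ ∑ k ∈ P.moves,
      (if P.target.1 ∈ fwd S (S.at_ (P.source.2 + k) (P.node k)) (P.source.2 + k + 1) L h
        then (1 : ℝ≥0) else 0) := by
    rw [Finset.sum_boole]
    refine Nat.cast_le.2 (h2.trans (Finset.card_le_card ?_))
    intro k hk
    rw [Finset.mem_filter] at hk ⊢
    refine ⟨hk.1, ?_⟩
    have hkl := hmv k hk.1
    have := P.node_mem_fwd (k + 1) (P.length - (k + 1)) h (by omega) (by
      refine le_trans (Finset.card_le_card ?_) (Nat.lt_succ_iff.1 hk.2)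
      intro i; simp only [Finset.mem_filter]; rintro ⟨h1, h2, h3⟩; exact ⟨h1, by omega⟩)
    rw [show k + 1 + (P.length - (k + 1)) = P.length by omega, node_length] at this
    have hmk : P.node (k + 1) = S.at_ (P.source.2 + k) (P.node k) := by
      have hk1 := hk.1
      simp only [moves, Finset.mem_filter] at hk1
      exact (P.node_succ hkl).resolve_left hk1.2
    rw [hmk] at this
    push_cast at this
    rw [← add_assoc] at this
    exact fwd_mono S _ _ h (by omega) this
  unfold edgeWeight
  rw [Finset.sum_add_distrib]
  calc (2 * (h + 1) : ℝ≥0) = ((h + 1 : ℕ) : ℝ≥0) + ((h + 1 : ℕ) : ℝ≥0) := by push_cast; ring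
    _ ≤ _ := add_le_add e1 e2

theorem RoutingScheme.inducedFlow_apply (R : RoutingScheme S) (D : Demand N) (P : Path S) :
    R.inducedFlow D P = D P.source.2 P.source.1 P.target.1 *
      R.flow P.source.1 P.target.1 P.source.2 P := by
  unfold inducedFlow
  rw [tsum_eq_single (P.source.1, P.target.1, P.source.2)]
  rintro ⟨a, b, t⟩ hne
  rw [R.supported, mul_zero]
  rintro ⟨h1, h2⟩
  apply hne
  simp only at h1 h2
  rw [h1, ← h2]

-- Rewrites the sum over the moves of a path as a sum over a set of edges that does not depend on
-- the path: a path that starts in `[0, M)` and has length at most `L` stays inside the window of `M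
-- + L` timeslots.
open Classical in
theorem Path.two_mul_le_sum_edges (P : Path S) (L h M : ℕ) (hL : P.length ≤ L)
    (hb : P.target.1 ∉ fwd S P.source.1 P.source.2 L h) (h0 : 0 ≤ P.source.2)
    (hM : P.source.2 < M) :
    (2 * (h + 1) : ℝ≥0) ≤ ∑ e ∈ (Finset.univ : Finset (Fin N)) ×ˢ Finset.Ico (0 : ℤ) (M + L : ℕ),
      if P.Traverses e (S.at_ e.2 e.1, e.2 + 1) then
        edgeWeight S L h e.1 e.2 P.source.1 P.target.1 else 0 := by
  refine (P.two_mul_le_sum_edgeWeight L h hL hb).trans ?_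
  -- Time increases along the path, so different moves use different edges.
  have hinj : Set.InjOn (fun k : ℕ => (P.node k, P.source.2 + (k : ℤ))) P.moves := by
    intro k _ k' _ hkk
    have := congrArg Prod.snd hkk
    simp only at this
    omega
  have hmv : ∀ k ∈ P.moves, k < P.length ∧
      P.node (k + 1) = S.at_ (P.source.2 + k) (P.node k) := fun k hk => by
    simp only [moves, Finset.mem_filter, Finset.mem_range] at hk
    exact ⟨hk.1, (P.node_succ hk.1).resolve_left hk.2⟩
  set W : Fin N × ℤ → ℝ≥0 := fun e => if P.Traverses e (S.at_ e.2 e.1, e.2 + 1) then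
    edgeWeight S L h e.1 e.2 P.source.1 P.target.1 else 0 with hW
  have hsum : ∑ k ∈ P.moves, edgeWeight S L h (P.node k) (P.source.2 + k) P.source.1 P.target.1
      = ∑ k ∈ P.moves, W (P.node k, P.source.2 + (k : ℤ)) := by
    refine Finset.sum_congr rfl fun k hk => ?_
    obtain ⟨hk1, hk2⟩ := hmv k hk
    simp only [hW]
    rw [if_pos]
    rw [traverses_iff]
    refine ⟨k, hk1, rfl, ?_⟩
    rw [hk2]; push_cast; rw [add_assoc]
  rw [hsum, ← Finset.sum_image (f := W) hinj]
  refine Finset.sum_le_sum_of_subset ?_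
  intro e he
  obtain ⟨k, hk, rfl⟩ := Finset.mem_image.1 he
  have := (hmv k hk).1
  simp only [Finset.mem_product, Finset.mem_univ, true_and, Finset.mem_Ico]
  push_cast
  omega

/-- The indicator of a near source does not depend on `b` and costs at most `N`; the other one
counts the nodes near ahead of the edge. This makes the weight matrix, scaled by `r / (N + B)`, an
admissible demand. -/
theorem sum_edgeWeight_right_le (L h : ℕ) (i : Fin N) (τ : ℤ) (a : Fin N) :
    ∑ b, edgeWeight S L h i τ a b ≤ N + ((L + h).choose h : ℕ) := by
  unfold edgeWeight
  rw [Finset.sum_add_distrib]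
  refine add_le_add ?_ ?_
  · refine (Finset.sum_le_card_nsmul _ _ 1 ?_).trans (by simp)
    intro b _; split_ifs <;> simp
  · rw [Finset.sum_boole, Finset.filter_mem_eq_inter, Finset.univ_inter]
    exact Nat.cast_le.2 (card_fwd_le _ _ _ _ _)

theorem sum_edgeWeight_left_le (L h : ℕ) (i : Fin N) (τ : ℤ) (b : Fin N) :
    ∑ a, edgeWeight S L h i τ a b ≤ N + ((L + h).choose h : ℕ) := by
  unfold edgeWeight
  rw [Finset.sum_add_distrib, add_comm]
  refine add_le_add ?_ ?_
  · refine (Finset.sum_le_card_nsmul _ _ 1 ?_).trans (by simp)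
    intro b _; split_ifs <;> simp
  · rw [Finset.sum_boole, Finset.filter_mem_eq_inter, Finset.univ_inter]
    exact Nat.cast_le.2 (card_bwd_le _ _ _ _ _)

/-- Pairs of a source and a start in `[0, M)` with a destination that is far away. -/
def farTriples (S : ConnectionSchedule N) (L h M : ℕ) : Finset (Fin N × Fin N × ℤ) :=
  (Finset.univ ×ˢ Finset.univ ×ˢ Finset.Ico (0 : ℤ) M).filter
    fun g => g.2.1 ∉ fwd S g.1 g.2.2 L h

/-- For each of the `M * N` starts `(a, t)` the near destinations form a set `fwd S a t L h`, whose
size is bounded by `card_fwd_le`. -/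
theorem le_card_farTriples (L h M : ℕ) :
    M * N * N ≤ (farTriples S L h M).card + M * N * (L + h).choose h := by
  classical
  have h1 := Finset.card_filter_add_card_filter_not (s := (Finset.univ ×ˢ Finset.univ ×ˢ
    Finset.Ico (0 : ℤ) M : Finset (Fin N × Fin N × ℤ))) (fun g => g.2.1 ∉ fwd S g.1 g.2.2 L h)
  have h2 : ((Finset.univ ×ˢ Finset.univ ×ˢ Finset.Ico (0 : ℤ) M :
      Finset (Fin N × Fin N × ℤ)).filter fun g => ¬ g.2.1 ∉ fwd S g.1 g.2.2 L h).card
      ≤ M * N * (L + h).choose h := by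
    have hc : (((Finset.univ : Finset (Fin N)) ×ˢ Finset.Ico (0 : ℤ) M).card) = M * N := by
      simp [mul_comm]
    rw [mul_comm, ← hc]
    refine Finset.card_le_mul_card_image_of_maps_to (f := fun g => (g.1, g.2.2)) ?_ _ ?_
    · rintro ⟨a, b, t⟩ hg
      simpa using (Finset.mem_filter.1 hg).1
    · rintro ⟨a, t⟩ _
      refine le_trans ?_ (card_fwd_le S a t L h)
      refine Finset.card_le_card_of_injOn (fun g => g.2.1) ?_ ?_
      · rintro ⟨a', b, t'⟩ hg
        simp at hg
        obtain ⟨⟨_, h⟩, rfl, rfl⟩ := hg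
        exact h
      · rintro ⟨a1, b1, t1⟩ hg ⟨a2, b2, t2⟩ hg' hb
        simp at hg hg' hb
        obtain ⟨_, rfl, rfl⟩ := hg
        obtain ⟨_, rfl, rfl⟩ := hg'
        simp [hb]
  have h3 : (Finset.univ ×ˢ Finset.univ ×ˢ Finset.Ico (0 : ℤ) M :
      Finset (Fin N × Fin N × ℤ)).card = M * N * N := by
    simp; ring
  unfold farTriples
  omega

end ORN

/-! ### The trade-off between throughput and latency -/

namespace ORN

variable {N : ℕ}

/-- Feasibility for the dual demands, summed over all edges in a window of `M + L` timeslots. -/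
theorem Design.card_farTriples_mul_le (X : Design N) (r : ℝ≥0)
    (hX : X.GuaranteesThroughput r) (L h M : ℕ)
    (hL : ∀ a b t P, X.routing.flow a b t P ≠ 0 → P.length ≤ L) (ρ : ℝ≥0)
    (hρ : ρ * (N + ((L + h).choose h : ℕ)) ≤ r) :
    ((farTriples X.schedule L h M).card : ℝ≥0) * (2 * (h + 1) * ρ) ≤ N * (M + L : ℕ) := by
  classical
  set S := X.schedule with hS
  set E : Finset (Fin N × ℤ) := Finset.univ ×ˢ Finset.Ico (0 : ℤ) (M + L : ℕ) with hE
  have hEc : E.card = N * (M + L) := by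
    rw [hE, Finset.card_product, Int.card_Ico]; simp; omega
  set F : Path S → ℝ≥0 := fun P =>
    X.routing.flow P.source.1 P.target.1 P.source.2 P with hF
  set c : ℝ≥0 := 2 * (h + 1) with hc
  -- Each edge is tested against its own demand: `ρ` times its weight matrix, the same in every
  -- timeslot.
  have hedge : ∀ e ∈ E, ∑' P : Path S,
      (if P.Traverses e (S.at_ e.2 e.1, e.2 + 1) then
        ((ρ * edgeWeight S L h e.1 e.2 P.source.1 P.target.1 * F P : ℝ≥0) : ℝ≥0∞) else 0) ≤ 1 := by
    intro e _
    have hD := hX (fun _ => Matrix.of fun a b => ρ * edgeWeight S L h e.1 e.2 a b) (by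
      intro t
      refine ⟨fun a => ?_, fun b => ?_⟩
      · simp only [Matrix.of_apply]
        rw [← Finset.mul_sum]
        refine NNReal.coe_le_coe.2 (le_trans ?_ hρ)
        gcongr
        exact sum_edgeWeight_right_le L h e.1 e.2 a
      · simp only [Matrix.of_apply]
        rw [← Finset.mul_sum]
        refine NNReal.coe_le_coe.2 (le_trans ?_ hρ)
        gcongr
        exact sum_edgeWeight_left_le L h e.1 e.2 b)
    have h1 := hD e (S.at_ e.2 e.1, e.2 + 1) rfl
    unfold Flow.load at h1
    simp only [RoutingScheme.inducedFlow_apply, Matrix.of_apply] at h1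
    convert h1 using 3
  -- For a fixed path only the triple given by its endpoints contributes on the left; if that triple
  -- is far, the path collects weight at least `c`.
  have hpt : ∀ P : Path S,
      ∑ g ∈ farTriples S L h M, ((c * ρ * X.routing.flow g.1 g.2.1 g.2.2 P : ℝ≥0) : ℝ≥0∞) ≤
      ∑ e ∈ E, (if P.Traverses e (S.at_ e.2 e.1, e.2 + 1) then
        ((ρ * edgeWeight S L h e.1 e.2 P.source.1 P.target.1 * F P : ℝ≥0) : ℝ≥0∞) else 0) := by
    intro P
    by_cases hg : (P.source.1, P.target.1, P.source.2) ∈ farTriples S L h M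
    · rw [Finset.sum_eq_single_of_mem _ hg]
      · by_cases hF0 : F P = 0
        · have : X.routing.flow P.source.1 P.target.1 P.source.2 P = 0 := hF0
          simp [this]
        · have hlen := hL _ _ _ _ hF0
          simp only [farTriples, Finset.mem_filter, Finset.mem_product, Finset.mem_univ, true_and,
            Finset.mem_Ico] at hg
          have key := P.two_mul_le_sum_edges L h M hlen hg.2 hg.1.1 (by exact_mod_cast hg.1.2)
          have : c * ρ * F P ≤ ∑ e ∈ E, (if P.Traverses e (S.at_ e.2 e.1, e.2 + 1) then
              (ρ * edgeWeight S L h e.1 e.2 P.source.1 P.target.1 * F P : ℝ≥0) else 0) := by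
            calc c * ρ * F P ≤ (∑ e ∈ E, if P.Traverses e (S.at_ e.2 e.1, e.2 + 1) then
                edgeWeight S L h e.1 e.2 P.source.1 P.target.1 else 0) * (ρ * F P) := by
                  rw [mul_assoc]; gcongr
              _ = _ := by
                rw [Finset.sum_mul]
                refine Finset.sum_congr rfl fun e _ => ?_
                split_ifs
                · ring
                · simp
          calc _ ≤ _ := ENNReal.coe_le_coe.2 this
            _ = _ := by
              rw [ENNReal.ofNNReal_finsetSum]
              refine Finset.sum_congr rfl fun e _ => ?_
              split_ifs <;> simp
      · rintro ⟨a, b, t⟩ _ hne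
        rw [X.routing.supported, mul_zero, ENNReal.coe_zero]
        rintro ⟨h1, h2⟩
        apply hne
        simp only at h1 h2
        rw [h1, ← h2]
    · rw [Finset.sum_eq_zero]
      · exact zero_le
      · rintro ⟨a, b, t⟩ hm
        rw [X.routing.supported, mul_zero, ENNReal.coe_zero]
        rintro ⟨h1, h2⟩
        apply hg
        simp only at h1 h2
        rw [h1, h2]
        exact hm
  have h1 : ∑ g ∈ farTriples S L h M, ∑' P : Path S,
      ((c * ρ * X.routing.flow g.1 g.2.1 g.2.2 P : ℝ≥0) : ℝ≥0∞) ≤ E.card := by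
    rw [← Summable.tsum_finsetSum (fun _ _ => ENNReal.summable)]
    refine (ENNReal.tsum_le_tsum hpt).trans ?_
    rw [Summable.tsum_finsetSum (fun _ _ => ENNReal.summable)]
    refine (Finset.sum_le_sum hedge).trans ?_
    simp
  -- The routing scheme sends one unit for each triple, so each far triple contributes exactly `c *
  -- ρ`.
  have h2 : ∀ g ∈ farTriples S L h M, ∑' P : Path S,
      ((c * ρ * X.routing.flow g.1 g.2.1 g.2.2 P : ℝ≥0) : ℝ≥0∞) = ((c * ρ : ℝ≥0) : ℝ≥0∞) := by
    intro g _
    simp only [ENNReal.coe_mul (c * ρ)]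
    rw [ENNReal.tsum_mul_left, X.routing.unit, mul_one]
  rw [Finset.sum_congr rfl h2, Finset.sum_const, nsmul_eq_mul, hEc] at h1
  exact_mod_cast h1

/-- Paths starting near the end of the window leave it by at most `L` timeslots; this boundary
effect disappears as the window length `M` tends to infinity. -/
theorem Design.throughput_tradeoff (X : Design N) (hN : 0 < N) {r : ℝ} (hr : 0 < r)
    (hX : X.GuaranteesThroughput r) (L h : ℕ)
    (hL : ∀ a b t P, X.routing.flow a b t P ≠ 0 → P.length ≤ L) :
    2 * (h + 1) * r * ((N : ℝ) - (L + h).choose h) ≤ N + (L + h).choose h := by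
  set B : ℝ := (((L + h).choose h : ℕ) : ℝ) with hB
  have hB0 : 0 ≤ B := Nat.cast_nonneg _
  have hN' : (0 : ℝ) < N := by exact_mod_cast hN
  have hz : 0 < (N : ℝ) + B := by positivity
  lift r to ℝ≥0 using hr.le
  obtain ⟨ρ, hρ⟩ : ∃ ρ : ℝ≥0, (ρ : ℝ) = r / (N + B) := ⟨⟨r / (N + B), by positivity⟩, rfl⟩
  have key : ∀ M : ℕ, (M : ℝ) * (2 * (h + 1) * r * (N - B)) ≤ (M + L) * (N + B) := by
    intro M
    have h1 := X.card_farTriples_mul_le r hX L h M hL ρ (by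
      rw [← NNReal.coe_le_coe]
      push_cast
      rw [hρ, ← hB, div_mul_cancel₀ _ hz.ne'])
    rw [← NNReal.coe_le_coe] at h1
    push_cast at h1
    rw [hρ] at h1
    have h2 : ((M * N * N : ℕ) : ℝ) ≤ _ := Nat.cast_le.2 (le_card_farTriples (S := X.schedule) L h M)
    push_cast at h2
    change (M * N * N : ℝ) ≤ _ + M * N * B at h2
    have h3 : (M * N * (N - B)) * (2 * (h + 1) * (r / (N + B))) ≤ N * (M + L) := by
      refine le_trans (mul_le_mul_of_nonneg_right ?_ (by positivity)) h1
      linarith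
    have h4 : (M * N * (N - B)) * (2 * (h + 1) * (r / (N + B)))
        = N * ((M : ℝ) * (2 * (h + 1) * r * (N - B)) / (N + B)) := by
      field_simp
    rw [h4] at h3
    have h5 := le_of_mul_le_mul_left h3 hN'
    rwa [div_le_iff₀ hz] at h5
  by_contra! hlt
  -- If the claim failed, the left side of `key` would grow faster in `M` than the right side; this
  -- `M` makes the gain exceed the constant term `L * (N + B)`.
  obtain ⟨M, hM⟩ := exists_nat_gt (L * (N + B) / (2 * (h + 1) * r * (N - B) - (N + B)))
  rw [div_lt_iff₀ (by linarith)] at hM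
  have := key M
  linarith

/-! ### From the trade-off to the lower bound by `L*` -/

/-- If `(L + h).choose h` is a positive proportion of `ε N`, then `L` is at least of order
`h (ε N) ^ (1 / h)`. -/
theorem mul_rpow_le_of_le_choose {h L N : ℕ} {ε : ℝ} (hh : 1 ≤ h) (hhL : h ≤ L) (hε : 0 ≤ ε)
    (H : ε * N ≤ 2 * (h + 1) * (L + h).choose h) :
    h * (ε * N) ^ (1 / (h : ℝ)) ≤ 24 * L := by
  have hh0 : (0 : ℝ) < h := by exact_mod_cast hh
  have h1 : ((L + h).choose h : ℝ) ≤ (2 * L) ^ h / h.factorial := by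
    refine (Nat.choose_le_pow_div h (L + h)).trans ?_
    gcongr
    push_cast
    have : (h : ℝ) ≤ L := by exact_mod_cast hhL
    linarith
  have h2 : (h : ℝ) ^ h / h.factorial ≤ 3 ^ h := by
    refine (Real.pow_div_factorial_le_exp (h : ℝ) hh0.le h).trans ?_
    rw [← Real.exp_one_pow]
    have := Real.exp_one_lt_three
    gcongr
  have h3 : (2 * (h + 1) : ℝ) ≤ 4 ^ h := by
    have : ∀ k : ℕ, 2 * (k + 1 + 1) ≤ 4 ^ (k + 1) := by
      intro k
      induction k with
      | zero => norm_num
      | succ k ih => rw [pow_succ]; omega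
    obtain ⟨k, rfl⟩ : ∃ k, h = k + 1 := ⟨h - 1, by omega⟩
    exact_mod_cast this k
  -- `24 = 2 * 3 * 4`: a factor `2` from `L + h ≤ 2 L`, a factor `3 > e` from `h ^ h / h!`, and a
  -- factor `4` absorbing `2 * (h + 1) ≤ 4 ^ h`.
  have h4 : (h : ℝ) ^ h * (ε * N) ≤ (24 * L) ^ h := by
    calc (h : ℝ) ^ h * (ε * N) ≤ h ^ h * (4 ^ h * ((2 * L) ^ h / h.factorial)) := by
          refine mul_le_mul_of_nonneg_left (H.trans ?_) (by positivity)
          gcongr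
      _ = (h ^ h / h.factorial) * (4 ^ h * (2 * L) ^ h) := by ring
      _ ≤ 3 ^ h * (4 ^ h * (2 * L) ^ h) := by gcongr
      _ = (24 * L) ^ h := by rw [← mul_pow, ← mul_pow]; congr 1; ring
  have h5 : (h * (ε * N) ^ (1 / (h : ℝ))) ^ h = h ^ h * (ε * N) := by
    rw [mul_pow, one_div, Real.rpow_inv_natCast_pow (by positivity) (by omega)]
  rw [← h5] at h4
  exact le_of_pow_le_pow_left₀ (by omega) (by positivity) h4

theorem IsHopParam.one_le {r : ℝ} (hr : 0 < r) (hr2 : r ≤ 1 / 2) {h : ℕ} {ε : ℝ}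
    (H : IsHopParam r h ε) : 1 ≤ h := by
  obtain ⟨h0, h1, h2⟩ := H
  have h3 : 1 ≤ 1 / (2 * r) := by rw [le_div_iff₀ (by positivity)]; linarith
  by_contra hh
  have : h = 0 := by omega
  subst this
  push_cast at h2
  linarith

theorem existsUnique_isHopParam {r : ℝ} (hr : 0 < r) :
    ∃! p : ℕ × ℝ, IsHopParam r p.1 p.2 := by
  have hx : 0 ≤ 1 / (2 * r) := by positivity
  set x := 1 / (2 * r) with hxdef
  refine ⟨(⌊x⌋₊, ⌊x⌋₊ + 1 - x), ⟨?_, ?_, ?_⟩, ?_⟩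
  · have := Nat.lt_floor_add_one x
    simp only; linarith
  · have := Nat.floor_le hx
    simp only; linarith
  · simp only; ring
  · rintro ⟨k, e⟩ ⟨h1, h2, h3⟩
    simp only at h1 h2 h3
    have : ⌊x⌋₊ = k := by
      rw [Nat.floor_eq_iff hx]
      constructor <;> linarith
    rw [Prod.mk.injEq]
    refine ⟨this.symm, ?_⟩
    rw [this]; linarith

theorem Lstar_nonneg (h : ℕ) {ε : ℝ} (hε : 0 ≤ ε) (N : ℕ) : 0 ≤ Lstar h ε N := by
  unfold Lstar; positivity

theorem Lstar_mono (h : ℕ) {ε : ℝ} (hε : 0 ≤ ε) : Monotone (Lstar h ε) := by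
  intro M N hMN
  unfold Lstar
  have : (M : ℝ) ≤ N := by exact_mod_cast hMN
  gcongr

theorem le_Lstar (h : ℕ) (ε : ℝ) (N : ℕ) : h * (ε * N) ^ (1 / (h : ℝ)) ≤ Lstar h ε N := by
  unfold Lstar
  rw [mul_add]
  have : 0 ≤ h * (N : ℝ) ^ (1 / ((h : ℝ) + 1)) := by positivity
  linarith

/-- For large `N` the second term dominates: `N ^ (1 / (h + 1)) ≤ (ε N) ^ (1 / h)` is equivalent to
`N ^ h ≤ (ε N) ^ (h + 1)`, that is, to `1 ≤ ε ^ (h + 1) * N`. -/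
theorem Lstar_le {h N : ℕ} {ε : ℝ} (hh : 1 ≤ h) (hε : 0 < ε) (hN : 1 ≤ ε ^ (h + 1) * N) :
    Lstar h ε N ≤ 2 * (h * (ε * N) ^ (1 / (h : ℝ))) := by
  have hh0 : (0 : ℝ) < h := by exact_mod_cast hh
  have h1 : (N : ℝ) ^ (1 / ((h : ℝ) + 1)) ≤ (ε * N) ^ (1 / (h : ℝ)) := by
    have h2 : (N : ℝ) ^ (h : ℝ) ≤ (ε * N) ^ ((h : ℝ) + 1) := by
      rw [Real.rpow_natCast]
      have : ((h : ℝ) + 1) = ((h + 1 : ℕ) : ℝ) := by push_cast; ring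
      rw [this, Real.rpow_natCast, mul_pow, pow_succ (N : ℝ)]
      have : (0 : ℝ) ≤ (N : ℝ) ^ h := by positivity
      nlinarith
    have h3 := Real.rpow_le_rpow (by positivity) h2
      (show 0 ≤ 1 / ((h : ℝ) * (h + 1)) by positivity)
    rw [← Real.rpow_mul (by positivity), ← Real.rpow_mul (by positivity)] at h3
    convert h3 using 2 <;> field_simp
  unfold Lstar
  nlinarith

theorem Design.exists_flow_ne_zero (X : Design N) (a b : Fin N) (t : ℤ) :
    ∃ P, X.routing.flow a b t P ≠ 0 := by
  by_contra! h
  have := X.routing.unit a b t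
  simp [h] at this

theorem Design.length_le_maxLatency (X : Design N) {a b t} {P : Path X.schedule}
    (h : X.routing.flow a b t P ≠ 0) : (P.length : ℕ∞) ≤ X.maxLatency :=
  le_iSup₂_of_le (f := fun (P : Path X.schedule)
    (_ : ∃ a b t, 0 < X.routing.flow a b t P) => (P.latency : ℕ∞)) P
    ⟨a, b, t, pos_iff_ne_zero.2 h⟩ le_rfl

/-- A path between two different nodes has an edge. This trivial bound serves the values of `N`
below the threshold of the asymptotic bound. -/
theorem Design.one_le_maxLatency (X : Design N) (hN : 1 < N) : 1 ≤ X.maxLatency := by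
  obtain ⟨P, hP⟩ := X.exists_flow_ne_zero ⟨0, by omega⟩ ⟨1, hN⟩ 0
  refine le_trans ?_ (X.length_le_maxLatency hP)
  have hJ : P.Joins ⟨0, by omega⟩ ⟨1, hN⟩ 0 := by
    by_contra h
    exact hP (X.routing.supported _ _ _ _ h)
  have : P.length ≠ 0 := by
    intro h0
    have h1 := P.node_zero
    have h2 := P.node_length
    rw [h0] at h2
    rw [h2, hJ.1, hJ.2] at h1
    simp [Fin.ext_iff] at h1
  exact_mod_cast Nat.one_le_iff_ne_zero.2 this

theorem Design.Lstar_le_maxLatency {r : ℝ} (hr : 0 < r) {h : ℕ} {ε : ℝ} (hh : 1 ≤ h)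
    (H : IsHopParam r h ε) (X : Design N) (hX : X.GuaranteesThroughput r)
    (hN1 : 1 ≤ ε ^ (h + 1) * N) (hN2 : 2 * (h + 1) * (h + h).choose h < ε * N) :
    ENNReal.ofReal (1 / 48 * Lstar h ε N) ≤ (X.maxLatency : ENNReal) := by
  obtain ⟨hε, -, hrε⟩ := H
  cases hL : X.maxLatency with
  | top => simp
  | coe L =>
    have hlen : ∀ a b t P, X.routing.flow a b t P ≠ 0 → P.length ≤ L := by
      intro a b t P hP
      have := X.length_le_maxLatency hP
      rw [hL] at this
      exact_mod_cast this
    have hN : 0 < N := by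
      rcases Nat.eq_zero_or_pos N with h0 | h0
      · subst h0; norm_num at hN1
      · exact h0
    have h1 := X.throughput_tradeoff hN hr hX L h hlen
    set B : ℝ := (((L + h).choose h : ℕ) : ℝ) with hB
    have hB0 : 0 ≤ B := Nat.cast_nonneg _
    have hpos : (0 : ℝ) < h + 1 - ε := by rw [← hrε]; positivity
    have hr2 : 2 * r * (h + 1 - ε) = 1 := by rw [← hrε]; field_simp
    -- The trade-off multiplied by `1 / (2 r) = h + 1 - ε`. The terms `(h + 1) N` cancel and leave
    -- `ε N ≤ (2 (h + 1) - ε) B`.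
    have h2 : ((h : ℝ) + 1) * (N - B) ≤ (N + B) * (h + 1 - ε) := by
      have := mul_le_mul_of_nonneg_right h1 hpos.le
      calc ((h : ℝ) + 1) * (N - B) = (h + 1) * (N - B) * (2 * r * (h + 1 - ε)) := by
            rw [hr2, mul_one]
        _ = 2 * (h + 1) * r * (N - B) * (h + 1 - ε) := by ring
        _ ≤ _ := this
    have h3 : ε * N ≤ 2 * (h + 1) * B := by nlinarith [mul_nonneg hε.le hB0]
    -- For `L < h` the number `B` would be at most `(h + h).choose h`, too small by `hN2`.
    have hhL : h ≤ L := by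
      by_contra hlt
      have h4 : B ≤ ((h + h).choose h : ℕ) := by
        rw [hB]; exact_mod_cast Nat.choose_le_choose h (by omega)
      have : 2 * ((h : ℝ) + 1) * B ≤ 2 * (h + 1) * ((h + h).choose h : ℕ) := by gcongr
      linarith
    have h4 := mul_rpow_le_of_le_choose hh hhL hε.le h3
    have h5 := Lstar_le hh hε hN1
    -- `48 = 2 * 24`, the factor `2` being the price of dropping the first term of `L*`.
    have h6 : 1 / 48 * Lstar h ε N ≤ L := by linarith
    calc ENNReal.ofReal (1 / 48 * Lstar h ε N) ≤ ENNReal.ofReal L := ENNReal.ofReal_le_ofReal h6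
      _ = _ := by rw [ENNReal.ofReal_natCast]; rfl

theorem exists_forall_Lstar_le_maxLatency {r : ℝ} (hr : 0 < r) (hr2 : r ≤ 1 / 2) {h : ℕ} {ε : ℝ}
    (H : IsHopParam r h ε) :
    ∃ N₀ : ℕ, ∀ N : ℕ, N₀ ≤ N → ∀ X : Design N, X.GuaranteesThroughput r →
      ENNReal.ofReal (1 / 48 * Lstar h ε N) ≤ (X.maxLatency : ENNReal) := by
  have hε := H.1
  obtain ⟨N₁, h1⟩ := exists_nat_gt (1 / ε ^ (h + 1))
  obtain ⟨N₂, h2⟩ := exists_nat_gt ((2 * (h + 1) * (h + h).choose h) / ε)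
  rw [div_lt_iff₀ (by positivity)] at h1 h2
  refine ⟨max N₁ N₂, fun N hN X hX =>
    X.Lstar_le_maxLatency hr (H.one_le hr hr2) H hX ?_ ?_⟩
  · have : (N₁ : ℝ) ≤ N := by exact_mod_cast (le_max_left _ _).trans hN
    have hp : 0 < ε ^ (h + 1) := by positivity
    nlinarith
  · have : (N₂ : ℝ) ≤ N := by exact_mod_cast (le_max_right _ _).trans hN
    nlinarith

theorem exists_const_Lstar_le_maxLatency {r : ℝ} (hr : 0 < r) (hr2 : r ≤ 1 / 2) {h : ℕ} {ε : ℝ}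
    (H : IsHopParam r h ε) :
    ∃ c' : ℝ, 0 < c' ∧ ∀ N : ℕ, 1 < N → ∀ X : Design N, X.GuaranteesThroughput r →
      ENNReal.ofReal (c' * Lstar h ε N) ≤ (X.maxLatency : ENNReal) := by
  obtain ⟨N₀, h0⟩ := exists_forall_Lstar_le_maxLatency hr hr2 H
  have hL0 := Lstar_nonneg h H.1.le N₀
  -- Since `Lstar` is monotone in `N`, the second entry makes the bound at most `1` for all `N ≤
  -- N₀`.
  refine ⟨min (1 / 48) (1 / (Lstar h ε N₀ + 1)), by positivity, fun N hN X hX => ?_⟩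
  have hLN := Lstar_nonneg h H.1.le N
  rcases le_total N₀ N with hle | hle
  · refine (ENNReal.ofReal_le_ofReal ?_).trans (h0 N hle X hX)
    gcongr
    exact min_le_left _ _
  · have h1 : (1 : ENNReal) ≤ (X.maxLatency : ENNReal) := by
      have := X.one_le_maxLatency hN
      exact_mod_cast this
    refine le_trans ?_ h1
    rw [ENNReal.ofReal_le_one]
    calc _ ≤ 1 / (Lstar h ε N₀ + 1) * Lstar h ε N₀ := by
          gcongr
          · exact min_le_right _ _
          · exact Lstar_mono h H.1.le hle
      _ ≤ 1 := by
          rw [one_div, inv_mul_le_iff₀ (by positivity)]; linarith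

end ORN

/-! ### Uniform routing via intermediate nodes and its load -/

namespace ORN

variable {N : ℕ}

section PathOfNodes

variable {S : ConnectionSchedule N}

/-- The path that visits the nodes `f 0, …, f m` from timeslot `t` on. -/
def Path.ofNodes (S : ConnectionSchedule N) (t : ℤ) (m : ℕ) (f : ℕ → Fin N)
    (hf : ∀ k < m, f (k + 1) = f k ∨ f (k + 1) = S.at_ (t + k) (f k)) : Path S where
  length := m
  vertex k := (f k, t + (k : ℕ))
  adj k := by
    rcases hf k k.2 with h | h
    · left
      unfold ConnectionSchedule.IsVirtual
      ext
      · simp [h]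
      · simp [add_assoc]
    · right
      unfold ConnectionSchedule.IsPhysical
      ext
      · simp [h]
      · simp [add_assoc]

theorem Path.visits_iff {t : ℤ} {m : ℕ} {f : ℕ → Fin N}
    (hf : ∀ k < m, f (k + 1) = f k ∨ f (k + 1) = S.at_ (t + k) (f k)) (P : Path S) :
    P.Visits t m f ↔ P = Path.ofNodes S t m f hf := by
  constructor
  · rintro ⟨rfl, h⟩
    obtain ⟨l, v, adj⟩ := P
    have : v = fun k : Fin (l + 1) => (f k, t + ((k : ℕ) : ℤ)) := funext h
    subst this
    rfl
  · rintro rfl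
    exact ⟨rfl, fun k => rfl⟩

theorem Path.shift_injective : Function.Injective (Path.shift : Path S → Path S) := by
  rintro ⟨l, v, adj⟩ ⟨l', v', adj'⟩ h
  simp only [shift, Path.mk.injEq] at h
  obtain ⟨rfl, h⟩ := h
  have h := eq_of_heq h
  have : v = v' := by
    funext k
    have := congrFun h k
    simp only [Prod.mk.injEq, add_left_inj] at this
    exact Prod.ext this.1 this.2
  subst this
  rfl

theorem Path.ofNodes_traverses {t : ℤ} {m : ℕ} {f : ℕ → Fin N}
    (hf : ∀ k < m, f (k + 1) = f k ∨ f (k + 1) = S.at_ (t + k) (f k)) {i j : Fin N} {τ τ' : ℤ}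
    (h : (Path.ofNodes S t m f hf).Traverses (i, τ) (j, τ')) :
    ∃ k < m, τ = t + k ∧ f k = i ∧ f (k + 1) = j := by
  obtain ⟨k, h1, h2⟩ := h
  simp only [ofNodes, Prod.mk.injEq] at h1 h2
  exact ⟨k, k.2, h1.2.symm, h1.1, h2.1⟩

end PathOfNodes

section Uniform

variable {S : ConnectionSchedule N}

open Classical in
/-- The routing scheme that distributes each unit of flow evenly over the paths `p a b t c`,
one for each intermediate node `c`. -/
def RoutingScheme.uniform (hN : 0 < N) (p : Fin N → Fin N → ℤ → Fin N → Path S)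
    (hj : ∀ a b t c, (p a b t c).Joins a b t)
    (hp : ∀ a b t c, p a b (t + S.T) c = (p a b t c).shift) : RoutingScheme S where
  flow a b t P := (Finset.univ.filter fun c => P = p a b t c).card / (N : ℝ≥0)
  supported a b t P h := by
    rw [Finset.card_eq_zero.2, Nat.cast_zero, zero_div]
    rw [Finset.filter_eq_empty_iff]
    rintro c - rfl
    exact h (hj a b t c)
  unit a b t := by
    have hN0 : (N : ℝ≥0) ≠ 0 := by exact_mod_cast hN.ne'
    have h1 : ∀ P : Path S,
        (((Finset.univ.filter fun c => P = p a b t c).card / (N : ℝ≥0) : ℝ≥0) : ℝ≥0∞) =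
        (∑ c, if P = p a b t c then (1 : ℝ≥0∞) else 0) * (N : ℝ≥0∞)⁻¹ := by
      intro P
      rw [Finset.sum_boole, ENNReal.coe_div hN0, div_eq_mul_inv]
      simp
    simp only [h1]
    rw [ENNReal.tsum_mul_right, Summable.tsum_finsetSum (fun _ _ => ENNReal.summable)]
    simp only [tsum_ite_eq]
    simp only [Finset.sum_const, Finset.card_univ, Fintype.card_fin, nsmul_eq_mul, mul_one]
    exact ENNReal.mul_inv_cancel (by exact_mod_cast hN.ne') (ENNReal.natCast_ne_top N)
  periodic a b t P := by
    simp only [hp, Path.shift_injective.eq_iff]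

/-- A divergent sum in `ℝ≥0` has the default value `0`, so coercing a sum to `ℝ≥0∞` needs an
argument; here at most one term is nonzero. In `ℝ≥0∞` all the interchanges of sums below are free.
-/
theorem RoutingScheme.coe_inducedFlow (R : RoutingScheme S) (D : Demand N) (P : Path S) :
    (R.inducedFlow D P : ℝ≥0∞) =
      ∑' q : Fin N × Fin N × ℤ, (D q.2.2 q.1 q.2.1 : ℝ≥0∞) * R.flow q.1 q.2.1 q.2.2 P := by
  rw [inducedFlow_apply, tsum_eq_single (P.source.1, P.target.1, P.source.2)]
  · simp
  rintro ⟨a, b, t⟩ hne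
  rw [R.supported, ENNReal.coe_zero, mul_zero]
  rintro ⟨h1, h2⟩
  apply hne
  simp only at h1 h2
  rw [h1, ← h2]

open Classical in
/-- If every path through the edge uses it in a first part that depends on the source and the
intermediate node, or in a second part that depends on the intermediate node and the destination,
then the load is bounded by counting such pairs. -/
theorem RoutingScheme.uniform_load_le (hN : 0 < N) (p : Fin N → Fin N → ℤ → Fin N → Path S)
    (hj : ∀ a b t c, (p a b t c).Joins a b t)
    (hp : ∀ a b t c, p a b (t + S.T) c = (p a b t c).shift) (x y : Fin N × ℤ)
    (A B : ℤ → Fin N → Fin N → Prop)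
    (hAB : ∀ a b t c, (p a b t c).Traverses x y → A t a c ∨ B t c b) (r : ℝ≥0)
    (hA : 2 * (r : ℝ≥0∞) * ∑' t, ∑ a, ((Finset.univ.filter fun c => A t a c).card : ℝ≥0∞) ≤ N)
    (hB : 2 * (r : ℝ≥0∞) * ∑' t, ∑ b, ((Finset.univ.filter fun c => B t c b).card : ℝ≥0∞) ≤ N)
    (D : Demand N) (hD : D.RequestsAtMost r) :
    ((RoutingScheme.uniform hN p hj hp).inducedFlow D).load x y ≤ 1 := by
  have hN0 : (N : ℝ≥0) ≠ 0 := by exact_mod_cast hN.ne'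
  set α : ℤ → Fin N → ℝ≥0∞ := fun t a => ((Finset.univ.filter fun c => A t a c).card : ℝ≥0∞)
    with hα
  set β : ℤ → Fin N → ℝ≥0∞ := fun t b => ((Finset.univ.filter fun c => B t c b).card : ℝ≥0∞)
    with hβ
  -- The share of the unit flow for `(a, b, t)` that crosses the edge is the proportion of
  -- intermediate nodes `c` whose path crosses it.
  have h1 : ∀ a b t, ∑' P : Path S, (if P.Traverses x y then
      ((RoutingScheme.uniform hN p hj hp).flow a b t P : ℝ≥0∞) else 0) ≤
      (α t a + β t b) * (N : ℝ≥0∞)⁻¹ := by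
    intro a b t
    have h2 : ∀ P : Path S, (if P.Traverses x y then
        ((RoutingScheme.uniform hN p hj hp).flow a b t P : ℝ≥0∞) else 0) =
        (∑ c, if P = p a b t c then (if (p a b t c).Traverses x y then (1 : ℝ≥0∞) else 0)
          else 0) * (N : ℝ≥0∞)⁻¹ := by
      intro P
      have h3 : ((RoutingScheme.uniform hN p hj hp).flow a b t P : ℝ≥0∞)
          = (∑ c, if P = p a b t c then (1 : ℝ≥0∞) else 0) * (N : ℝ≥0∞)⁻¹ := by
        unfold uniform
        rw [Finset.sum_boole, ENNReal.coe_div hN0, div_eq_mul_inv]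
        simp
      have h4 : ∀ c, (if P = p a b t c then (if (p a b t c).Traverses x y then (1 : ℝ≥0∞) else 0)
          else 0) = if P.Traverses x y then (if P = p a b t c then (1 : ℝ≥0∞) else 0) else 0 := by
        intro c
        by_cases hc : P = p a b t c
        · simp [hc]
        · simp [hc]
      simp only [h4, h3]
      split_ifs <;> simp
    simp only [h2]
    rw [ENNReal.tsum_mul_right, Summable.tsum_finsetSum (fun _ _ => ENNReal.summable)]
    simp only [tsum_ite_eq]
    gcongr
    rw [Finset.sum_boole]
    simp only [hα, hβ]
    norm_cast
    refine le_trans (Finset.card_le_card ?_) (Finset.card_union_le _ _)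
    intro c hc
    simp only [Finset.mem_filter, Finset.mem_univ, true_and, Finset.mem_union] at hc ⊢
    exact hAB a b t c hc
  unfold Flow.load
  simp only [RoutingScheme.coe_inducedFlow]
  have h5 : ∀ P : Path S, (if P.Traverses x y then
      ∑' q : Fin N × Fin N × ℤ, (D q.2.2 q.1 q.2.1 : ℝ≥0∞) *
        (RoutingScheme.uniform hN p hj hp).flow q.1 q.2.1 q.2.2 P else 0) =
      ∑' q : Fin N × Fin N × ℤ, (D q.2.2 q.1 q.2.1 : ℝ≥0∞) * (if P.Traverses x y then
        ((RoutingScheme.uniform hN p hj hp).flow q.1 q.2.1 q.2.2 P : ℝ≥0∞) else 0) := by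
    intro P; split_ifs <;> simp
  simp only [h5]
  rw [ENNReal.tsum_comm]
  simp only [ENNReal.tsum_mul_left]
  have hDa : ∀ t a, ∑ b, (D t a b : ℝ≥0∞) ≤ r := fun t a => by
    have := (hD t).1 a
    rw [NNReal.coe_le_coe] at this
    exact_mod_cast this
  have hDb : ∀ t b, ∑ a, (D t a b : ℝ≥0∞) ≤ r := fun t b => by
    have := (hD t).2 b
    rw [NNReal.coe_le_coe] at this
    exact_mod_cast this
  -- `α` does not involve the destination, so the row sums of the demand apply to it; `β` does not
  -- involve the source, so the column sums apply.
  have h6 : ∀ t, ∑ a, ∑ b, (D t a b : ℝ≥0∞) * ((α t a + β t b) * (N : ℝ≥0∞)⁻¹) ≤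
      r * (∑ a, α t a + ∑ b, β t b) * (N : ℝ≥0∞)⁻¹ := by
    intro t
    have e1 : ∑ a, ∑ b, (D t a b : ℝ≥0∞) * α t a ≤ r * ∑ a, α t a := by
      simp only [← Finset.sum_mul, Finset.mul_sum]
      gcongr with a _
      exact hDa t a
    have e2 : ∑ a, ∑ b, (D t a b : ℝ≥0∞) * β t b ≤ r * ∑ b, β t b := by
      rw [Finset.sum_comm]
      simp only [← Finset.sum_mul, Finset.mul_sum]
      gcongr with b _
      exact hDb t b
    calc _ = (∑ a, ∑ b, (D t a b : ℝ≥0∞) * α t a + ∑ a, ∑ b, (D t a b : ℝ≥0∞) * β t b) *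
          (N : ℝ≥0∞)⁻¹ := by
          simp only [← mul_assoc, mul_add, add_mul, Finset.sum_add_distrib, Finset.sum_mul]
      _ ≤ (r * ∑ a, α t a + r * ∑ b, β t b) * (N : ℝ≥0∞)⁻¹ := by gcongr
      _ = _ := by rw [mul_add]
  calc _ ≤ ∑' q : Fin N × Fin N × ℤ, (D q.2.2 q.1 q.2.1 : ℝ≥0∞) *
        ((α q.2.2 q.1 + β q.2.2 q.2.1) * (N : ℝ≥0∞)⁻¹) :=
        ENNReal.tsum_le_tsum fun q => by gcongr; exact h1 _ _ _
    _ = ∑' t, ∑ a, ∑ b, (D t a b : ℝ≥0∞) * ((α t a + β t b) * (N : ℝ≥0∞)⁻¹) := by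
        rw [ENNReal.tsum_prod', tsum_fintype]
        simp only [ENNReal.tsum_prod', tsum_fintype]
        rw [Summable.tsum_finsetSum (fun _ _ => ENNReal.summable)]
        refine Finset.sum_congr rfl fun a _ => ?_
        rw [Summable.tsum_finsetSum (fun _ _ => ENNReal.summable)]
    _ ≤ ∑' t, r * (∑ a, α t a + ∑ b, β t b) * (N : ℝ≥0∞)⁻¹ := ENNReal.tsum_le_tsum h6
    _ = (r * ∑' t, ∑ a, α t a + r * ∑' t, ∑ b, β t b) * (N : ℝ≥0∞)⁻¹ := by
        rw [ENNReal.tsum_mul_right, ENNReal.tsum_mul_left, ENNReal.tsum_add, mul_add]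
    _ ≤ 1 := by
        have hN1 : (N : ℝ≥0∞) ≠ 0 := by exact_mod_cast hN.ne'
        rw [← div_eq_mul_inv]
        refine ENNReal.div_le_of_le_mul ?_
        rw [one_mul]
        have h2 : (2 : ℝ≥0∞) ≠ 0 := by norm_num
        -- The first and the second parts of the paths use at most half of the capacity each, which
        -- is the origin of the factor `2` in `hA` and `hB`.
        rw [← ENNReal.mul_le_mul_iff_right h2 (by norm_num)]
        calc _ = 2 * (r : ℝ≥0∞) * ∑' t, ∑ a, α t a + 2 * (r : ℝ≥0∞) * ∑' t, ∑ b, β t b := by ring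
          _ ≤ N + N := add_le_add hA hB
          _ = _ := by ring

end Uniform

end ORN

/-! ### Translation-invariant semi-path schemes -/

namespace ORN

variable {N : ℕ}

/-- Translation-invariant semi-paths for a schedule acting by translations `u τ` of a group. The
semi-path for the distance `d` that starts in timeslot `t` has displacement `disp t d k` after `k`
steps and reaches `d` within `M` steps, and in fact within `len t d` steps. Semi-paths start only in
the timeslots in `Start`; `wait t` is the time to wait for one from timeslot `t` on. -/
structure SemiPathScheme (S : ConnectionSchedule N) (G : Type) [AddCommGroup G] where
  φ : Fin N ≃ G
  u : ℤ → G
  u_ne_zero : ∀ τ, u τ ≠ 0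
  at_apply : ∀ τ i, φ (S.at_ τ i) = φ i + u τ
  M : ℕ
  wait : ℤ → ℕ
  wait_add_period : ∀ t, wait (t + S.T) = wait t
  wait_add_M : ∀ t, wait (t + M) = wait t
  Start : ℤ → Prop
  start_wait : ∀ t, Start (t + wait t)
  start_add_M : ∀ t, Start t → Start (t + M)
  disp : ℤ → G → ℕ → G
  disp_zero : ∀ t d, disp t d 0 = 0
  disp_M : ∀ t d, Start t → disp t d M = d
  disp_succ : ∀ t d k, Start t → k < M →
    disp t d (k + 1) = disp t d k ∨ disp t d (k + 1) = disp t d k + u (t + k)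
  disp_add_period : ∀ t d, disp (t + S.T) d = disp t d
  len : ℤ → G → ℕ
  len_le : ∀ t d, Start t → len t d ≤ M
  disp_len : ∀ t d, Start t → disp t d (len t d) = d
  len_add_period : ∀ t d, len (t + S.T) d = len t d

namespace SemiPathScheme

variable {S : ConnectionSchedule N} {G : Type} [AddCommGroup G] (Z : SemiPathScheme S G)

/-- The node reached after `k` steps of the semi-path from `(a, t)` to `c`. -/
def semi (a c : Fin N) (t : ℤ) (k : ℕ) : Fin N :=
  Z.φ.symm (Z.φ a + Z.disp t (Z.φ c - Z.φ a) k)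

theorem φ_semi (a c : Fin N) (t : ℤ) (k : ℕ) :
    Z.φ (Z.semi a c t k) = Z.φ a + Z.disp t (Z.φ c - Z.φ a) k := by simp [semi]

theorem semi_zero (a c : Fin N) (t : ℤ) : Z.semi a c t 0 = a := by
  simp [semi, Z.disp_zero]

theorem semi_M (a c : Fin N) {t : ℤ} (ht : Z.Start t) : Z.semi a c t Z.M = c := by
  simp [semi, Z.disp_M t _ ht]

theorem semi_len (a c : Fin N) {t : ℤ} (ht : Z.Start t) :
    Z.semi a c t (Z.len t (Z.φ c - Z.φ a)) = c := by
  simp [semi, Z.disp_len t _ ht]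

theorem semi_succ (a c : Fin N) {t : ℤ} (ht : Z.Start t) {k : ℕ} (hk : k < Z.M) :
    Z.semi a c t (k + 1) = Z.semi a c t k ∨
      Z.semi a c t (k + 1) = S.at_ (t + k) (Z.semi a c t k) := by
  rcases Z.disp_succ t (Z.φ c - Z.φ a) k ht hk with h | h
  · left; simp [semi, h]
  · right
    apply Z.φ.injective
    rw [Z.at_apply, φ_semi, φ_semi, h, add_assoc]

/-- The nodes visited by the path for `(a, b, t)` via `c`. -/
def nodes (a b : Fin N) (t : ℤ) (c : Fin N) (k : ℕ) : Fin N :=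
  if k < Z.wait t then a
  else if k < Z.wait t + Z.M then Z.semi a c (t + Z.wait t) (k - Z.wait t)
  else Z.semi c b (t + Z.wait t + Z.M) (k - (Z.wait t + Z.M))

/-- The length of the path for `(a, b, t)` via `c`. -/
def length (b : Fin N) (t : ℤ) (c : Fin N) : ℕ :=
  Z.wait t + Z.M + Z.len (t + Z.wait t + Z.M) (Z.φ b - Z.φ c)

theorem nodes_step (a b : Fin N) (t : ℤ) (c : Fin N) {k : ℕ} (hk : k < Z.length b t c) :
    Z.nodes a b t c (k + 1) = Z.nodes a b t c k ∨
    (∃ j < Z.M, (k : ℤ) = Z.wait t + j ∧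
      Z.nodes a b t c k = Z.semi a c (t + Z.wait t) j ∧
      Z.nodes a b t c (k + 1) = Z.semi a c (t + Z.wait t) (j + 1)) ∨
    (∃ j < Z.M, (k : ℤ) = Z.wait t + Z.M + j ∧
      Z.nodes a b t c k = Z.semi c b (t + Z.wait t + Z.M) j ∧
      Z.nodes a b t c (k + 1) = Z.semi c b (t + Z.wait t + Z.M) (j + 1)) := by
  have hs := Z.start_wait t
  have hs' := Z.start_add_M _ hs
  have hl := Z.len_le _ (Z.φ b - Z.φ c) hs'
  have hend : Z.nodes a b t c (Z.wait t + Z.M) = c := by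
    simp [nodes, semi_zero]
  unfold length at hk
  by_cases h1 : k < Z.wait t
  · left
    have e1 : Z.nodes a b t c k = a := by simp [nodes, h1]
    rw [e1]
    by_cases h2 : k + 1 < Z.wait t
    · simp [nodes, h2]
    · have h3 : k + 1 = Z.wait t := by omega
      -- For `M = 0` the second semi-path starts as soon as the waiting ends; then `a = c`, because
      -- the empty semi-path already reaches its destination.
      by_cases hM : Z.M = 0
      · have : k + 1 = Z.wait t + Z.M := by omega
        rw [this, hend]
        have := Z.semi_M a c hs
        rw [hM, semi_zero] at this
        exact this.symm
      · rw [h3]; simp [nodes, semi_zero]; omega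
  · by_cases h2 : k < Z.wait t + Z.M
    · right; left
      refine ⟨k - Z.wait t, by omega, by omega, ?_, ?_⟩
      · simp [nodes, h1, h2]
      · by_cases h3 : k + 1 < Z.wait t + Z.M
        · have h4 : ¬ k + 1 < Z.wait t := by omega
          simp only [nodes, h4, h3, if_true, if_false]
          congr 1; omega
        · have h5 : k + 1 = Z.wait t + Z.M := by omega
          have h6 : k - Z.wait t + 1 = Z.M := by omega
          rw [h5, hend, h6, Z.semi_M a c hs]
    · right; right
      refine ⟨k - (Z.wait t + Z.M), by omega, by omega, ?_, ?_⟩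
      · simp [nodes, h1, h2]
      · have h3 : ¬ k + 1 < Z.wait t := by omega
        have h4 : ¬ k + 1 < Z.wait t + Z.M := by omega
        simp only [nodes, h3, h4, if_false]
        congr 1; omega

theorem nodes_succ (a b : Fin N) (t : ℤ) (c : Fin N) (k : ℕ) (hk : k < Z.length b t c) :
    Z.nodes a b t c (k + 1) = Z.nodes a b t c k ∨
    Z.nodes a b t c (k + 1) = S.at_ (t + k) (Z.nodes a b t c k) := by
  have hs := Z.start_wait t
  rcases Z.nodes_step a b t c hk with h | ⟨j, hj, hkj, h1, h2⟩ | ⟨j, hj, hkj, h1, h2⟩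
  · exact Or.inl h
  · rw [h1, h2, hkj, ← add_assoc]
    exact Z.semi_succ a c hs hj
  · rw [h1, h2, hkj, ← add_assoc, ← add_assoc]
    exact Z.semi_succ c b (Z.start_add_M _ hs) hj

/-- The path for `(a, b, t)` via `c`. -/
def path (a b : Fin N) (t : ℤ) (c : Fin N) : Path S :=
  Path.ofNodes S t (Z.length b t c) (Z.nodes a b t c) (Z.nodes_succ a b t c)

theorem visits_iff (a b : Fin N) (t : ℤ) (c : Fin N) (P : Path S) :
    P.Visits t (Z.length b t c) (Z.nodes a b t c) ↔ P = Z.path a b t c :=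
  Path.visits_iff _ _

theorem path_joins (a b : Fin N) (t : ℤ) (c : Fin N) : (Z.path a b t c).Joins a b t := by
  have hs := Z.start_wait t
  constructor
  · have h0 : Z.nodes a b t c 0 = a := by
      unfold nodes
      split_ifs with h1 h2
      · rfl
      · simp [semi_zero]
      · have hM : Z.M = 0 := by omega
        have := Z.semi_M a c hs
        rw [hM, semi_zero] at this
        subst this
        simp [semi_zero]
    simp [path, Path.ofNodes, Path.source, h0]
  · have : Z.nodes a b t c (Z.length b t c) = b := by
      unfold nodes length
      rw [if_neg (by omega), if_neg (by omega), Nat.add_sub_cancel_left,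
        Z.semi_len c b (Z.start_add_M _ hs)]
    simpa [path, Path.ofNodes, Path.target] using this

theorem path_add_period (a b : Fin N) (t : ℤ) (c : Fin N) :
    Z.path a b (t + S.T) c = (Z.path a b t c).shift := by
  symm
  rw [← Z.visits_iff]
  have hw := Z.wait_add_period t
  have e1 : t + S.T + Z.wait t = t + Z.wait t + S.T := by ring
  have e2 : t + Z.wait t + S.T + Z.M = t + Z.wait t + Z.M + S.T := by ring
  have hl : Z.length b (t + S.T) c = Z.length b t c := by
    unfold length
    rw [hw, e1, e2, Z.len_add_period]
  refine ⟨hl.symm, fun k => ?_⟩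
  have hn : Z.nodes a b (t + S.T) c = Z.nodes a b t c := by
    funext k
    unfold nodes semi
    rw [hw, e1, e2, Z.disp_add_period, Z.disp_add_period]
  rw [hn]
  simp only [path, Path.shift, Path.ofNodes]
  ext
  · rfl
  · simp only; ring

theorem path_length_le (a b : Fin N) (t : ℤ) (c : Fin N) :
    (Z.path a b t c).length ≤ Z.wait t + 2 * Z.M := by
  have := Z.len_le _ (Z.φ b - Z.φ c) (Z.start_add_M _ (Z.start_wait t))
  change Z.length b t c ≤ _
  unfold length
  omega

/-- The semi-path from `(a, t)` to `c` takes the physical edge out of `(i, τ)`. -/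
def Hops (t : ℤ) (a c : Fin N) (i : Fin N) (τ : ℤ) : Prop :=
  ∃ k < Z.M, τ = t + k ∧ Z.semi a c t k = i ∧ Z.semi a c t (k + 1) ≠ i

theorem hops_of_traverses (a b : Fin N) (t : ℤ) (c : Fin N) (i : Fin N) (τ : ℤ)
    (h : (Z.path a b t c).Traverses (i, τ) (S.at_ τ i, τ + 1)) :
    Z.Hops (t + Z.wait t) a c i τ ∨ Z.Hops (t + Z.wait t + Z.M) c b i τ := by
  obtain ⟨k, hk, rfl, h1, h2⟩ := Path.ofNodes_traverses _ h
  -- Translations by nonzero elements have no fixed points, so a physical edge is never also a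
  -- virtual one and its use is a true hop.
  have hne : S.at_ (t + k) i ≠ i := by
    intro h
    have := Z.at_apply (t + k) i
    rw [h] at this
    exact Z.u_ne_zero _ (left_eq_add.1 this)
  rcases Z.nodes_step a b t c hk with h | ⟨j, hj, hkj, h3, h4⟩ | ⟨j, hj, hkj, h3, h4⟩
  · rw [h1, h2] at h; exact absurd h hne
  · left
    refine ⟨j, hj, by rw [hkj, add_assoc], by rw [← h3, h1], ?_⟩
    rw [← h4, h2]; exact hne
  · right
    refine ⟨j, hj, by rw [hkj, add_assoc, add_assoc, add_assoc], by rw [← h3, h1], ?_⟩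
    rw [← h4, h2]; exact hne

/-- The design that routes uniformly via all intermediate nodes. -/
def design (hN : 0 < N) : Design N where
  schedule := S
  routing := RoutingScheme.uniform hN Z.path Z.path_joins Z.path_add_period

theorem design_maxLatency_le (hN : 0 < N) (W : ℕ) (hW : ∀ t, Z.wait t ≤ W) :
    (Z.design hN).maxLatency ≤ ((W + 2 * Z.M : ℕ) : ℕ∞) := by
  classical
  refine iSup₂_le ?_
  rintro P ⟨a, b, t, hP⟩
  have hne : (Finset.univ.filter fun c => P = Z.path a b t c).Nonempty := by
    rw [Finset.nonempty_iff_ne_empty]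
    intro h
    have h0 : (Z.design hN).routing.flow a b t P = 0 := by
      change ((Finset.univ.filter fun c => P = Z.path a b t c).card / (N : ℝ≥0)) = 0
      rw [h]; simp
    rw [h0] at hP
    exact lt_irrefl _ hP
  obtain ⟨c, hc⟩ := hne
  rw [(Finset.mem_filter.1 hc).2]
  have h1 := Z.path_length_le a b t c
  have h2 := hW t
  exact_mod_cast (show (Z.path a b t c).length ≤ W + 2 * Z.M by omega)

variable [Fintype G]

open Classical in
/-- The number of distances whose semi-path from timeslot `t` on has a hop in timeslot `τ`. -/
def hopCount (t τ : ℤ) : ℕ :=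
  (Finset.univ.filter fun d : G =>
    ∃ k < Z.M, τ = t + k ∧ Z.disp t d (k + 1) ≠ Z.disp t d k).card

theorem hopCount_le (t τ : ℤ) (s : Finset G)
    (h : ∀ d, ∀ k < Z.M, τ = t + k → Z.disp t d (k + 1) ≠ Z.disp t d k → d ∈ s) :
    Z.hopCount t τ ≤ s.card := by
  classical
  refine Finset.card_le_card fun d hd => ?_
  obtain ⟨k, hk, h1, h2⟩ := (Finset.mem_filter.1 hd).2
  exact h d k hk h1 h2

-- By translation invariance a semi-path is determined by its distance and its start node. If it is
-- at `i` in timeslot `τ`, the start node is `i` minus the displacement so far, so the distance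
-- alone determines the pair `(a, c)`.
open Classical in
theorem card_hops_le (t τ : ℤ) (i : Fin N) :
    (Finset.univ.filter fun ac : Fin N × Fin N => Z.Hops t ac.1 ac.2 i τ).card ≤
      Z.hopCount t τ := by
  refine Finset.card_le_card_of_injOn (fun ac => Z.φ ac.2 - Z.φ ac.1) ?_ ?_
  · rintro ⟨a, c⟩ h
    simp only [Finset.coe_filter, Finset.mem_univ, true_and, Set.mem_ofPred_eq] at h ⊢
    obtain ⟨k, hk, rfl, h1, h2⟩ := h
    refine ⟨k, hk, rfl, fun h => h2 ?_⟩
    rw [← h1]; simp [semi, h]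
  · rintro ⟨a, c⟩ h ⟨a', c'⟩ h' hd
    simp only [Finset.coe_filter, Finset.mem_univ, true_and, Set.mem_ofPred_eq] at h h' hd
    obtain ⟨k, hk, rfl, h1, -⟩ := h
    obtain ⟨k', hk', hkk, h1', -⟩ := h'
    have : k = k' := by omega
    subst this
    have e1 := Z.φ_semi a c t k
    have e2 := Z.φ_semi a' c' t k
    rw [h1] at e1
    rw [h1', e1, hd] at e2
    have ha := add_right_cancel e2
    have hc : Z.φ c = Z.φ c' := by
      have := sub_add_cancel (Z.φ c) (Z.φ a)
      rw [← this, hd, ha, sub_add_cancel]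
    rw [Z.φ.injective ha, Z.φ.injective hc]

open Classical in
theorem sum_card_hops_left_le (t τ : ℤ) (i : Fin N) :
    ∑ a, ((Finset.univ.filter fun c => Z.Hops t a c i τ).card : ℝ≥0∞) ≤ Z.hopCount t τ := by
  rw [← Nat.cast_sum]
  refine Nat.cast_le.2 (le_trans (le_of_eq ?_) (Z.card_hops_le t τ i))
  simp only [Finset.card_filter]
  rw [Fintype.sum_prod_type]

open Classical in
theorem sum_card_hops_right_le (t τ : ℤ) (i : Fin N) :
    ∑ b, ((Finset.univ.filter fun c => Z.Hops t c b i τ).card : ℝ≥0∞) ≤ Z.hopCount t τ := by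
  rw [← Nat.cast_sum]
  refine Nat.cast_le.2 (le_trans (le_of_eq ?_) (Z.card_hops_le t τ i))
  simp only [Finset.card_filter]
  rw [Fintype.sum_prod_type, Finset.sum_comm]

/-- Both semi-paths of a route cause the same hop counts: the second one merely starts `M` timeslots
later, which is a shift of the summation index because `wait` is invariant under adding `M`. -/
theorem design_guaranteesThroughput (hN : 0 < N) (r : ℝ≥0)
    (h : ∀ τ, 2 * (r : ℝ≥0∞) * ∑' t : ℤ, (Z.hopCount (t + Z.wait t) τ : ℝ≥0∞) ≤ N) :
    (Z.design hN).GuaranteesThroughput r := by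
  rintro D hD ⟨i, τ⟩ y hy
  change y = (S.at_ τ i, τ + 1) at hy
  subst hy
  refine RoutingScheme.uniform_load_le hN Z.path Z.path_joins Z.path_add_period _ _
    (fun t a c => Z.Hops (t + Z.wait t) a c i τ)
    (fun t c b => Z.Hops (t + Z.wait t + Z.M) c b i τ)
    (fun a b t c => Z.hops_of_traverses a b t c i τ) r ?_ ?_ D hD
  · refine le_trans ?_ (h τ)
    gcongr with t
    exact Z.sum_card_hops_left_le _ τ i
  · refine le_trans ?_ (h τ)
    gcongr 2 * (r : ℝ≥0∞) * ?_
    calc _ ≤ ∑' t : ℤ, (Z.hopCount (t + Z.wait t + Z.M) τ : ℝ≥0∞) :=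
          ENNReal.tsum_le_tsum fun t => Z.sum_card_hops_right_le _ τ i
      _ = ∑' t : ℤ, (fun t : ℤ => (Z.hopCount (t + Z.wait t) τ : ℝ≥0∞))
            (Equiv.addRight (Z.M : ℤ) t) := by
          refine tsum_congr fun t => ?_
          simp only [Equiv.coe_addRight]
          rw [Z.wait_add_M, add_right_comm]
      _ ≤ _ := ((Equiv.addRight (Z.M : ℤ)).tsum_eq
          (fun t : ℤ => (Z.hopCount (t + Z.wait t) τ : ℝ≥0∞))).le

end SemiPathScheme

end ORN

namespace ORN

variable {N : ℕ}

/-- The schedule that acts in timeslot `k` by the translation by `v k`. -/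
def translationSchedule {G : Type} [AddCommGroup G] (φ : Fin N ≃ G) (T : ℕ) (hT : 0 < T)
    (v : ℕ → G) : ConnectionSchedule N where
  T := T
  T_pos := hT
  perm k := (φ.trans (Equiv.addRight (v k))).trans φ.symm

theorem translationSchedule_at_ {G : Type} [AddCommGroup G] (φ : Fin N ≃ G) (T : ℕ) (hT : 0 < T)
    (v : ℕ → G) (τ : ℤ) (i : Fin N) :
    φ ((translationSchedule φ T hT v).at_ τ i) = φ i + v (τ % T).toNat := by
  simp [translationSchedule, ConnectionSchedule.at_]

/-! ### The Elementary Basis Scheme -/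

section Greedy

variable {ℓ n : ℕ}

/-- Only coordinate `p` changes, so the distance drops exactly when that coordinate becomes correct;
`s ≠ 0` ensures that it was wrong before. -/
theorem hammingDist_add_single_lt_iff (g d : Fin ℓ → ZMod n) (p : Fin ℓ) {s : ZMod n}
    (hs : s ≠ 0) :
    hammingDist (g + (Pi.single p s : Fin ℓ → ZMod n)) d < hammingDist g d ↔ g p + s = d p := by
  have hoff : ∀ i, i ≠ p → (g + (Pi.single p s : Fin ℓ → ZMod n)) i = g i := fun i hi => by
    simp [hi]
  have hon : (g + (Pi.single p s : Fin ℓ → ZMod n)) p = g p + s := by simp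
  unfold hammingDist
  constructor
  · intro h
    by_contra hne
    refine absurd h (not_lt.2 (Finset.card_le_card ?_))
    intro i hi
    simp only [Finset.mem_filter, Finset.mem_univ, true_and] at hi ⊢
    by_cases hip : i = p
    · subst hip; rwa [hon]
    · rwa [hoff i hip]
  · intro h
    apply Finset.card_lt_card
    rw [Finset.ssubset_iff_of_subset]
    · refine ⟨p, ?_, ?_⟩
      · simp only [Finset.mem_filter, Finset.mem_univ, true_and]
        intro h'
        rw [h'] at h
        exact hs (add_eq_left.1 h)
      · simp [h]
    · intro i hi
      simp only [Finset.mem_filter, Finset.mem_univ, true_and] at hi ⊢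
      by_cases hip : i = p
      · subst hip; rw [hon] at hi; exact absurd h hi
      · rwa [hoff i hip] at hi

theorem hammingDist_add_left (a x b : Fin ℓ → ZMod n) :
    hammingDist (a + x) b = hammingDist x (b - a) := by
  unfold hammingDist
  congr 1
  ext i
  simp [eq_sub_iff_add_eq, add_comm]

/-- The displacement of the greedy semi-path for the distance `d` after `k` steps. -/
def greedyDisp (u : ℤ → Fin ℓ → ZMod n) (t : ℤ) (d : Fin ℓ → ZMod n) : ℕ → Fin ℓ → ZMod n
  | 0 => 0
  | k + 1 =>
    if hammingDist (greedyDisp u t d k + u (t + k)) d < hammingDist (greedyDisp u t d k) d then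
      greedyDisp u t d k + u (t + k) else greedyDisp u t d k

theorem φ_greedyNode {S : ConnectionSchedule N} (φ : Fin N ≃ (Fin ℓ → ZMod n))
    (u : ℤ → Fin ℓ → ZMod n) (hu : ∀ τ i, φ (S.at_ τ i) = φ i + u τ) (a b : Fin N) (t : ℤ)
    (k : ℕ) : φ (greedyNode S φ a b t k) = φ a + greedyDisp u t (φ b - φ a) k := by
  induction k with
  | zero => simp [greedyNode, greedyDisp]
  | succ k ih =>
    rw [greedyNode, greedyDisp]
    rw [hu, ih, add_assoc, hammingDist_add_left (φ a), hammingDist_add_left (φ a)]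
    split_ifs with h
    · rw [hu, ih, add_assoc]
    · rw [ih]

theorem greedyDisp_add_period (u : ℤ → Fin ℓ → ZMod n) (T : ℤ) (hu : ∀ τ, u (τ + T) = u τ)
    (t : ℤ) (d : Fin ℓ → ZMod n) : greedyDisp u (t + T) d = greedyDisp u t d := by
  funext k
  induction k with
  | zero => rfl
  | succ k ih =>
    rw [greedyDisp, greedyDisp, ih, add_right_comm, hu]

/-- The displacement of timeslot `τ` when it hops along dimension `dim τ` by `scale τ`. -/
def axisStep (dim : ℤ → Fin ℓ) (scale : ℤ → ZMod n) (τ : ℤ) : Fin ℓ → ZMod n :=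
  Pi.single (dim τ) (scale τ)

variable {dim : ℤ → Fin ℓ} {scale : ℤ → ZMod n}

theorem greedyDisp_succ (hs : ∀ τ, scale τ ≠ 0) (t : ℤ) (d : Fin ℓ → ZMod n) (k : ℕ) :
    greedyDisp (axisStep dim scale) t d (k + 1) =
      if greedyDisp (axisStep dim scale) t d k (dim (t + k)) + scale (t + k) = d (dim (t + k)) then
        greedyDisp (axisStep dim scale) t d k + axisStep dim scale (t + k)
      else greedyDisp (axisStep dim scale) t d k := by
  rw [greedyDisp]
  simp only [axisStep, hammingDist_add_single_lt_iff _ _ _ (hs _)]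

theorem greedyDisp_apply_eq (hs : ∀ τ, scale τ ≠ 0) (t : ℤ) (d : Fin ℓ → ZMod n) (k : ℕ)
    (p : Fin ℓ) : greedyDisp (axisStep dim scale) t d k p = 0 ∨
      greedyDisp (axisStep dim scale) t d k p = d p := by
  induction k with
  | zero => left; rfl
  | succ k ih =>
    rw [greedyDisp_succ hs]
    split_ifs with h
    · by_cases hp : p = dim (t + k)
      · right; subst hp; rw [← h]; simp [axisStep]
      · simpa [axisStep, hp] using ih
    · exact ih

/-- Each coordinate of the displacement is untouched or already correct, and a correct one is never
changed, so a hop corrects a coordinate in one stroke. Hence a timeslot is used only by the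
distances with one prescribed coordinate. -/
theorem eq_scale_of_greedyDisp_ne (hs : ∀ τ, scale τ ≠ 0) {t : ℤ} {d : Fin ℓ → ZMod n} {k : ℕ}
    (h : greedyDisp (axisStep dim scale) t d (k + 1) ≠ greedyDisp (axisStep dim scale) t d k) :
    d (dim (t + k)) = scale (t + k) := by
  rw [greedyDisp_succ hs] at h
  split_ifs at h with h1
  · rcases greedyDisp_apply_eq (dim := dim) hs t d k (dim (t + k)) with h2 | h2
    · rw [← h1, h2, zero_add]
    · rw [h2] at h1
      exact absurd (add_eq_left.1 h1) (hs _)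
  · exact absurd rfl h

theorem greedyDisp_stable (hs : ∀ τ, scale τ ≠ 0) {t : ℤ} {d : Fin ℓ → ZMod n} {k : ℕ}
    {p : Fin ℓ} (h : greedyDisp (axisStep dim scale) t d k p = d p) {m : ℕ} (hm : k ≤ m) :
    greedyDisp (axisStep dim scale) t d m p = d p := by
  induction m, hm using Nat.le_induction with
  | base => exact h
  | succ m _ ih =>
    rw [greedyDisp_succ hs]
    split_ifs with h1
    · by_cases hp : p = dim (t + m)
      · rw [hp] at ih
        rw [ih] at h1
        exact absurd (add_eq_left.1 h1) (hs _)
      · simpa [axisStep, hp] using ih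
    · exact ih

/-- Within `T` timeslots, every nonzero coordinate `d p` meets the timeslot that hops along `p` by
exactly `d p`, and correct coordinates stay correct. -/
theorem greedyDisp_eq (hs : ∀ τ, scale τ ≠ 0) (T : ℕ)
    (hcover : ∀ t p s, s ≠ 0 → ∃ j < T, dim (t + (j : ℕ)) = p ∧ scale (t + (j : ℕ)) = s) (t : ℤ)
    (d : Fin ℓ → ZMod n) : greedyDisp (axisStep dim scale) t d T = d := by
  funext p
  by_cases hd : d p = 0
  · rcases greedyDisp_apply_eq (dim := dim) hs t d T p with h | h
    · rw [h, hd]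
    · exact h
  · obtain ⟨j, hj, h1, h2⟩ := hcover t p (d p) hd
    refine greedyDisp_stable hs (k := j + 1) ?_ hj
    rcases greedyDisp_apply_eq (dim := dim) hs t d j p with h | h
    · rw [greedyDisp_succ hs, h1, h, h2, zero_add, if_pos rfl]
      simp [axisStep, h1, h2, h]
    · exact greedyDisp_stable hs h (by omega)

end Greedy

section EBS

variable {ℓ n : ℕ}

theorem natCast_ne_zero_of_lt {s : ℕ} (h0 : 0 < s) (h : s < n) : (s : ZMod n) ≠ 0 := by
  rw [Ne, ZMod.natCast_eq_zero_iff]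
  exact fun hd => absurd (Nat.le_of_dvd h0 hd) (by omega)

/-- The dimension along which the schedule of the Elementary Basis Scheme hops. -/
def ebsDim (ℓ n : ℕ) (h : 0 < ℓ * (n - 1)) (τ : ℤ) : Fin ℓ :=
  ⟨(τ % (ℓ * (n - 1) : ℕ)).toNat / (n - 1), by
    have h1 := Int.emod_nonneg τ (b := (ℓ * (n - 1) : ℕ)) (by omega)
    have h2 := Int.emod_lt_of_pos τ (b := (ℓ * (n - 1) : ℕ)) (by omega)
    refine Nat.div_lt_of_lt_mul ?_
    exact lt_of_lt_of_eq (by omega) (mul_comm ℓ (n - 1))⟩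

/-- The scale factor of the hops in timeslot `τ` of the Elementary Basis Scheme. -/
def ebsScale (ℓ n : ℕ) (τ : ℤ) : ZMod n :=
  ((τ % (ℓ * (n - 1) : ℕ)).toNat % (n - 1) + 1 : ℕ)

theorem ebsScale_ne_zero (hn : 2 ≤ n) (τ : ℤ) : ebsScale ℓ n τ ≠ 0 := by
  have := Nat.mod_lt (τ % (ℓ * (n - 1) : ℕ)).toNat (show n - 1 > 0 by omega)
  exact natCast_ne_zero_of_lt (by omega) (by omega)

theorem ebs_slot (hn : 2 ≤ n) (h : 0 < ℓ * (n - 1)) (τ : ℤ) (p : Fin ℓ) (s : ℕ) (hs : 1 ≤ s)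
    (hsn : s < n) (hτ : τ % (ℓ * (n - 1) : ℕ) = ((n - 1) * (p : ℕ) + s - 1 : ℕ)) :
    ebsDim ℓ n h τ = p ∧ ebsScale ℓ n τ = s := by
  have h1 : (τ % (ℓ * (n - 1) : ℕ)).toNat = (n - 1) * (p : ℕ) + (s - 1) := by omega
  have h2 : 0 < n - 1 := by omega
  constructor
  · ext
    simp only [ebsDim]
    rw [h1, Nat.mul_add_div h2, Nat.div_eq_of_lt (by omega), add_zero]
  · simp only [ebsScale]
    rw [h1, Nat.mul_add_mod, Nat.mod_eq_of_lt (by omega), Nat.sub_add_cancel hs]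

theorem ebs_index_lt (hn : 2 ≤ n) (p : Fin ℓ) (s : ℕ) (hsn : s < n) :
    (n - 1) * (p : ℕ) + s - 1 < ℓ * (n - 1) := by
  have h1 : (n - 1) * ((p : ℕ) + 1) ≤ (n - 1) * ℓ := Nat.mul_le_mul_left _ p.2
  rw [mul_comm ℓ]
  rw [mul_add] at h1
  omega

theorem ebs_cover (hn : 2 ≤ n) (h : 0 < ℓ * (n - 1)) (t : ℤ) (p : Fin ℓ) (s : ZMod n)
    (hs : s ≠ 0) : ∃ j < ℓ * (n - 1), ebsDim ℓ n h (t + (j : ℕ)) = p ∧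
      ebsScale ℓ n (t + (j : ℕ)) = s := by
  have : NeZero n := ⟨by omega⟩
  have hsv : s.val ≠ 0 := by rwa [Ne, ZMod.val_eq_zero]
  have hsn := ZMod.val_lt s
  set x := (n - 1) * (p : ℕ) + s.val - 1 with hx
  have hxT := ebs_index_lt hn p s.val hsn
  have hT : (0 : ℤ) < (ℓ * (n - 1) : ℕ) := by exact_mod_cast h
  have h1 := Int.emod_nonneg (x - t) hT.ne'
  have h2 := Int.emod_lt_of_pos (x - t) hT
  -- `x` is the position of the hop `(p, s)` within a period, and the witness is the time from `t`
  -- to its next occurrence.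
  refine ⟨((x - t) % (ℓ * (n - 1) : ℕ)).toNat, by omega, ?_⟩
  have h3 : (t + (((x - t) % (ℓ * (n - 1) : ℕ)).toNat : ℤ)) % (ℓ * (n - 1) : ℕ) = (x : ℕ) := by
    rw [Int.toNat_of_nonneg h1, Int.add_emod_emod, add_sub_cancel]
    exact Int.emod_eq_of_lt (by omega) (by exact_mod_cast hxT)
  have h4 := ebs_slot hn h _ p s.val (by omega) hsn h3
  rwa [ZMod.natCast_zmod_val] at h4

/-- The translation of timeslot `τ` in the Elementary Basis Scheme. -/
def ebsStep (ℓ n : ℕ) (h : 0 < ℓ * (n - 1)) : ℤ → Fin ℓ → ZMod n :=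
  axisStep (ebsDim ℓ n h) (ebsScale ℓ n)

theorem ebsStep_add_period (h : 0 < ℓ * (n - 1)) (τ : ℤ) :
    ebsStep ℓ n h (τ + (ℓ * (n - 1) : ℕ)) = ebsStep ℓ n h τ := by
  simp only [ebsStep, axisStep, ebsDim, ebsScale, Int.add_emod_right]

/-- The schedule of the Elementary Basis Scheme. -/
def ebsSchedule (h : 0 < ℓ * (n - 1)) (φ : Fin N ≃ (Fin ℓ → ZMod n)) : ConnectionSchedule N :=
  translationSchedule φ (ℓ * (n - 1)) h fun k => ebsStep ℓ n h k

theorem ebsSchedule_at_ (h : 0 < ℓ * (n - 1)) (φ : Fin N ≃ (Fin ℓ → ZMod n)) (τ : ℤ) (i : Fin N) :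
    φ ((ebsSchedule h φ).at_ τ i) = φ i + ebsStep ℓ n h τ := by
  have hT : (0 : ℤ) < (ℓ * (n - 1) : ℕ) := by exact_mod_cast h
  rw [ebsSchedule, translationSchedule_at_]
  simp only [ebsStep, axisStep, ebsDim, ebsScale, Int.toNat_of_nonneg (Int.emod_nonneg τ hT.ne'),
    Int.emod_emod]

theorem ebs_greedyDisp_eq (hn : 2 ≤ n) (h : 0 < ℓ * (n - 1)) (t : ℤ) (d : Fin ℓ → ZMod n) :
    greedyDisp (ebsStep ℓ n h) t d (ℓ * (n - 1)) = d :=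
  greedyDisp_eq (ebsScale_ne_zero hn) _ (ebs_cover hn h) t d

/-- The semi-paths of the Elementary Basis Scheme. -/
def ebsScheme (hn : 2 ≤ n) (h : 0 < ℓ * (n - 1)) (φ : Fin N ≃ (Fin ℓ → ZMod n)) :
    SemiPathScheme (ebsSchedule h φ) (Fin ℓ → ZMod n) where
  φ := φ
  u := ebsStep ℓ n h
  u_ne_zero τ := by simpa [ebsStep, axisStep] using ebsScale_ne_zero hn τ
  at_apply := ebsSchedule_at_ h φ
  M := ℓ * (n - 1)
  wait _ := 0
  wait_add_period _ := rfl
  wait_add_M _ := rfl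
  Start _ := True
  start_wait _ := trivial
  start_add_M _ _ := trivial
  disp := greedyDisp (ebsStep ℓ n h)
  disp_zero _ _ := rfl
  disp_M t d _ := ebs_greedyDisp_eq hn h t d
  disp_succ t d k _ _ := by
    rw [greedyDisp]
    split_ifs
    · exact Or.inr rfl
    · exact Or.inl rfl
  disp_add_period := greedyDisp_add_period _ _ (ebsStep_add_period h)
  len t d := sInf {k | greedyDisp (ebsStep ℓ n h) t d k = d}
  len_le t d _ := Nat.sInf_le (ebs_greedyDisp_eq hn h t d)
  disp_len t d _ := Nat.sInf_mem (s := {k | greedyDisp (ebsStep ℓ n h) t d k = d})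
    ⟨_, ebs_greedyDisp_eq hn h t d⟩
  len_add_period t d := by
    rw [greedyDisp_add_period]
    exact ebsStep_add_period h

theorem ebsScheme_semi (hn : 2 ≤ n) (h : 0 < ℓ * (n - 1)) (φ : Fin N ≃ (Fin ℓ → ZMod n))
    (a c : Fin N) (t : ℤ) (k : ℕ) :
    greedyNode (ebsSchedule h φ) φ a c t k = (ebsScheme hn h φ).semi a c t k := by
  apply φ.injective
  rw [φ_greedyNode φ (ebsStep ℓ n h) (ebsSchedule_at_ h φ)]
  exact ((ebsScheme hn h φ).φ_semi a c t k).symm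

theorem isEBSPath_iff (hn : 2 ≤ n) (h : 0 < ℓ * (n - 1)) (φ : Fin N ≃ (Fin ℓ → ZMod n))
    (a b : Fin N) (t : ℤ) (c : Fin N) (P : Path (ebsSchedule h φ)) :
    IsEBSPath φ a b t c P ↔ P = (ebsScheme hn h φ).path a b t c := by
  set Z := ebsScheme hn h φ with hZ
  have hw : Z.wait t = 0 := rfl
  have hM : Z.M = ℓ * (n - 1) := rfl
  have hT : (ebsSchedule h φ).T = ℓ * (n - 1) := rfl
  have hreach : ∀ k, greedyNode (ebsSchedule h φ) φ c b (t + (ebsSchedule h φ).T) k = b ↔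
      greedyDisp (ebsStep ℓ n h) (t + (ebsSchedule h φ).T) (φ b - φ c) k = φ b - φ c := by
    intro k
    rw [← φ.injective.eq_iff, φ_greedyNode φ (ebsStep ℓ n h) (ebsSchedule_at_ h φ),
      eq_sub_iff_add_eq, add_comm]
  have hleast : IsLeast {k | greedyNode (ebsSchedule h φ) φ c b (t + (ebsSchedule h φ).T) k = b}
      (Z.len (t + (ebsSchedule h φ).T) (φ b - φ c)) := by
    constructor
    · exact (hreach _).2 (Z.disp_len _ _ trivial)
    · intro k hk
      exact Nat.sInf_le ((hreach k).1 hk)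
  rw [← Z.visits_iff]
  have hlen : Z.length b t c =
      (ebsSchedule h φ).T + Z.len (t + (ebsSchedule h φ).T) (φ b - φ c) := by
    unfold SemiPathScheme.length
    rw [hw, hM, hT, zero_add, Nat.cast_zero, add_zero]
    rfl
  have hnodes : Z.nodes a b t c = fun k =>
      if k < (ebsSchedule h φ).T then greedyNode (ebsSchedule h φ) φ a c t k
      else greedyNode (ebsSchedule h φ) φ c b (t + (ebsSchedule h φ).T)
        (k - (ebsSchedule h φ).T) := by
    funext k
    have hsemi : ∀ a c t k, greedyNode (ebsSchedule h φ) φ a c t k = Z.semi a c t k :=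
      ebsScheme_semi hn h φ
    simp only [SemiPathScheme.nodes, hw, hM, hT, hsemi]
    simp
  rw [hlen, hnodes]
  constructor
  · rintro ⟨-, m, hm, hv⟩
    rwa [hm.unique hleast] at hv
  · intro hv
    refine ⟨?_, _, hleast, hv⟩
    rw [ebsScheme_semi hn h]
    exact Z.semi_M a c trivial

theorem card_filter_apply_eq [NeZero n] (p : Fin ℓ) (s : ZMod n) :
    (Finset.univ.filter fun d : Fin ℓ → ZMod n => d p = s).card = n ^ (ℓ - 1) := by
  have h1 : (Finset.univ.filter fun d : Fin ℓ → ZMod n => d p = s) =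
      Fintype.piFinset fun i => if i = p then {s} else Finset.univ := by
    ext d
    simp only [Finset.mem_filter, Finset.mem_univ, true_and, Fintype.mem_piFinset]
    constructor
    · intro h i
      split_ifs with hi
      · rw [hi, Finset.mem_singleton, h]
      · exact Finset.mem_univ _
    · intro h
      simpa using h p
  rw [h1, Fintype.card_piFinset, ← Finset.mul_prod_erase _ _ (Finset.mem_univ p)]
  rw [Finset.prod_congr rfl (g := fun _ => n)]
  · simp
  · intro i hi
    rw [if_neg (Finset.ne_of_mem_erase hi)]
    simp

theorem ebsScheme_hopCount_le [NeZero n] (hn : 2 ≤ n) (h : 0 < ℓ * (n - 1))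
    (φ : Fin N ≃ (Fin ℓ → ZMod n)) (t τ : ℤ) :
    (ebsScheme hn h φ).hopCount t τ ≤
      if t ∈ Finset.Ioc (τ - (ℓ * (n - 1) : ℕ)) τ then n ^ (ℓ - 1) else 0 := by
  have hM : (ebsScheme hn h φ).M = ℓ * (n - 1) := rfl
  split_ifs with ht
  · rw [← card_filter_apply_eq (ebsDim ℓ n h τ) (ebsScale ℓ n τ)]
    refine SemiPathScheme.hopCount_le _ _ _ _ fun d k hk hτ hne => ?_
    subst hτ
    rw [Finset.mem_filter]
    exact ⟨Finset.mem_univ _, eq_scale_of_greedyDisp_ne (ebsScale_ne_zero hn) hne⟩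
  · rw [← Finset.card_empty (α := Fin ℓ → ZMod n)]
    refine SemiPathScheme.hopCount_le _ _ _ _ fun d k hk hτ hne => absurd ?_ ht
    rw [hM] at hk
    rw [Finset.mem_Ioc]
    omega

/-- The Elementary Basis Scheme of order `ℓ` guarantees throughput `1 / (2 ℓ)` with maximum latency
at most two periods. -/
theorem exists_isEBS (hℓ : 1 ≤ ℓ) (hn : 2 ≤ n) (r : ℝ≥0) (hr : 2 * r * ℓ ≤ 1) :
    ∃ X : Design (n ^ ℓ), X.IsEBS ℓ n ∧ X.GuaranteesThroughput r ∧
      X.maxLatency ≤ ((2 * (ℓ * (n - 1)) : ℕ) : ℕ∞) := by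
  have : NeZero n := ⟨by omega⟩
  have h : 0 < ℓ * (n - 1) := Nat.mul_pos (by omega) (by omega)
  have hN : 0 < n ^ ℓ := by positivity
  have hcard : Fintype.card (Fin (n ^ ℓ)) = Fintype.card (Fin ℓ → ZMod n) := by simp
  let φ : Fin (n ^ ℓ) ≃ (Fin ℓ → ZMod n) := Fintype.equivOfCardEq hcard
  let Z := ebsScheme hn h φ
  classical
  refine ⟨Z.design hN, ⟨hℓ, hn, φ, rfl, ?_, ?_⟩, ?_, ?_⟩
  · intro p s hs hsn i
    refine (ebsSchedule_at_ h φ _ i).trans ?_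
    have hlt := ebs_index_lt hn p s hsn
    obtain ⟨h1, h2⟩ := ebs_slot hn h (((n - 1) * (p : ℕ) + s - 1 : ℕ) : ℤ) p s hs hsn
      (Int.emod_eq_of_lt (by omega) (by exact_mod_cast hlt))
    rw [ebsStep, axisStep, h1, h2]
  · intro a b t P
    change (Finset.card _ : ℝ≥0) / _ = _
    congr 3
    ext c
    rw [Finset.mem_filter]
    erw [Finset.mem_filter]
    exact and_congr_right fun _ => (isEBSPath_iff hn h φ a b t c P).symm
  · refine Z.design_guaranteesThroughput hN r fun τ => ?_
    -- The semi-paths that may hop in timeslot `τ` start in one of the last `ℓ (n - 1)` timeslots,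
    -- and from each of these at most `n ^ (ℓ - 1)` distances do so.
    have h1 : ∑' t : ℤ, (Z.hopCount (t + Z.wait t) τ : ℝ≥0∞) ≤
        ((ℓ * n ^ ℓ : ℕ) : ℝ≥0∞) := by
      calc _ ≤ ∑' t : ℤ, (if t ∈ Finset.Ioc (τ - (ℓ * (n - 1) : ℕ)) τ then
            ((n ^ (ℓ - 1) : ℕ) : ℝ≥0∞) else 0) := by
            refine ENNReal.tsum_le_tsum fun t => ?_
            have := ebsScheme_hopCount_le hn h φ t τ
            have hw : t + ((Z.wait t : ℕ) : ℤ) = t := add_zero t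
            rw [hw]
            refine (Nat.cast_le.2 this).trans (le_of_eq ?_)
            split_ifs <;> simp
        _ = ((ℓ * (n - 1) * n ^ (ℓ - 1) : ℕ) : ℝ≥0∞) := by
            rw [tsum_eq_sum (s := Finset.Ioc (τ - (ℓ * (n - 1) : ℕ)) τ)]
            · rw [Finset.sum_congr rfl (fun t ht => if_pos ht), Finset.sum_const, Int.card_Ioc,
                sub_sub_cancel, Int.toNat_natCast, nsmul_eq_mul, ← Nat.cast_mul]
            · intro t ht
              rw [if_neg ht]
        _ ≤ _ := by
            refine Nat.cast_le.2 ?_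
            obtain ⟨k, rfl⟩ : ∃ k, ℓ = k + 1 := ⟨ℓ - 1, by omega⟩
            rw [mul_assoc, Nat.add_sub_cancel, pow_succ']
            gcongr
            omega
    calc _ ≤ 2 * (r : ℝ≥0∞) * ((ℓ * n ^ ℓ : ℕ) : ℝ≥0∞) := by gcongr
      _ = ((2 * r * ℓ : ℝ≥0) : ℝ≥0∞) * ((n ^ ℓ : ℕ) : ℝ≥0∞) := by push_cast; ring
      _ ≤ 1 * ((n ^ ℓ : ℕ) : ℝ≥0∞) := by gcongr; exact_mod_cast hr
      _ = _ := one_mul _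
  · have := Z.design_maxLatency_le hN 0 (fun _ => le_rfl)
    rwa [zero_add] at this

end EBS

end ORN

namespace ORN

variable {N : ℕ}

/-! ### Vandermonde vectors and the choice of semi-paths -/

section Vandermonde

variable {n h : ℕ} [Fact n.Prime]

/-- At most `h + 1` Vandermonde vectors at distinct points are linearly independent. -/
theorem eq_zero_of_sum_smul_vandermondeVec {ι : Type*} (s : Finset ι) (x : ι → ℤ)
    (hx : Set.InjOn (fun i => (x i : ZMod n)) s) (hs : s.card ≤ h + 1) (c : ι → ZMod n)
    (H : ∑ i ∈ s, c i • vandermondeVec n h (x i) = 0) : ∀ i ∈ s, c i = 0 := by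
  classical
  intro i₀ hi₀
  -- This polynomial vanishes at all points but `x i₀`. Having degree at most `h`, it acts on
  -- Vandermonde vectors as a linear functional, which isolates the coefficient `c i₀`.
  set f : Polynomial (ZMod n) :=
    ∏ i ∈ s.erase i₀, (Polynomial.X - Polynomial.C (x i : ZMod n)) with hf
  have hdeg : f.natDegree < h + 1 := by
    rw [hf, Polynomial.natDegree_finsetProd_X_sub_C_eq_card, Finset.card_erase_of_mem hi₀]
    have := Finset.card_pos.2 ⟨i₀, hi₀⟩
    omega
  have h1 : ∑ i ∈ s, c i * f.eval (x i : ZMod n) = 0 := by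
    simp only [Polynomial.eval_eq_sum_range' hdeg, Finset.mul_sum]
    rw [Finset.sum_comm]
    refine Finset.sum_eq_zero fun j hj => ?_
    have h2 := congrFun H ⟨j, Finset.mem_range.1 hj⟩
    simp only [Finset.sum_apply, Pi.smul_apply, vandermondeVec, smul_eq_mul, Pi.zero_apply] at h2
    calc _ = f.coeff j * ∑ i ∈ s, c i * (x i : ZMod n) ^ j := by
          rw [Finset.mul_sum]; exact Finset.sum_congr rfl fun i _ => by ring
      _ = 0 := by rw [h2, mul_zero]
  rw [Finset.sum_eq_single_of_mem i₀ hi₀] at h1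
  · refine (mul_eq_zero.1 h1).resolve_right ?_
    rw [hf, Polynomial.eval_prod]
    refine Finset.prod_ne_zero_iff.2 ?_
    intro i hi
    rw [Polynomial.eval_sub, Polynomial.eval_X, Polynomial.eval_C, sub_ne_zero]
    intro he
    exact (Finset.ne_of_mem_erase hi) (hx (Finset.mem_of_mem_erase hi) hi₀ he.symm)
  · intro i hi hne
    rw [hf, Polynomial.eval_prod, Finset.prod_eq_zero (Finset.mem_erase.2 ⟨hne, hi⟩), mul_zero]
    simp

theorem injOn_intCast_add (q : ℤ) (s : Finset ℕ) (hs : ∀ j ∈ s, j < n) :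
    Set.InjOn (fun j : ℕ => ((q + j : ℤ) : ZMod n)) s := by
  intro i hi j hj hij
  simp only [Int.cast_add, Int.cast_natCast, add_right_inj] at hij
  rw [ZMod.natCast_eq_natCast_iff'] at hij
  rwa [Nat.mod_eq_of_lt (hs i hi), Nat.mod_eq_of_lt (hs j hj)] at hij

theorem IsSingleBasis.unique (hn : h + 1 ≤ n) {q : ℤ} {d : Fin (h + 1) → ZMod n}
    {s s' : ℕ → ZMod n} (H : IsSingleBasis n h q d s) (H' : IsSingleBasis n h q d s') :
    s = s' := by
  have h1 := eq_zero_of_sum_smul_vandermondeVec (h := h) (Finset.range (h + 1)) (fun j => q + j)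
    (injOn_intCast_add q _ fun j hj => by have := Finset.mem_range.1 hj; omega) (by simp)
    (fun j => s j - s' j) (by
      simp only [sub_smul, Finset.sum_sub_distrib]
      rw [H.2, H'.2, sub_self])
  funext j
  by_cases hj : j < h + 1
  · exact sub_eq_zero.1 (h1 j (Finset.mem_range.2 hj))
  · rw [not_imp_comm.1 (H.1 j) hj, not_imp_comm.1 (H'.1 j) hj]

theorem exists_isSingleBasis (hn : h + 1 ≤ n) (q : ℤ) (d : Fin (h + 1) → ZMod n) :
    ∃ s, IsSingleBasis n h q d s := by
  let F : (Fin (h + 1) → ZMod n) → (Fin (h + 1) → ZMod n) := fun c =>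
    ∑ i, c i • vandermondeVec n h (q + (i : ℕ))
  have hF : Function.Injective F := by
    intro c c' hcc
    have h1 := eq_zero_of_sum_smul_vandermondeVec (h := h) Finset.univ
      (fun i : Fin (h + 1) => q + (i : ℕ)) (by
        intro i _ j _ hij
        refine Fin.ext (injOn_intCast_add q (Finset.range (h + 1)) (fun j hj => ?_)
          (Finset.mem_coe.2 (Finset.mem_range.2 i.2)) (Finset.mem_coe.2 (Finset.mem_range.2 j.2))
          hij)
        have := Finset.mem_range.1 hj; omega) (by simp)
      (fun i => c i - c' i) (by
        simp only [sub_smul, Finset.sum_sub_distrib]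
        exact sub_eq_zero.2 hcc)
    funext i
    exact sub_eq_zero.1 (h1 i (Finset.mem_univ i))
  obtain ⟨c, hc⟩ := Finite.injective_iff_surjective.1 hF d
  refine ⟨fun j => if hj : j < h + 1 then c ⟨j, hj⟩ else 0, fun j hj => ?_, ?_⟩
  · by_contra hlt
    simp [hlt] at hj
  · rw [← hc, Finset.sum_range]
    exact Finset.sum_congr rfl fun i _ => by dsimp only; rw [dif_pos i.2]

theorem IsSingleBasis.smul {q : ℤ} {d : Fin (h + 1) → ZMod n} {s : ℕ → ZMod n}
    (H : IsSingleBasis n h q d s) (α : ZMod n) : IsSingleBasis n h q (α • d) (α • s) := by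
  refine ⟨fun j hj => H.1 j fun h0 => hj (by simp [h0]), ?_⟩
  rw [← H.2, Finset.smul_sum]
  simp [smul_smul]

/-- The phases with a hop. -/
def hopSupport (K : ℕ) (s : ℕ → ZMod n) : Finset ℕ := (Finset.range K).filter fun j => s j ≠ 0

theorem hopSupport_smul (K : ℕ) (s : ℕ → ZMod n) {α : ZMod n} (hα : α ≠ 0) :
    hopSupport K (α • s) = hopSupport K s := by
  unfold hopSupport
  congr 1
  ext j
  simp [hα]

theorem IsHopEfficient.smul {Q : ℕ} {q : ℤ} {d : Fin (h + 1) → ZMod n} {s : ℕ → ZMod n}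
    (H : IsHopEfficient n h Q q d s) {α : ZMod n} (hα : α ≠ 0) :
    IsHopEfficient n h Q q (α • d) (α • s) := by
  refine ⟨fun j hj => H.1 j fun h0 => hj (by simp [h0]), ?_, ?_⟩
  · exact (congrArg Finset.card (hopSupport_smul (h + 1 + Q) s hα)).trans H.2.1
  · rw [← H.2.2, Finset.smul_sum]
    simp [smul_smul]

/-- The `h` Vandermonde vectors of the support are independent, their phases being distinct modulo
`n` by `hn`. The support thus serves as a finite label for the hop vector. -/
theorem IsHopEfficient.eq_of_hopSupport_eq {Q : ℕ} (hn : h + 1 + Q < n) {q : ℤ}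
    {d : Fin (h + 1) → ZMod n} {s s' : ℕ → ZMod n} (H : IsHopEfficient n h Q q d s)
    (H' : IsHopEfficient n h Q q d s')
    (hs : hopSupport (h + 1 + Q) s = hopSupport (h + 1 + Q) s') : s = s' := by
  have hsum : ∀ {s : ℕ → ZMod n}, IsHopEfficient n h Q q d s →
      ∑ j ∈ hopSupport (h + 1 + Q) s, s j • vandermondeVec n h (q + j) = d := by
    intro s H
    rw [← H.2.2, hopSupport]
    refine Finset.sum_filter_of_ne fun j _ hj h0 => hj ?_
    rw [h0, zero_smul]
  have h1 := eq_zero_of_sum_smul_vandermondeVec (h := h) (hopSupport (h + 1 + Q) s)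
    (fun j => q + j)
    (injOn_intCast_add q _ fun j hj => by
      have := Finset.mem_range.1 (Finset.mem_filter.1 hj).1; omega)
    (H.2.1.le.trans (Nat.le_succ h))
    (fun j => s j - s' j) (by
      simp only [sub_smul, Finset.sum_sub_distrib]
      rw [hsum H]
      rw [hs, hsum H', sub_self])
  funext j
  by_cases hj : j ∈ hopSupport (h + 1 + Q) s
  · exact sub_eq_zero.1 (h1 j hj)
  · have h2 : ∀ {s : ℕ → ZMod n}, IsHopEfficient n h Q q d s →
        j ∉ hopSupport (h + 1 + Q) s → s j = 0 := by
      intro s H hj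
      by_contra h0
      exact hj (Finset.mem_filter.2 ⟨Finset.mem_range.2 (H.1 j h0).2, h0⟩)
    rw [h2 H hj, h2 H' (hs ▸ hj)]

/-- A choice of hop vectors for the semi-paths that start with phase `0`, homogeneous in the
distance. -/
theorem exists_homogeneous_choice {Q : ℕ} (hn : h + 1 + Q < n) :
    ∃ s : (Fin (h + 1) → ZMod n) → ℕ → ZMod n,
      (∀ d, IsHopEfficient n h Q 0 d (s d) ∨
        ((¬ ∃ s', IsHopEfficient n h Q 0 d s') ∧ IsSingleBasis n h 0 d (s d))) ∧
      ∀ (α : ZMod n), α ≠ 0 → ∀ d, s (α • d) = α • s d := by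
  classical
  -- The set of possible supports is invariant under nonzero scalars. A choice of support that
  -- depends only on this set is the same for proportional distances, and the support determines the
  -- hop vector, which is therefore homogeneous.
  let A : (Fin (h + 1) → ZMod n) → Set (Finset ℕ) := fun d =>
    {t | ∃ s', IsHopEfficient n h Q 0 d s' ∧ hopSupport (h + 1 + Q) s' = t}
  have hA : ∀ (α : ZMod n), α ≠ 0 → ∀ d, A (α • d) = A d := by
    have hsub : ∀ (α : ZMod n), α ≠ 0 → ∀ d, A d ⊆ A (α • d) := by
      rintro α hα d t ⟨s', h1, h2⟩
      exact ⟨α • s', h1.smul hα, (hopSupport_smul _ _ hα).trans h2⟩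
    intro α hα d
    refine Set.Subset.antisymm ?_ (hsub α hα d)
    have := hsub α⁻¹ (inv_ne_zero hα) (α • d)
    rwa [smul_smul, inv_mul_cancel₀ hα, one_smul] at this
  let pick : Set (Finset ℕ) → Finset ℕ := fun A => if hA : A.Nonempty then hA.some else ∅
  have hex : ∀ d, ∃ s : ℕ → ZMod n,
      (IsHopEfficient n h Q 0 d s ∧ hopSupport (h + 1 + Q) s = pick (A d)) ∨
      ((¬ ∃ s', IsHopEfficient n h Q 0 d s') ∧ IsSingleBasis n h 0 d s) := by
    intro d
    by_cases hd : (A d).Nonempty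
    · obtain ⟨s, h1, h2⟩ := hd.some_mem
      refine ⟨s, Or.inl ⟨h1, ?_⟩⟩
      simp only [pick, dif_pos hd, h2]
    · obtain ⟨s, hs⟩ := exists_isSingleBasis (h := h) (n := n) (by omega) 0 d
      refine ⟨s, Or.inr ⟨?_, hs⟩⟩
      rintro ⟨s', hs'⟩
      exact hd ⟨_, s', hs', rfl⟩
  choose s hs using hex
  refine ⟨s, fun d => (hs d).imp_left And.left, fun α hα d => ?_⟩
  rcases hs d with ⟨h1, h2⟩ | ⟨h1, h2⟩
  · rcases hs (α • d) with ⟨h3, h4⟩ | ⟨h3, h4⟩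
    · refine h3.eq_of_hopSupport_eq hn (h1.smul hα) ?_
      rw [hopSupport_smul _ _ hα, h2, h4, hA α hα]
    · exact absurd ⟨_, h1.smul hα⟩ h3
  · rcases hs (α • d) with ⟨h3, h4⟩ | ⟨h3, h4⟩
    · refine absurd ⟨α⁻¹ • s (α • d), ?_⟩ h1
      have := h3.smul (inv_ne_zero hα)
      rwa [smul_smul α⁻¹ α d, inv_mul_cancel₀ hα, one_smul] at this
    · exact h4.unique (by omega) (h2.smul α)

end Vandermonde

/-! ### Counting hops -/

section Counting

/-- A weak form of the Bonferroni inequality. -/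
theorem mul_card_le_card_biUnion_add {ι α : Type*} [DecidableEq ι] [DecidableEq α]
    (s : Finset ι) (A : ι → Finset α) (a b : ℕ)
    (ha : ∀ i ∈ s, a ≤ (A i).card) (hb : ∀ i ∈ s, ∀ j ∈ s, i ≠ j → (A i ∩ A j).card ≤ b) :
    s.card * a ≤ (s.biUnion A).card + s.card * s.card * b := by
  induction s using Finset.induction_on with
  | empty => simp
  | insert i s hi ih =>
    have h1 := ih (fun j hj => ha j (Finset.mem_insert_of_mem hj))
      (fun j hj k hk => hb j (Finset.mem_insert_of_mem hj) k (Finset.mem_insert_of_mem hk))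
    have h2 : (A i ∩ s.biUnion A).card ≤ s.card * b := by
      rw [Finset.inter_biUnion]
      refine Finset.card_biUnion_le_card_mul _ _ _ fun j hj => ?_
      exact hb i (Finset.mem_insert_self _ _) j (Finset.mem_insert_of_mem hj)
        (fun h => hi (h ▸ hj))
    have h3 := Finset.card_union_add_card_inter (A i) (s.biUnion A)
    have h4 := ha i (Finset.mem_insert_self _ _)
    rw [Finset.biUnion_insert, Finset.card_insert_of_notMem hi]
    have : (s.card + 1) * (s.card + 1) * b = s.card * s.card * b + s.card * b + s.card * b + b := by
      ring
    rw [this, add_mul, one_mul]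
    omega

variable {n h : ℕ} [Fact n.Prime]

/-- Vectors with nonzero coordinates with respect to the Vandermonde vectors indexed by `t`. -/
def fullSupportVectors (n h : ℕ) [Fact n.Prime] (t : Finset ℕ) : Finset (Fin (h + 1) → ZMod n) :=
  (Fintype.piFinset fun _ : t => (Finset.univ : Finset (ZMod n)).erase 0).image
    fun c => ∑ i : t, c i • vandermondeVec n h (0 + (i : ℕ))

theorem card_fullSupportVectors {t : Finset ℕ} (ht : t.card = h) (htn : ∀ j ∈ t, j < n) :
    (fullSupportVectors n h t).card = (n - 1) ^ h := by
  unfold fullSupportVectors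
  rw [Finset.card_image_of_injective]
  · simp [ht, ZMod.card]
  · intro c c' hcc
    have h1 := eq_zero_of_sum_smul_vandermondeVec (h := h) Finset.univ
      (fun i : t => (0 : ℤ) + (i : ℕ)) (by
        intro i _ j _ hij
        exact Subtype.ext (injOn_intCast_add (n := n) 0 t htn i.2 j.2 hij)) (by simp; omega)
      (fun i => c i - c' i) (by
        simp only [sub_smul, Finset.sum_sub_distrib]
        exact sub_eq_zero.2 hcc)
    funext i
    exact sub_eq_zero.1 (h1 i (Finset.mem_univ i))

theorem mem_fullSupportVectors {t : Finset ℕ} {d : Fin (h + 1) → ZMod n}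
    (hd : d ∈ fullSupportVectors n h t) :
    ∃ c : ℕ → ZMod n, (∀ j, c j ≠ 0 ↔ j ∈ t) ∧ ∑ j ∈ t, c j • vandermondeVec n h (0 + j) = d := by
  obtain ⟨c, hc, rfl⟩ := Finset.mem_image.1 hd
  refine ⟨fun j => if hj : j ∈ t then c ⟨j, hj⟩ else 0, fun j => ?_, ?_⟩
  · by_cases hj : j ∈ t
    · have := Fintype.mem_piFinset.1 hc ⟨j, hj⟩
      simp only [hj, dif_pos, iff_true]
      exact Finset.ne_of_mem_erase this
    · simp [hj]
  · rw [← Finset.sum_coe_sort t]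
    simp

theorem isHopEfficient_of_mem {Q : ℕ} {t : Finset ℕ}
    (ht : t ∈ (Finset.Ico (h + 1) (h + 1 + Q)).powersetCard h) {d : Fin (h + 1) → ZMod n}
    (hd : d ∈ fullSupportVectors n h t) : ∃ s, IsHopEfficient n h Q 0 d s := by
  obtain ⟨ht1, ht2⟩ := Finset.mem_powersetCard.1 ht
  obtain ⟨c, hc, hsum⟩ := mem_fullSupportVectors hd
  have hf : (Finset.range (h + 1 + Q)).filter (fun j => c j ≠ 0) = t := by
    ext j
    rw [Finset.mem_filter, hc, Finset.mem_range, and_iff_right_iff_imp]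
    exact fun hj => (Finset.mem_Ico.1 (ht1 hj)).2
  refine ⟨c, fun j hj => Finset.mem_Ico.1 (ht1 ((hc j).1 hj)), ?_, ?_⟩
  · rw [hf, ht2]
  · rw [← hsum]
    symm
    refine Finset.sum_subset (hf ▸ Finset.filter_subset _ _) fun j _ hj => ?_
    rw [not_not.1 (mt (hc j).1 hj), zero_smul]

/-- For `j₀ ∈ t \ t'` the `h + 1` vectors indexed by `insert j₀ t'` are independent. If two common
elements have the same coefficients on `t.erase j₀`, their difference is a multiple of `v(j₀)` in
the span of `t'`, hence zero. So `h - 1` coefficients determine a common element. -/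
theorem card_fullSupportVectors_inter_le {t t' : Finset ℕ} (hne : t ≠ t') (ht : t.card = h)
    (ht' : t'.card = h) (htn : ∀ j ∈ t, j < n) (htn' : ∀ j ∈ t', j < n) :
    (fullSupportVectors n h t ∩ fullSupportVectors n h t').card ≤ n ^ (h - 1) := by
  classical
  obtain ⟨j₀, hj₀, hj₀'⟩ : ∃ j ∈ t, j ∉ t' := by
    by_contra! hsub
    exact hne (Finset.eq_of_subset_of_card_le hsub (by omega))
  have hc1 : ∀ d ∈ fullSupportVectors n h t ∩ fullSupportVectors n h t', ∃ c : ℕ → ZMod n,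
      ∑ j ∈ t, c j • vandermondeVec n h (0 + j) = d := fun d hd =>
    (mem_fullSupportVectors (Finset.mem_inter.1 hd).1).imp fun _ h => h.2
  have hc2 : ∀ d ∈ fullSupportVectors n h t ∩ fullSupportVectors n h t', ∃ c : ℕ → ZMod n,
      ∑ j ∈ t', c j • vandermondeVec n h (0 + j) = d := fun d hd =>
    (mem_fullSupportVectors (Finset.mem_inter.1 hd).2).imp fun _ h => h.2
  choose! c hc using hc1
  choose! c' hc' using hc2
  have hcard : (Finset.univ : Finset (↥(t.erase j₀) → ZMod n)).card = n ^ (h - 1) := by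
    simp [ZMod.card, Finset.card_erase_of_mem hj₀, ht]
  rw [← hcard]
  refine Finset.card_le_card_of_injOn (fun d i => c d i) (fun _ _ => Finset.mem_univ _) ?_
  intro d hd e he hde
  have heq : ∀ j ∈ t.erase j₀, c d j = c e j := fun j hj => congrFun hde ⟨j, hj⟩
  have hsub : ∑ j ∈ t, (c d j - c e j) • vandermondeVec n h (0 + j) = d - e := by
    simp only [sub_smul, Finset.sum_sub_distrib]
    rw [hc d hd, hc e he]
  have hsub' : ∑ j ∈ t', (c' d j - c' e j) • vandermondeVec n h (0 + j) = d - e := by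
    simp only [sub_smul, Finset.sum_sub_distrib]
    rw [hc' d hd, hc' e he]
  rw [← Finset.add_sum_erase _ _ hj₀, Finset.sum_eq_zero (s := t.erase j₀), add_zero] at hsub
  · have h1 := eq_zero_of_sum_smul_vandermondeVec (n := n) (h := h) (insert j₀ t')
      (fun j => (0 : ℤ) + j)
      (injOn_intCast_add 0 _ fun j hj => by
        rcases Finset.mem_insert.1 hj with rfl | hj
        · exact htn _ hj₀
        · exact htn' j hj)
      (by rw [Finset.card_insert_of_notMem hj₀', ht'])
      (fun j => if j = j₀ then c d j - c e j else -(c' d j - c' e j)) (by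
        rw [Finset.sum_insert hj₀', if_pos rfl, hsub, ← hsub', ← Finset.sum_add_distrib]
        refine Finset.sum_eq_zero fun j hj => ?_
        rw [if_neg (ne_of_mem_of_not_mem hj hj₀'), neg_smul, add_neg_cancel])
      j₀ (Finset.mem_insert_self _ _)
    simp only [if_true] at h1
    rw [h1, zero_smul] at hsub
    exact (sub_eq_zero.1 hsub.symm)
  · intro j hj
    rw [heq j hj, sub_self, zero_smul]

open Classical in
/-- Many distances have a hop-efficient semi-path. -/
theorem le_card_hopEfficient {Q m : ℕ} (hn : h + 1 + Q < n) (hm : m ≤ Q.choose h) :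
    m * (n - 1) ^ h ≤
      (Finset.univ.filter fun d : Fin (h + 1) → ZMod n =>
        ∃ s, IsHopEfficient n h Q 0 d s).card + m * m * n ^ (h - 1) := by
  have hc : ((Finset.Ico (h + 1) (h + 1 + Q)).powersetCard h).card = Q.choose h := by
    rw [Finset.card_powersetCard, Nat.card_Ico, Nat.add_sub_cancel_left]
  obtain ⟨𝒯, h𝒯, h𝒯m⟩ := Finset.exists_subset_card_eq (hm.trans hc.ge)
  have hcard : ∀ t ∈ 𝒯, t.card = h := fun t ht => (Finset.mem_powersetCard.1 (h𝒯 ht)).2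
  have hlt : ∀ t ∈ 𝒯, ∀ j ∈ t, j < n := fun t ht j hj => by
    have := Finset.mem_Ico.1 ((Finset.mem_powersetCard.1 (h𝒯 ht)).1 hj)
    omega
  have h1 := mul_card_le_card_biUnion_add 𝒯 (fullSupportVectors n h) ((n - 1) ^ h) (n ^ (h - 1))
    (fun t ht => (card_fullSupportVectors (hcard t ht) (hlt t ht)).ge)
    (fun t ht t' ht' hne => card_fullSupportVectors_inter_le hne (hcard t ht) (hcard t' ht')
      (hlt t ht) (hlt t' ht'))
  rw [h𝒯m] at h1
  refine h1.trans (Nat.add_le_add_right (Finset.card_le_card ?_) _)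
  intro d hd
  obtain ⟨t, ht, hdt⟩ := Finset.mem_biUnion.1 hd
  exact Finset.mem_filter.2 ⟨Finset.mem_univ _, isHopEfficient_of_mem (h𝒯 ht) hdt⟩

open Classical in
/-- The number of distances with a hop of a given scale, summed over the phases. -/
theorem mul_sum_card_hop_le {Q : ℕ} {s : (Fin (h + 1) → ZMod n) → ℕ → ZMod n}
    (hs : ∀ d, IsHopEfficient n h Q 0 d (s d) ∨
        ((¬ ∃ s', IsHopEfficient n h Q 0 d s') ∧ IsSingleBasis n h 0 d (s d)))
    (hα : ∀ (α : ZMod n), α ≠ 0 → ∀ d, s (α • d) = α • s d) {σ : ZMod n} (hσ : σ ≠ 0) :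
    (n - 1) * ∑ j ∈ Finset.range (h + 1 + Q), (Finset.univ.filter fun d => s d j = σ).card +
      (Finset.univ.filter fun d : Fin (h + 1) → ZMod n =>
        ∃ s, IsHopEfficient n h Q 0 d s).card ≤ (h + 1) * n ^ (h + 1) := by
  -- By homogeneity, scaling the distance by `σ / σ'` turns hops of scale `σ'` into hops of scale
  -- `σ`: all scale factors are equally frequent.
  have h1 : ∀ j, ∀ σ' : ZMod n, σ' ≠ 0 → (Finset.univ.filter fun d => s d j = σ').card =
      (Finset.univ.filter fun d => s d j = σ).card := by
    intro j σ' hσ'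
    refine Finset.card_bij' (fun d _ => (σ * σ'⁻¹) • d) (fun d _ => (σ' * σ⁻¹) • d) ?_ ?_ ?_ ?_
    · intro d hd
      have hd := (Finset.mem_filter.1 hd).2
      refine Finset.mem_filter.2 ⟨Finset.mem_univ _, ?_⟩
      rw [hα _ (mul_ne_zero hσ (inv_ne_zero hσ')), Pi.smul_apply, hd, smul_eq_mul]
      field_simp
    · intro d hd
      have hd := (Finset.mem_filter.1 hd).2
      refine Finset.mem_filter.2 ⟨Finset.mem_univ _, ?_⟩
      rw [hα _ (mul_ne_zero hσ' (inv_ne_zero hσ)), Pi.smul_apply, hd, smul_eq_mul]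
      field_simp
    · intro d _
      rw [smul_smul]
      convert one_smul (ZMod n) d using 2
      field_simp
    · intro d _
      rw [smul_smul]
      convert one_smul (ZMod n) d using 2
      field_simp
  have h2 : ∀ j, (n - 1) * (Finset.univ.filter fun d => s d j = σ).card =
      (Finset.univ.filter fun d => s d j ≠ 0).card := by
    intro j
    have hmaps : Set.MapsTo (fun d => s d j)
        (Finset.univ.filter fun d => s d j ≠ 0 : Finset (Fin (h + 1) → ZMod n))
        ((Finset.univ : Finset (ZMod n)).erase 0 : Finset (ZMod n)) := by
      intro d hd
      exact Finset.mem_erase.2 ⟨(Finset.mem_filter.1 hd).2, Finset.mem_univ _⟩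
    refine Eq.trans ?_ (Finset.card_eq_sum_card_fiberwise hmaps).symm
    rw [Finset.sum_congr rfl (g := fun _ => (Finset.univ.filter fun d => s d j = σ).card)]
    · simp [ZMod.card]
    · intro σ' hσ'
      have h0 := Finset.ne_of_mem_erase hσ'
      rw [← h1 j σ' h0]
      congr 1
      ext d
      simp only [Finset.mem_filter, Finset.mem_univ, true_and, and_iff_right_iff_imp]
      rintro rfl; exact h0
  -- A hop-efficient semi-path saves one of the `h + 1` hops.
  have h3 : ∀ d, ((Finset.range (h + 1 + Q)).filter fun j => s d j ≠ 0).card +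
      (if ∃ s, IsHopEfficient n h Q 0 d s then 1 else 0) ≤ h + 1 := by
    intro d
    rcases hs d with hd | ⟨hd, hd'⟩
    · rw [if_pos ⟨_, hd⟩, hd.2.1]
    · rw [if_neg hd, add_zero]
      refine (Finset.card_le_card (t := Finset.range (h + 1)) ?_).trans (by simp)
      intro j hj
      exact Finset.mem_range.2 (hd'.1 j (Finset.mem_filter.1 hj).2)
  calc _ = ∑ j ∈ Finset.range (h + 1 + Q), (Finset.univ.filter fun d => s d j ≠ 0).card +
        ∑ d, (if ∃ s, IsHopEfficient n h Q 0 d s then 1 else 0) := by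
        rw [Finset.mul_sum, Finset.sum_congr rfl fun j _ => h2 j, Finset.card_filter]
    _ = ∑ d, (((Finset.range (h + 1 + Q)).filter fun j => s d j ≠ 0).card +
        (if ∃ s, IsHopEfficient n h Q 0 d s then 1 else 0)) := by
        rw [Finset.sum_add_distrib]
        simp only [Finset.card_filter]
        rw [Finset.sum_comm]
    _ ≤ ∑ d : Fin (h + 1) → ZMod n, (h + 1) := Finset.sum_le_sum fun d _ => h3 d
    _ = _ := by simp [ZMod.card, mul_comm]

end Counting

end ORN

namespace ORN

variable {N : ℕ}

/-! ### The Vandermonde Bases Scheme -/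

section VBS

variable {n h : ℕ}

/-- The linear map that takes the Vandermonde vector of each `p` to that of `p + q`. -/
def vandermondeShift (n h : ℕ) (q : ℤ) : (Fin (h + 1) → ZMod n) →ₗ[ZMod n] (Fin (h + 1) → ZMod n) :=
  Matrix.mulVecLin (Matrix.of fun i k : Fin (h + 1) =>
    (q : ZMod n) ^ ((i : ℕ) - k) * ((i : ℕ).choose k : ℕ))

/-- This is the binomial theorem for `(p + q) ^ i`, coordinate by coordinate. For `k > i` the
truncated exponent `i - k` is harmless because the binomial coefficient vanishes. -/
theorem vandermondeShift_vandermondeVec (p q : ℤ) :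
    vandermondeShift n h q (vandermondeVec n h p) = vandermondeVec n h (p + q) := by
  funext i
  simp only [vandermondeShift, Matrix.mulVecLin_apply, Matrix.mulVec, dotProduct, Matrix.of_apply,
    vandermondeVec]
  rw [Int.cast_add, add_pow]
  rw [Fin.sum_univ_eq_sum_range (fun k => (q : ZMod n) ^ ((i : ℕ) - k) * ((i : ℕ).choose k : ℕ) *
    (p : ZMod n) ^ k)]
  symm
  refine Finset.sum_subset_zero_on_sdiff (Finset.range_subset_range.2 (by omega)) ?_ ?_
  · intro k hk
    simp only [Finset.mem_sdiff, Finset.mem_range] at hk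
    rw [Nat.choose_eq_zero_of_lt (by omega)]
    simp
  · intro k _
    ring

theorem vandermondeShift_add_card (q : ℤ) :
    vandermondeShift n h (q + n) = vandermondeShift n h q := by
  simp [vandermondeShift]

theorem IsHopEfficient.shift {Q : ℕ} {q : ℤ} {d : Fin (h + 1) → ZMod n} {s : ℕ → ZMod n}
    (H : IsHopEfficient n h Q q d s) (q' : ℤ) :
    IsHopEfficient n h Q (q + q') (vandermondeShift n h q' d) s := by
  refine ⟨H.1, H.2.1, ?_⟩
  rw [← H.2.2]
  simp only [map_sum, map_smul, vandermondeShift_vandermondeVec, add_right_comm]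

theorem IsSingleBasis.shift {q : ℤ} {d : Fin (h + 1) → ZMod n} {s : ℕ → ZMod n}
    (H : IsSingleBasis n h q d s) (q' : ℤ) :
    IsSingleBasis n h (q + q') (vandermondeShift n h q' d) s := by
  refine ⟨H.1, ?_⟩
  rw [← H.2]
  simp only [map_sum, map_smul, vandermondeShift_vandermondeVec, add_right_comm]

/-- The time to wait for the beginning of a phase. -/
def vbsWait (n : ℕ) (t : ℤ) : ℕ := ((-t) % (n - 1 : ℕ)).toNat

theorem vbsWait_add_mul (t : ℤ) (m : ℤ) : vbsWait n (t + m * (n - 1 : ℕ)) = vbsWait n t := by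
  unfold vbsWait
  rw [neg_add, ← neg_mul, Int.add_mul_emod_self_right]

theorem eq_vbsWait {t q : ℤ} {w : ℕ} (hw : w < n - 1) (hq : t + w = q * (n - 1 : ℕ)) :
    w = vbsWait n t := by
  have h1 : -t = w + (-q) * (n - 1 : ℕ) := by linarith
  unfold vbsWait
  rw [h1, Int.add_mul_emod_self_right, Int.emod_eq_of_lt (by omega) (by exact_mod_cast hw)]
  simp

/-- `s` chooses hop vectors for the semi-paths that start with phase `0`. -/
def IsHopChoice (n h Q : ℕ) (s : (Fin (h + 1) → ZMod n) → ℕ → ZMod n) : Prop :=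
  ∀ d, IsHopEfficient n h Q 0 d (s d) ∨
    ((¬ ∃ s', IsHopEfficient n h Q 0 d s') ∧ IsSingleBasis n h 0 d (s d))

/-- The choice for all starting phases obtained by translation from the choice for phase `0`. -/
def shiftedChoice (s : (Fin (h + 1) → ZMod n) → ℕ → ZMod n) (q : ℤ) (d : Fin (h + 1) → ZMod n) :
    ℕ → ZMod n :=
  s (vandermondeShift n h (-q) d)

variable {Q : ℕ} {s : (Fin (h + 1) → ZMod n) → ℕ → ZMod n}

variable [Fact n.Prime]

/-- The Vandermonde vectors of `h + 1` consecutive phases span the space, and on Vandermonde vectors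
the two shifts visibly cancel. -/
theorem vandermondeShift_neg_cancel (hn : h + 1 ≤ n) (q : ℤ) (d : Fin (h + 1) → ZMod n) :
    vandermondeShift n h q (vandermondeShift n h (-q) d) = d := by
  obtain ⟨s, -, hs⟩ := exists_isSingleBasis hn 0 d
  rw [← hs]
  simp [map_sum, map_smul, vandermondeShift_vandermondeVec]

theorem IsHopChoice.shiftedChoice_spec (hn : h + 1 ≤ n) (hs : IsHopChoice n h Q s) (q : ℤ)
    (d : Fin (h + 1) → ZMod n) :
    IsHopEfficient n h Q q d (shiftedChoice s q d) ∨
    ((¬ ∃ s', IsHopEfficient n h Q q d s') ∧ IsSingleBasis n h q d (shiftedChoice s q d)) := by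
  rcases hs (vandermondeShift n h (-q) d) with h1 | ⟨h1, h2⟩
  · left
    have := h1.shift q
    rwa [zero_add, vandermondeShift_neg_cancel hn] at this
  · right
    refine ⟨?_, ?_⟩
    · rintro ⟨s', hs'⟩
      have := hs'.shift (-q)
      rw [add_neg_cancel] at this
      exact h1 ⟨s', this⟩
    · have := h2.shift q
      rwa [zero_add, vandermondeShift_neg_cancel hn] at this

theorem IsHopChoice.sum_eq (hn : h + 1 ≤ n) (hs : IsHopChoice n h Q s) (q : ℤ)
    (d : Fin (h + 1) → ZMod n) :
    ∑ j ∈ Finset.range (h + 1 + Q), shiftedChoice s q d j • vandermondeVec n h (q + j) = d := by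
  rcases hs.shiftedChoice_spec hn q d with h1 | ⟨-, h1⟩
  · exact h1.2.2
  · refine Eq.trans (Eq.symm ?_) h1.2
    refine Finset.sum_subset (Finset.range_subset_range.2 (by omega)) fun j _ hj => ?_
    have h0 : shiftedChoice s q d j = 0 := by
      by_contra h0
      exact hj (Finset.mem_range.2 (h1.1 j h0))
    rw [h0, zero_smul]

/-- The translation of timeslot `τ` in the Vandermonde Bases Scheme. -/
def vbsStep (n h : ℕ) (τ : ℤ) : Fin (h + 1) → ZMod n :=
  (((τ % (n - 1 : ℕ)).toNat + 1 : ℕ) : ZMod n) • vandermondeVec n h (τ / (n - 1 : ℕ))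

theorem vbsStep_mul_add (q : ℤ) {j : ℕ} (hj : j < n - 1) :
    vbsStep n h (q * (n - 1 : ℕ) + j) = ((j + 1 : ℕ) : ZMod n) • vandermondeVec n h q := by
  have h0 : (0 : ℤ) ≤ j := by omega
  have h1 : (j : ℤ) < (n - 1 : ℕ) := by exact_mod_cast hj
  unfold vbsStep
  rw [mul_comm, Int.mul_add_emod_self_left, Int.emod_eq_of_lt h0 h1, Int.toNat_natCast,
    Int.mul_add_ediv_left _ _ (by omega), Int.ediv_eq_zero_of_lt h0 h1, add_zero]

theorem one_le_pred : 1 ≤ n - 1 := by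
  have := (Fact.out : n.Prime).two_le
  omega

theorem vbsStep_add_mul (τ m : ℤ) :
    vbsStep n h (τ + (n * (n - 1) : ℕ) * m) = vbsStep n h τ := by
  have h0 : ((n - 1 : ℕ) : ℤ) ≠ 0 := by
    have := one_le_pred (n := n)
    omega
  have h1 : τ + ((n * (n - 1) : ℕ) : ℤ) * m = τ + (n - 1 : ℕ) * (n * m) := by
    rw [Nat.cast_mul]; ring
  unfold vbsStep vandermondeVec
  rw [h1, Int.add_mul_emod_self_left, Int.add_mul_ediv_left _ _ h0]
  simp

theorem vbsStep_ne_zero (τ : ℤ) : vbsStep n h τ ≠ 0 := by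
  intro h0
  have h1 := congrFun h0 0
  have h2 := one_le_pred (n := n)
  have h3 := Int.emod_lt_of_pos τ (b := (n - 1 : ℕ)) (by omega)
  simp only [vbsStep, vandermondeVec, Pi.smul_apply, Fin.val_zero, pow_zero, smul_eq_mul, mul_one,
    Pi.zero_apply] at h1
  exact natCast_ne_zero_of_lt (by omega) (by omega) h1

theorem vbs_period_pos : 0 < n * (n - 1) :=
  Nat.mul_pos (Fact.out : n.Prime).pos one_le_pred

/-- The schedule of the Vandermonde Bases Scheme. -/
def vbsSchedule (φ : Fin N ≃ (Fin (h + 1) → ZMod n)) : ConnectionSchedule N :=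
  translationSchedule φ (n * (n - 1)) vbs_period_pos fun k => vbsStep n h k

theorem vbsSchedule_at_ (φ : Fin N ≃ (Fin (h + 1) → ZMod n)) (τ : ℤ) (i : Fin N) :
    φ ((vbsSchedule φ).at_ τ i) = φ i + vbsStep n h τ := by
  have hT : (0 : ℤ) < (n * (n - 1) : ℕ) := by exact_mod_cast vbs_period_pos
  rw [vbsSchedule, translationSchedule_at_, Int.toNat_of_nonneg (Int.emod_nonneg τ hT.ne')]
  congr 1
  conv_rhs => rw [← Int.emod_add_mul_ediv τ (n * (n - 1) : ℕ)]
  rw [vbsStep_add_mul]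

/-- The displacement after `k` steps of the semi-path with hop vector `s` from timeslot `t` on. -/
def vbsDisp (n h : ℕ) (s : ℕ → ZMod n) (t : ℤ) : ℕ → Fin (h + 1) → ZMod n
  | 0 => 0
  | k + 1 =>
    if s (k / (n - 1)) = ((k % (n - 1) + 1 : ℕ) : ZMod n) then
      vbsDisp n h s t k + vbsStep n h (t + k) else vbsDisp n h s t k

theorem φ_semiNode (φ : Fin N ≃ (Fin (h + 1) → ZMod n)) (a : Fin N) (q : ℤ) (s : ℕ → ZMod n)
    (k : ℕ) : φ (semiNode (vbsSchedule φ) a q s k) =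
      φ a + vbsDisp n h s (q * (n - 1 : ℕ)) k := by
  induction k with
  | zero => simp [semiNode, vbsDisp]
  | succ k ih =>
    rw [semiNode, vbsDisp]
    split_ifs with h
    · rw [vbsSchedule_at_, ih, add_assoc]
    · rw [ih]

/-- The hop of phase `J` takes place in the step with scale factor `s J`, that is, it is complete
after `(s J).val` steps of the phase. For `s J = 0` the condition holds from the outset, but the
term added is zero. -/
theorem vbsDisp_mul_add (s : ℕ → ZMod n) (q : ℤ) (J m : ℕ) (hm : m ≤ n - 1) :
    vbsDisp n h s (q * (n - 1 : ℕ)) (J * (n - 1) + m) =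
      vbsDisp n h s (q * (n - 1 : ℕ)) (J * (n - 1)) +
        if (s J).val ≤ m then s J • vandermondeVec n h (q + J) else 0 := by
  have : NeZero n := ⟨(Fact.out : n.Prime).ne_zero⟩
  induction m with
  | zero =>
    by_cases h0 : s J = 0
    · simp [h0]
    · simp [h0]
  | succ m ih =>
    have hdiv : (J * (n - 1) + m) / (n - 1) = J := by
      rw [mul_comm, Nat.mul_add_div (by omega), Nat.div_eq_of_lt (by omega), add_zero]
    have hmod : (J * (n - 1) + m) % (n - 1) = m := by
      rw [mul_comm, Nat.mul_add_mod, Nat.mod_eq_of_lt (by omega)]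
    have hval : s J = ((m + 1 : ℕ) : ZMod n) ↔ (s J).val = m + 1 := by
      constructor
      · intro h1
        rw [h1, ZMod.val_natCast, Nat.mod_eq_of_lt (by omega)]
      · intro h1
        rw [← h1, ZMod.natCast_zmod_val]
    rw [← add_assoc, vbsDisp, hdiv, hmod, ih (by omega)]
    by_cases h1 : s J = ((m + 1 : ℕ) : ZMod n)
    · have h2 := hval.1 h1
      rw [if_pos h1, if_neg (by omega), if_pos (by omega), add_zero]
      congr 1
      have : q * ((n - 1 : ℕ) : ℤ) + ((J * (n - 1) + m : ℕ) : ℤ)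
          = (q + J) * ((n - 1 : ℕ) : ℤ) + m := by push_cast; ring
      rw [this, vbsStep_mul_add _ (by omega), h1]
    · have h2 := mt hval.2 h1
      rw [if_neg h1]
      have h3 : (s J).val ≤ m + 1 ↔ (s J).val ≤ m := by omega
      simp only [h3]

theorem vbsDisp_mul (s : ℕ → ZMod n) (q : ℤ) (J : ℕ) :
    vbsDisp n h s (q * (n - 1 : ℕ)) (J * (n - 1)) =
      ∑ j ∈ Finset.range J, s j • vandermondeVec n h (q + j) := by
  have : NeZero n := ⟨(Fact.out : n.Prime).ne_zero⟩
  induction J with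
  | zero => simp [vbsDisp]
  | succ J ih =>
    have := ZMod.val_lt (s J)
    rw [add_mul, one_mul, vbsDisp_mul_add _ _ _ _ le_rfl, ih, if_pos (by omega),
      Finset.sum_range_succ]

theorem pred_cast_pos : (0 : ℤ) < (n - 1 : ℕ) := by exact_mod_cast one_le_pred (n := n)

theorem add_vbsWait (t : ℤ) : t + vbsWait n t = -((-t) / (n - 1 : ℕ)) * (n - 1 : ℕ) := by
  have h1 := Int.emod_nonneg (-t) (pred_cast_pos (n := n)).ne'
  have h2 := Int.emod_add_mul_ediv (-t) (n - 1 : ℕ)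
  rw [vbsWait, Int.toNat_of_nonneg h1]
  linarith

theorem vbsWait_lt (t : ℤ) : vbsWait n t < n - 1 := by
  have h1 := Int.emod_nonneg (-t) (pred_cast_pos (n := n)).ne'
  have h2 := Int.emod_lt_of_pos (-t) (pred_cast_pos (n := n))
  unfold vbsWait
  omega

/-- The semi-paths of the Vandermonde Bases Scheme. -/
def vbsScheme (hn : h + 1 ≤ n) (hs : IsHopChoice n h Q s)
    (φ : Fin N ≃ (Fin (h + 1) → ZMod n)) :
    SemiPathScheme (vbsSchedule φ) (Fin (h + 1) → ZMod n) where
  φ := φ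
  u := vbsStep n h
  u_ne_zero := vbsStep_ne_zero
  at_apply := vbsSchedule_at_ φ
  M := (h + 1 + Q) * (n - 1)
  wait := vbsWait n
  wait_add_period t := by
    change vbsWait n (t + (n * (n - 1) : ℕ)) = _
    rw [Nat.cast_mul, vbsWait_add_mul]
  wait_add_M t := by rw [Nat.cast_mul, vbsWait_add_mul]
  Start t := ∃ q : ℤ, t = q * (n - 1 : ℕ)
  start_wait t := ⟨_, add_vbsWait t⟩
  start_add_M := by
    rintro _ ⟨q, rfl⟩
    exact ⟨q + (h + 1 + Q : ℕ), by rw [Nat.cast_mul, add_mul]⟩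
  disp t d := vbsDisp n h (shiftedChoice s (t / (n - 1 : ℕ)) d) t
  disp_zero _ _ := rfl
  disp_M := by
    rintro _ d ⟨q, rfl⟩
    rw [Int.mul_ediv_cancel _ pred_cast_pos.ne', vbsDisp_mul, hs.sum_eq hn]
  disp_succ t d k _ _ := by
    rw [vbsDisp]
    split_ifs
    · exact Or.inr rfl
    · exact Or.inl rfl
  disp_add_period t d := by
    change vbsDisp n h (shiftedChoice s ((t + (n * (n - 1) : ℕ)) / (n - 1 : ℕ)) d)
      (t + (n * (n - 1) : ℕ)) = _
    -- A period consists of `n` phases, and the Vandermonde shift depends on the phase only modulo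
    -- `n`.
    have h1 : shiftedChoice s ((t + (n * (n - 1) : ℕ)) / (n - 1 : ℕ)) d =
        shiftedChoice s (t / (n - 1 : ℕ)) d := by
      rw [Nat.cast_mul, Int.add_mul_ediv_right _ _ pred_cast_pos.ne']
      unfold shiftedChoice
      rw [← vandermondeShift_add_card (-(t / ((n - 1 : ℕ) : ℤ) + n))]
      congr 2
      ring_nf
    rw [h1]
    funext k
    induction k with
    | zero => rfl
    | succ k ih =>
      have h2 := vbsStep_add_mul (n := n) (h := h) (t + k) 1
      rw [mul_one] at h2
      rw [vbsDisp, vbsDisp, ih, add_right_comm, h2]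
  len _ _ := (h + 1 + Q) * (n - 1)
  len_le _ _ _ := le_rfl
  disp_len := by
    rintro _ d ⟨q, rfl⟩
    rw [Int.mul_ediv_cancel _ pred_cast_pos.ne', vbsDisp_mul, hs.sum_eq hn]
  len_add_period _ _ := rfl

theorem vbsScheme_semi (hn : h + 1 ≤ n) (hs : IsHopChoice n h Q s)
    (φ : Fin N ≃ (Fin (h + 1) → ZMod n)) (a c : Fin N) (q : ℤ) (k : ℕ) :
    semiNode (vbsSchedule φ) a q (shiftedChoice s q (φ c - φ a)) k =
      (vbsScheme hn hs φ).semi a c (q * (n - 1 : ℕ)) k := by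
  apply φ.injective
  rw [φ_semiNode]
  refine Eq.trans ?_ ((vbsScheme hn hs φ).φ_semi a c _ k).symm
  simp only [vbsScheme]
  rw [Int.mul_ediv_cancel _ pred_cast_pos.ne']

theorem isVBSPath_iff (hn : h + 1 ≤ n) (hs : IsHopChoice n h Q s)
    (φ : Fin N ≃ (Fin (h + 1) → ZMod n)) (a b : Fin N) (t : ℤ) (c : Fin N)
    (P : Path (vbsSchedule φ)) :
    IsVBSPath h Q (fun q a b => shiftedChoice s q (φ b - φ a)) a b t c P ↔
      P = (vbsScheme hn hs φ).path a b t c := by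
  set Z := vbsScheme hn hs φ with hZ
  have hM : Z.M = (h + 1 + Q) * (n - 1) := rfl
  have hnodes : ∀ (q : ℤ) (w : ℕ), w < n - 1 → t + w = q * ((n - 1 : ℕ) : ℤ) →
      Z.nodes a b t c = fun k =>
        if k < w then a
        else if k < w + (h + 1 + Q) * (n - 1) then
          semiNode (vbsSchedule φ) a q (shiftedChoice s q (φ c - φ a)) (k - w)
        else semiNode (vbsSchedule φ) c (q + (h + 1 + Q : ℕ))
          (shiftedChoice s (q + (h + 1 + Q : ℕ)) (φ b - φ c))
          (k - (w + (h + 1 + Q) * (n - 1))) := by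
    intro q w hw hq
    have hww : Z.wait t = w := (eq_vbsWait hw hq).symm
    have hsemi : ∀ a c q k, semiNode (vbsSchedule φ) a q (shiftedChoice s q (φ c - φ a)) k =
        Z.semi a c (q * (n - 1 : ℕ)) k := vbsScheme_semi hn hs φ
    funext k
    unfold SemiPathScheme.nodes
    rw [hww, hM, hsemi, hsemi, hq, Nat.cast_mul, add_mul q]
  have hlen : ∀ w, w = Z.wait t →
      Z.length b t c = w + (h + 1 + Q) * (n - 1) + (h + 1 + Q) * (n - 1) := by
    rintro _ rfl
    rfl
  rw [← Z.visits_iff]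
  constructor
  · rintro ⟨q, w, hw, hq, -, hv⟩
    rw [hlen w (eq_vbsWait hw hq), hnodes q w hw hq]
    exact hv
  · intro hv
    have hw := vbsWait_lt (n := n) t
    have hq := add_vbsWait (n := n) t
    refine ⟨_, _, hw, hq, ?_, ?_⟩
    · rw [vbsScheme_semi hn hs]
      exact Z.semi_M a c ⟨_, rfl⟩
    · rw [hlen _ rfl, hnodes _ _ hw hq] at hv
      exact hv

-- Here `z` is the number of phases between the start and timeslot `τ`. A hop in `τ` fixes entry `z`
-- of the hop vector to be the scale factor of `τ`, and the shift by the starting phase reduces the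
-- count to semi-paths that start with phase `0`.
open Classical in
theorem vbsScheme_hopCount_le (hn : h + 1 ≤ n) (hs : IsHopChoice n h Q s)
    (φ : Fin N ≃ (Fin (h + 1) → ZMod n)) (τ z : ℤ) :
    (vbsScheme hn hs φ).hopCount ((τ / (n - 1 : ℕ) - z) * (n - 1 : ℕ)) τ ≤
      if z ∈ (Finset.range (h + 1 + Q)).map Nat.castEmbedding then
        (Finset.univ.filter fun d => s d z.toNat =
          (((τ % (n - 1 : ℕ)).toNat + 1 : ℕ) : ZMod n)).card else 0 := by
  have hpos := pred_cast_pos (n := n)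
  have h0 := Int.emod_nonneg τ hpos.ne'
  have h1 := Int.emod_lt_of_pos τ hpos
  have h2 := Int.emod_add_mul_ediv τ (n - 1 : ℕ)
  set q := τ / ((n - 1 : ℕ) : ℤ) - z with hq
  have key : ∀ d, ∀ k < (vbsScheme hn hs φ).M, τ = q * (n - 1 : ℕ) + k →
      (vbsScheme hn hs φ).disp (q * (n - 1 : ℕ)) d (k + 1) ≠
        (vbsScheme hn hs φ).disp (q * (n - 1 : ℕ)) d k →
      (k / (n - 1) < h + 1 + Q ∧ z = (k / (n - 1) : ℕ)) ∧
      s (vandermondeShift n h (-q) d) z.toNat =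
        (((τ % (n - 1 : ℕ)).toNat + 1 : ℕ) : ZMod n) := by
    intro d k hk hτ hne
    have hk' : k < (h + 1 + Q) * (n - 1) := hk
    have hkz : (k : ℤ) = τ % (n - 1 : ℕ) + z * (n - 1 : ℕ) := by
      have : (n - 1 : ℕ) * (τ / (n - 1 : ℕ)) = (q + z) * ((n - 1 : ℕ) : ℤ) := by
        rw [hq]; ring
      linarith
    have hz : z = (k / (n - 1) : ℕ) := by
      rw [Int.natCast_ediv, hkz, Int.add_mul_ediv_right _ _ hpos.ne',
        Int.ediv_eq_zero_of_lt h0 h1, zero_add]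
    have hmod : k % (n - 1) = (τ % (n - 1 : ℕ)).toNat := by
      have : ((k % (n - 1) : ℕ) : ℤ) = τ % (n - 1 : ℕ) := by
        rw [Int.natCast_emod, hkz, Int.add_mul_emod_self_right, Int.emod_emod]
      omega
    refine ⟨⟨Nat.div_lt_of_lt_mul (by rwa [mul_comm] at hk'), hz⟩, ?_⟩
    simp only [vbsScheme] at hne
    rw [Int.mul_ediv_cancel _ hpos.ne', vbsDisp] at hne
    split_ifs at hne with h3
    · rw [hz, Int.toNat_natCast, ← hmod, ← h3]
      rfl
    · exact absurd rfl hne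
  split_ifs with hz
  · have hinj : Function.Injective (vandermondeShift n h q) :=
      Function.LeftInverse.injective (g := vandermondeShift n h (-q)) fun d => by
        have := vandermondeShift_neg_cancel hn (-q) d
        rwa [neg_neg] at this
    rw [← Finset.card_image_of_injective _ hinj]
    refine SemiPathScheme.hopCount_le _ _ _ _ fun d k hk hτ hne => ?_
    refine Finset.mem_image.2 ⟨vandermondeShift n h (-q) d, ?_, vandermondeShift_neg_cancel hn q d⟩
    exact Finset.mem_filter.2 ⟨Finset.mem_univ _, (key d k hk hτ hne).2⟩
  · rw [← Finset.card_empty (α := Fin (h + 1) → ZMod n)]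
    refine SemiPathScheme.hopCount_le _ _ _ _ fun d k hk hτ hne => absurd ?_ hz
    obtain ⟨⟨h3, h4⟩, -⟩ := key d k hk hτ hne
    exact Finset.mem_map.2 ⟨_, Finset.mem_range.2 h3, h4.symm⟩

open Classical in
theorem vbsScheme_tsum_hopCount_le (hn : h + 1 ≤ n) (hs : IsHopChoice n h Q s)
    (φ : Fin N ≃ (Fin (h + 1) → ZMod n)) (τ : ℤ) :
    ∑' t : ℤ, ((vbsScheme hn hs φ).hopCount (t + (vbsScheme hn hs φ).wait t) τ : ℝ≥0∞) ≤
      (((n - 1) * ∑ j ∈ Finset.range (h + 1 + Q), (Finset.univ.filter fun d => s d j =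
          (((τ % (n - 1 : ℕ)).toNat + 1 : ℕ) : ZMod n)).card : ℕ) : ℝ≥0∞) := by
  have : NeZero (n - 1) := ⟨by have := one_le_pred (n := n); omega⟩
  set f : ℤ → ℝ≥0∞ := fun q => ((vbsScheme hn hs φ).hopCount (q * (n - 1 : ℕ)) τ : ℝ≥0∞) with hf
  set c : ℕ → ℕ := fun j => (Finset.univ.filter fun d => s d j =
    (((τ % (n - 1 : ℕ)).toNat + 1 : ℕ) : ZMod n)).card with hc
  have h1 : ∑' t : ℤ, ((vbsScheme hn hs φ).hopCount (t + (vbsScheme hn hs φ).wait t) τ : ℝ≥0∞) =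
      ∑' t : ℤ, f (-((-t) / (n - 1 : ℕ))) := by
    refine tsum_congr fun t => ?_
    simp only [hf]
    rw [← add_vbsWait]
    rfl
  have h2 : ∑' t : ℤ, f (-((-t) / (n - 1 : ℕ))) = (n - 1 : ℕ) * ∑' q : ℤ, f q := by
    calc _ = ∑' t : ℤ, f (-(t / (n - 1 : ℕ))) :=
          (Equiv.neg ℤ).tsum_eq (fun t : ℤ => f (-(t / (n - 1 : ℕ))))
      _ = ∑' p : ℤ × Fin (n - 1), f (-p.1) :=
          (Int.divModEquiv (n - 1)).tsum_eq (fun p : ℤ × Fin (n - 1) => f (-p.1))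
      _ = ∑' q : ℤ, (n - 1 : ℕ) * f (-q) := by
          rw [ENNReal.tsum_prod']
          refine tsum_congr fun q => ?_
          simp only [tsum_fintype, Finset.sum_const, Finset.card_univ, Fintype.card_fin,
            nsmul_eq_mul]
      _ = _ := by
          rw [ENNReal.tsum_mul_left]
          congr 1
          exact (Equiv.neg ℤ).tsum_eq f
  have h3 : ∑' q : ℤ, f q ≤ ((∑ j ∈ Finset.range (h + 1 + Q), c j : ℕ) : ℝ≥0∞) := by
    calc _ = ∑' z : ℤ, f (τ / (n - 1 : ℕ) - z) :=
          ((Equiv.subLeft (τ / ((n - 1 : ℕ) : ℤ))).tsum_eq f).symm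
      _ ≤ ∑' z : ℤ, (if z ∈ (Finset.range (h + 1 + Q)).map Nat.castEmbedding then
            (c z.toNat : ℝ≥0∞) else 0) := by
          refine ENNReal.tsum_le_tsum fun z => ?_
          refine (Nat.cast_le.2 (vbsScheme_hopCount_le hn hs φ τ z)).trans (le_of_eq ?_)
          split_ifs <;> simp [hc]
      _ = _ := by
          rw [tsum_eq_sum (s := (Finset.range (h + 1 + Q)).map Nat.castEmbedding)]
          · rw [Finset.sum_congr rfl (fun z hz => if_pos hz), Finset.sum_map]
            simp
          · intro z hz
            rw [if_neg hz]
  rw [h1, h2, Nat.cast_mul]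
  gcongr

/-- The throughput and the maximum latency of the Vandermonde Bases Scheme of order `h`. -/
theorem exists_isVBS (hh : 1 ≤ h) {δ : ℝ} (hδ : 0 < δ)
    (hQ : IsLeast {Q : ℕ | δ * n ≤ (Q.choose h : ℝ)} Q) (hn : h + 1 + Q < n) {m : ℕ}
    (hm : m ≤ Q.choose h) (r : ℝ≥0)
    (hr : 2 * (r : ℝ) * ((h + 1) * (n : ℝ) ^ (h + 1) + m * m * (n : ℝ) ^ (h - 1) -
      m * ((n : ℝ) - 1) ^ h) ≤ (n : ℝ) ^ (h + 1)) :
    ∃ X : Design (n ^ (h + 1)), X.IsVBS h n δ ∧ X.GuaranteesThroughput r ∧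
      X.maxLatency ≤ ((n - 1 + 2 * ((h + 1 + Q) * (n - 1)) : ℕ) : ℕ∞) := by
  classical
  have hprime : n.Prime := Fact.out
  have hN : 0 < n ^ (h + 1) := Nat.pow_pos hprime.pos
  have hn1 : h + 1 ≤ n := by omega
  have hcard : Fintype.card (Fin (n ^ (h + 1))) = Fintype.card (Fin (h + 1) → ZMod n) := by
    simp [ZMod.card]
  let φ : Fin (n ^ (h + 1)) ≃ (Fin (h + 1) → ZMod n) := Fintype.equivOfCardEq hcard
  obtain ⟨s, hs, hα⟩ := exists_homogeneous_choice (n := n) (h := h) (Q := Q) hn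
  have hs' : IsHopChoice n h Q s := hs
  let Z := vbsScheme hn1 hs' φ
  refine ⟨Z.design hN, ⟨hh, hprime, hδ, φ, Q, fun q a b => shiftedChoice s q (φ b - φ a), hQ, hn,
    ?_, rfl, ?_, ?_⟩, ?_, ?_⟩
  · intro q a b
    exact hs'.shiftedChoice_spec hn1 q (φ b - φ a)
  · intro p σ hp hσ hσn i
    refine (vbsSchedule_at_ φ _ i).trans ?_
    have h1 : (((n - 1) * p + σ - 1 : ℕ) : ℤ) = (p : ℤ) * (n - 1 : ℕ) + (σ - 1 : ℕ) := by
      rw [Nat.add_sub_assoc hσ]; push_cast; ring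
    rw [h1, vbsStep_mul_add _ (by omega), Nat.sub_add_cancel hσ]
  · intro a b t P
    change (Finset.card _ : ℝ≥0) / _ = _
    congr 3
    ext c
    rw [Finset.mem_filter]
    erw [Finset.mem_filter]
    exact and_congr_right fun _ => (isVBSPath_iff hn1 hs' φ a b t c P).symm
  · refine Z.design_guaranteesThroughput hN r fun τ => ?_
    have h1 := vbsScheme_tsum_hopCount_le hn1 hs' φ τ
    have hlt := Int.emod_lt_of_pos τ (pred_cast_pos (n := n))
    have hσ : (((τ % (n - 1 : ℕ)).toNat + 1 : ℕ) : ZMod n) ≠ 0 :=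
      natCast_ne_zero_of_lt (by omega) (by omega)
    -- `h2` bounds the hop count by `(h + 1) n ^ (h + 1)` minus the number of distances with a
    -- hop-efficient semi-path, and `h3` bounds that number from below; together they give the
    -- bracket in `hr`.
    have h2 := mul_sum_card_hop_le hs hα hσ
    have h3 := le_card_hopEfficient (n := n) (h := h) hn hm
    set A := (n - 1) * ∑ j ∈ Finset.range (h + 1 + Q), (Finset.univ.filter fun d => s d j =
          (((τ % (n - 1 : ℕ)).toNat + 1 : ℕ) : ZMod n)).card
    set E := (Finset.univ.filter fun d : Fin (h + 1) → ZMod n =>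
        ∃ s, IsHopEfficient n h Q 0 d s).card
    have h2' : (A : ℝ) + E ≤ (h + 1) * (n : ℝ) ^ (h + 1) := by exact_mod_cast h2
    have h3' : (m : ℝ) * ((n : ℝ) - 1) ^ h ≤ E + m * m * (n : ℝ) ^ (h - 1) := by
      have : ((n - 1 : ℕ) : ℝ) = (n : ℝ) - 1 := by
        rw [Nat.cast_sub hprime.one_lt.le, Nat.cast_one]
      rw [← this]
      exact_mod_cast h3
    have h4 : 2 * (r : ℝ) * A ≤ (n : ℝ) ^ (h + 1) := by
      refine le_trans ?_ hr
      have : (0 : ℝ) ≤ 2 * r := by positivity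
      refine mul_le_mul_of_nonneg_left ?_ this
      linarith
    have h5 : 2 * r * (A : ℝ≥0) ≤ ((n ^ (h + 1) : ℕ) : ℝ≥0) := by
      rw [← NNReal.coe_le_coe]
      push_cast
      exact h4
    calc _ ≤ 2 * (r : ℝ≥0∞) * (A : ℝ≥0∞) := by gcongr
      _ = ((2 * r * (A : ℝ≥0) : ℝ≥0) : ℝ≥0∞) := by push_cast; rfl
      _ ≤ ((((n ^ (h + 1) : ℕ) : ℝ≥0) : ℝ≥0) : ℝ≥0∞) := ENNReal.coe_le_coe.2 h5
      _ = _ := by simp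
  · exact Z.design_maxLatency_le hN (n - 1) fun t => (vbsWait_lt t).le

end VBS

end ORN

/-! ### Choice of parameters and the upper bound -/

namespace ORN

variable {N : ℕ}

theorem maxLatency_le_ofReal {X : Design N} {L : ℕ} (h : X.maxLatency ≤ (L : ℕ∞)) {x : ℝ}
    (hx : (L : ℝ) ≤ x) : (X.maxLatency : ENNReal) ≤ ENNReal.ofReal x := by
  calc (X.maxLatency : ENNReal) ≤ (((L : ℕ∞)) : ENNReal) := ENat.toENNReal_le.2 h
    _ = ENNReal.ofReal (L : ℝ) := by rw [ENNReal.ofReal_natCast]; rfl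
    _ ≤ _ := ENNReal.ofReal_le_ofReal hx

theorem IsHopParam.two_mul_mul_eq_one {r : ℝ} (hr : 0 < r) {h : ℕ} {ε : ℝ}
    (H : IsHopParam r h ε) : 2 * r * (h + 1 - ε) = 1 := by
  rw [← H.2.2]; field_simp

theorem self_le_rpow_one_div {ε : ℝ} (h0 : 0 < ε) (h1 : ε ≤ 1) {h : ℕ} (hh : 1 ≤ h) :
    ε ≤ ε ^ (1 / (h : ℝ)) := by
  have : (1 : ℝ) ≤ h := by exact_mod_cast hh
  have h2 : 1 / (h : ℝ) ≤ 1 := by rw [div_le_one (by positivity)]; exact this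
  simpa using Real.rpow_le_rpow_of_exponent_ge h0 h1 h2

theorem mul_pow_rpow_one_div {x y : ℝ} (hx : 0 ≤ x) (hy : 0 ≤ y) {h : ℕ} (hh : 1 ≤ h) :
    (x * y ^ h) ^ (1 / (h : ℝ)) = x ^ (1 / (h : ℝ)) * y := by
  rw [Real.mul_rpow hx (by positivity), one_div, Real.pow_rpow_inv_natCast hy (by omega)]

/-- From `ε ≤ 1` follows `2 r h ≤ 2 r (h + 1 - ε) = 1`. The latency is less than `2 h n`, and `L* ≥
h ε^(1/h) n ≥ h n / 8`, so a constant `16` would do; `18` is shared with the other case. -/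
theorem exists_isEBS_maxLatency_le {r : ℝ} (hr : 0 < r) {h : ℕ} {ε : ℝ} (hh : 1 ≤ h)
    (H : IsHopParam r h ε) (hε : 1 / 8 < ε) {n : ℕ} (hn : 2 ≤ n) :
    ∃ X : Design (n ^ h), X.IsEBS h n ∧ X.GuaranteesThroughput r ∧
      (X.maxLatency : ENNReal) ≤ ENNReal.ofReal (18 * Lstar h ε (n ^ h)) := by
  have h1 := H.two_mul_mul_eq_one hr
  lift r to ℝ≥0 using hr.le
  have hrh : 2 * r * (h : ℝ≥0) ≤ 1 := by
    rw [← NNReal.coe_le_coe]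
    push_cast
    rw [← h1]
    have := H.2.1
    gcongr
    linarith
  obtain ⟨X, hX1, hX2, hX3⟩ := exists_isEBS hh hn r hrh
  refine ⟨X, hX1, hX2, maxLatency_le_ofReal hX3 ?_⟩
  have h2 := le_Lstar h ε (n ^ h)
  rw [Nat.cast_pow, mul_pow_rpow_one_div H.1.le (Nat.cast_nonneg n) hh] at h2
  have h3 := self_le_rpow_one_div H.1 H.2.1 hh
  have h4 : (1 / 8 : ℝ) * n ≤ ε ^ (1 / (h : ℝ)) * n := by gcongr; linarith
  have h5 : (h : ℝ) * (1 / 8 * n) ≤ h * (ε ^ (1 / (h : ℝ)) * n) := by gcongr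
  have h6 : ((n - 1 : ℕ) : ℝ) ≤ n := by exact_mod_cast Nat.sub_le n 1
  have h7 : (0 : ℝ) ≤ h * n := by positivity
  push_cast
  nlinarith

theorem succ_le_choose_add {h x : ℕ} (hh : 1 ≤ h) (hx : h ≤ x) : x + 1 ≤ x.choose h + h := by
  obtain ⟨k, rfl⟩ := Nat.exists_eq_add_of_le hx
  have h1 : (1 + k).choose k ≤ (h + k).choose k := Nat.choose_le_choose k (by omega)
  have h2 : (1 + k).choose k = k + 1 := by rw [add_comm]; exact Nat.choose_succ_self_right k
  have h3 : (h + k).choose k = (h + k).choose h := by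
    rw [Nat.choose_symm_add]
  omega

/-- The parameter `2 ε` is twice the required fraction of hop-efficient distances, because the
overlaps and the loss from `n ^ h` to `(n - 1) ^ h` may cost half of the count. The condition `ε ≤ 1
/ 8` keeps the overlaps that small. -/
theorem exists_isVBS_maxLatency_le {r : ℝ} (hr : 0 < r) {h : ℕ} {ε : ℝ} (hh : 1 ≤ h)
    (H : IsHopParam r h ε) (hε : ε ≤ 1 / 8) {n : ℕ} (hp : n.Prime) (hn1 : 4 * (h + 1) ≤ n)
    (hn2 : 1 ≤ 2 * ε * n) :
    ∃ X : Design (n ^ (h + 1)), X.IsVBS h n (2 * ε) ∧ X.GuaranteesThroughput r ∧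
      (X.maxLatency : ENNReal) ≤ ENNReal.ofReal (18 * Lstar h ε (n ^ (h + 1))) := by
  have hfact : Fact n.Prime := ⟨hp⟩
  have hε0 := H.1
  have hh1 : (1 : ℝ) ≤ h := by exact_mod_cast hh
  have hn1' : 4 * ((h : ℝ) + 1) ≤ n := by exact_mod_cast hn1
  have hn0 : (0 : ℝ) < n := by linarith
  have h1 := H.two_mul_mul_eq_one hr
  set δ := 2 * ε with hδ
  have hδn : δ * n ≤ n / 4 := by nlinarith
  have hne : ({Q : ℕ | δ * n ≤ (Q.choose h : ℝ)}).Nonempty := by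
    refine ⟨n + h, ?_⟩
    have h2 := succ_le_choose_add (x := n + h) hh (by omega)
    have h3 : (n : ℝ) ≤ ((n + h).choose h : ℝ) := by exact_mod_cast (by omega)
    change δ * n ≤ _
    linarith
  obtain ⟨Q, hQ⟩ : ∃ Q, IsLeast {Q : ℕ | δ * n ≤ (Q.choose h : ℝ)} Q :=
    ⟨_, Nat.sInf_mem hne, fun _ hQ => Nat.sInf_le hQ⟩
  have hQpos : 1 ≤ Q := by
    by_contra h0
    have : Q = 0 := by omega
    subst this
    have h2 := hQ.1
    rw [Set.mem_ofPred_eq, Nat.choose_eq_zero_of_lt (by omega), Nat.cast_zero] at h2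
    linarith
  have hQ1 : ((Q - 1).choose h : ℝ) < δ * n := by
    by_contra! hle
    have := hQ.2 hle
    omega
  -- By minimality `(Q - 1).choose h < δ n ≤ n / 4`, while this binomial coefficient is at least `Q
  -- - h`; as `h + 1 ≤ n / 4`, the number `Q` cannot be close to `n`.
  have hQn : h + 1 + Q < n := by
    by_contra hge
    have h2 := succ_le_choose_add (x := Q - 1) hh (by omega)
    have h3 : (n : ℝ) ≤ ((Q - 1).choose h : ℝ) + 2 * h + 1 := by exact_mod_cast (by omega)
    linarith
  have hm : ⌈δ * n⌉₊ ≤ Q.choose h := Nat.ceil_le.2 hQ.1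
  have hm1 := Nat.le_ceil (δ * n)
  have hm2 := Nat.ceil_lt_add_one (show 0 ≤ δ * n by linarith)
  set m := ⌈δ * n⌉₊ with hmdef
  -- Bernoulli's inequality gives `(n - 1) ^ h ≥ n ^ (h - 1) (n - h)`, which leaves `ε n ^ 2 ≤ m (n
  -- - h - m)`. This holds because `m ≥ 2 ε n` and `h + m ≤ n / 2`.
  have hkey : ε * (n : ℝ) ^ (h + 1) + m * m * (n : ℝ) ^ (h - 1) ≤ m * ((n : ℝ) - 1) ^ h := by
    obtain ⟨k, rfl⟩ : ∃ k, h = k + 1 := ⟨h - 1, by omega⟩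
    have hb : (n : ℝ) ^ k * (n - (k + 1 : ℕ)) ≤ ((n : ℝ) - 1) ^ (k + 1) := by
      have h2 := one_add_mul_le_pow (a := -(1 / (n : ℝ))) (by
        rw [neg_le_neg_iff, div_le_iff₀ hn0]; linarith) (k + 1)
      have h3 := mul_le_mul_of_nonneg_left h2 (show (0 : ℝ) ≤ n ^ (k + 1) by positivity)
      rw [← mul_pow] at h3
      calc _ = (n : ℝ) ^ (k + 1) * (1 + ((k + 1 : ℕ) : ℝ) * -(1 / n)) := by field_simp; ring
        _ ≤ _ := h3
        _ = _ := by congr 1; field_simp; ring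
    rw [Nat.add_sub_cancel]
    have h4 : ε * (n : ℝ) ^ 2 ≤ m * (n - (k + 1 : ℕ) - m) := by
      have h5 : (n : ℝ) / 2 ≤ n - (k + 1 : ℕ) - m := by linarith
      calc ε * (n : ℝ) ^ 2 = (δ * n) * (n / 2) := by rw [hδ]; ring
        _ ≤ _ := by gcongr
    have h6 := mul_le_mul_of_nonneg_left h4 (show (0 : ℝ) ≤ n ^ k by positivity)
    have h7 := mul_le_mul_of_nonneg_left hb (Nat.cast_nonneg (α := ℝ) m)
    calc ε * (n : ℝ) ^ (k + 1 + 1) + m * m * (n : ℝ) ^ k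
        = n ^ k * (ε * n ^ 2) + m * m * n ^ k := by ring
      _ ≤ n ^ k * (m * (n - (k + 1 : ℕ) - m)) + m * m * n ^ k := by gcongr
      _ = m * (n ^ k * (n - (k + 1 : ℕ))) := by ring
      _ ≤ _ := h7
  have hlat : ((n - 1 + 2 * ((h + 1 + Q) * (n - 1)) : ℕ) : ℝ) ≤ 18 * Lstar h ε (n ^ (h + 1)) := by
    set y := (δ * n) ^ (1 / (h : ℝ)) with hy
    have hy1 : 1 ≤ y := Real.one_le_rpow hn2 (by positivity)
    have hyh : y ^ h = δ * n := by
      rw [hy, one_div, Real.rpow_inv_natCast_pow (by positivity) (by omega)]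
    -- By minimality of `Q`, `(Q - h) ^ h ≤ h! * (Q - 1).choose h ≤ h ^ h * y ^ h`.
    have hQy : (Q : ℝ) ≤ h + h * y := by
      rcases le_total Q h with hle | hle
      · have : (Q : ℝ) ≤ h := by exact_mod_cast hle
        nlinarith
      · have h2 : ((Q - 1 + 1 - h : ℕ) : ℝ) ^ h ≤ h.factorial * ((Q - 1).choose h : ℝ) := by
          have := Nat.pow_sub_le_descFactorial (Q - 1) h
          rw [Nat.descFactorial_eq_factorial_mul_choose] at this
          exact_mod_cast this
        have h3 : ((Q - 1 + 1 - h : ℕ) : ℝ) = Q - h := by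
          rw [Nat.sub_add_cancel hQpos, Nat.cast_sub hle]
        rw [h3] at h2
        have h4 : ((Q : ℝ) - h) ^ h ≤ (h * y) ^ h := by
          refine h2.trans ?_
          rw [mul_pow, hyh]
          have : (h.factorial : ℝ) ≤ (h : ℝ) ^ h := by exact_mod_cast Nat.factorial_le_pow h
          gcongr
        have := le_of_pow_le_pow_left₀ (by omega) (by positivity) h4
        linarith
    have h5 : y * n ≤ 2 * (ε * (n ^ (h + 1) : ℕ)) ^ (1 / (h : ℝ)) := by
      have h6 : y ≤ 2 * (ε * n) ^ (1 / (h : ℝ)) := by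
        rw [hy, hδ, mul_assoc, Real.mul_rpow (by norm_num) (by positivity)]
        gcongr
        have : (2 : ℝ) ^ (1 / (h : ℝ)) ≤ 2 ^ (1 : ℝ) :=
          Real.rpow_le_rpow_of_exponent_le (by norm_num)
            (by rw [div_le_one (by linarith)]; exact hh1)
        simpa using this
      have h7 : ε * ((n ^ (h + 1) : ℕ) : ℝ) = ε * n * n ^ h := by push_cast; ring
      rw [h7, mul_pow_rpow_one_div (by positivity) hn0.le hh, ← mul_assoc]
      gcongr
    have h8 := le_Lstar h ε (n ^ (h + 1))
    have h9 : ((n - 1 : ℕ) : ℝ) ≤ n := by exact_mod_cast Nat.sub_le n 1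
    calc ((n - 1 + 2 * ((h + 1 + Q) * (n - 1)) : ℕ) : ℝ)
        = ((n - 1 : ℕ) : ℝ) * (1 + 2 * (h + 1 + Q)) := by push_cast; ring
      -- `1 + 2 (h + 1 + Q) ≤ 3 + 4 h + 2 h y ≤ 9 h y`, as `h` and `y` are at least `1`.
      _ ≤ n * (9 * (h * y)) := by
          gcongr
          nlinarith
      _ = 9 * h * (y * n) := by ring
      _ ≤ 9 * h * (2 * (ε * (n ^ (h + 1) : ℕ)) ^ (1 / (h : ℝ))) := by gcongr
      _ = 18 * (h * (ε * (n ^ (h + 1) : ℕ)) ^ (1 / (h : ℝ))) := by ring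
      _ ≤ _ := by gcongr
  lift r to ℝ≥0 using hr.le
  obtain ⟨X, hX1, hX2, hX3⟩ := exists_isVBS (n := n) hh (show 0 < δ by positivity) hQ hQn hm r (by
    have h2 : (0 : ℝ) ≤ 2 * r := by positivity
    calc _ ≤ 2 * (r : ℝ) * ((h + 1 - ε) * (n : ℝ) ^ (h + 1)) :=
          mul_le_mul_of_nonneg_left (by linarith) h2
      _ = (2 * (r : ℝ) * (h + 1 - ε)) * (n : ℝ) ^ (h + 1) := by ring
      _ = _ := by rw [h1, one_mul])
  exact ⟨X, hX1, hX2, maxLatency_le_ofReal hX3 hlat⟩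

theorem infinite_setOf_design {r : ℝ} (hr : 0 < r) {h : ℕ} {ε : ℝ} (hh : 1 ≤ h)
    (H : IsHopParam r h ε) :
    {N : ℕ | ∃ X : Design N,
      ((∃ ℓ n : ℕ, X.IsEBS ℓ n) ∨ (∃ (h' n : ℕ) (δ : ℝ), X.IsVBS h' n δ)) ∧
      X.GuaranteesThroughput r ∧
      (X.maxLatency : ENNReal) ≤ ENNReal.ofReal (18 * Lstar h ε N)}.Infinite := by
  refine Set.infinite_of_forall_exists_gt fun a => ?_
  rcases lt_or_ge (1 / 8) ε with hε | hε
  · obtain ⟨X, h1, h2, h3⟩ :=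
      exists_isEBS_maxLatency_le hr hh H hε (show 2 ≤ a + 2 by omega)
    exact ⟨_, ⟨X, Or.inl ⟨_, _, h1⟩, h2, h3⟩,
      lt_of_lt_of_le (by omega) (Nat.le_self_pow (by omega) (a + 2))⟩
  -- Any prime `n ≥ M` satisfies `1 ≤ 2 ε n`; the other summands in the choice of `n` ensure `n > a`
  -- and `n ≥ 4 (h + 1)`.
  · obtain ⟨M, hM⟩ := exists_nat_gt (1 / (2 * ε))
    rw [div_lt_iff₀ (by linarith [H.1])] at hM
    obtain ⟨n, hn, hp⟩ := Nat.exists_infinite_primes (a + 1 + M + 4 * (h + 1))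
    obtain ⟨X, h1, h2, h3⟩ := exists_isVBS_maxLatency_le hr hh H hε hp (by omega) (by
      have h4 : (M : ℝ) ≤ n := by exact_mod_cast (by omega)
      nlinarith [H.1])
    exact ⟨_, ⟨X, Or.inr ⟨_, _, _, h1⟩, h2, h3⟩,
      lt_of_lt_of_le (by omega) (Nat.le_self_pow (by omega) n)⟩

end ORN

end

theorem theorem1 :
    ∃ c C : ℝ, 0 < c ∧ 0 < C ∧ ∀ r : ℝ, 0 < r → r ≤ 1 / 2 →
      (∃! p : ℕ × ℝ, ORN.IsHopParam r p.1 p.2) ∧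
      ∀ (h : ℕ) (ε : ℝ), ORN.IsHopParam r h ε →
        (∃ c' : ℝ, 0 < c' ∧ ∀ N : ℕ, 1 < N → ∀ X : ORN.Design N, X.GuaranteesThroughput r →
          ENNReal.ofReal (c' * ORN.Lstar h ε N) ≤ (X.maxLatency : ENNReal)) ∧
        (∃ N₀ : ℕ, ∀ N : ℕ, N₀ ≤ N → ∀ X : ORN.Design N, X.GuaranteesThroughput r →
          ENNReal.ofReal (c * ORN.Lstar h ε N) ≤ (X.maxLatency : ENNReal)) ∧
        {N : ℕ | ∃ X : ORN.Design N,
          ((∃ ℓ n : ℕ, X.IsEBS ℓ n) ∨ (∃ (h' n : ℕ) (δ : ℝ), X.IsVBS h' n δ)) ∧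
          X.GuaranteesThroughput r ∧
          (X.maxLatency : ENNReal) ≤ ENNReal.ofReal (C * ORN.Lstar h ε N)}.Infinite := by
  refine ⟨1 / 48, 18, by norm_num, by norm_num, fun r hr hr2 =>
    ⟨ORN.existsUnique_isHopParam hr, fun h ε H => ⟨?_, ?_, ?_⟩⟩⟩
  · exact ORN.exists_const_Lstar_le_maxLatency hr hr2 H
  · exact ORN.exists_forall_Lstar_le_maxLatency hr hr2 H
  · exact ORN.infinite_setOf_design hr (H.one_le hr hr2) H
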